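/- Fix an integer $\mu\ge 2$ (MIN_ARITY; MAX_ARITY is $2\mu$). A FiBA window stores entries $(t,v)$, with $t$ in a totally ordered set and $v$ in a monoid $(V,\otimes,1)$, in a B-tree: all leaves have the same depth; a node of arity $a$ holds $a-1$ entries and, if it is not a leaf, $a$ children; timestamps strictly increase in the left-to-right order of the tree; non-root nodes have arity between $\mu$ and $2\mu$, the root has arity between $2$ and $2\mu$ (or is a leaf without entries if the window is empty). Parent pointers and pointers to the leftmost and rightmost leaf (the fingers) are available. Each node stores a partial aggregate: off the spines, the product of everything in its subtree (up aggregate); at the root, the product of its values and its inner children (inner aggregate); on the left (right) spine, the product of the part of its subtree outside its own leftmost (rightmost) child, combined with the aggregate of its parent unless the parent is the root. $\mathrm{bulkInsert}(B)$, for a bulk $B$ of $m\ge1$ entries with strictly increasing timestamps, adds the entries of $B$ to the window, where for a timestamp that is already present the new value is multiplied to the old one from the right. It works as follows. (1) Search: walk up from the right finger to the lowest right-spine node whose first timestamp is at most the earliest timestamp of $B$ (or to the root), then find the sites of all entries of $B$ in the subtree of that node in timestamp order, going from one site to the next through their least common ancestor. New timestamps belong to leaves, present ones to the node that contains them. (2)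 Pass up: for each affected node, from the leaves upwards, interleave the contents of the node with the entries destined for it; if its arity becomes $p>2\mu$, split it into nodes of arity $\mu+1$ and one last node of arity between $\mu$ and $2\mu$, and promote the entries between these nodes, with the new nodes, to the parent (to a new root if the root was split); recompute up and inner aggregates. This continues until nothing is promoted and, in the subtree where the search took place, the aggregates are up to date. (3) Pass down: repair the right aggregates on the right spine below the highest processed node and, if the bulk reaches the left spine or the root was split, the left aggregates on the left spine. $\mathrm{bulkEvict}(t)$ removes all entries with timestamps at most $t$: it cuts the tree along the path to $t$ and repairs underflows from the bottom up, by moving entries and children from the right neighbor of the underfull node if the deficit of the node is at most the surplus of the neighbor over $\mu$, and by merging the node into that neighbor otherwise; a right-spine node without right neighbor, or its only child, becomes the root. For an insertion of a bulk of size $m$ into a window of $n$ entries, let $d$ be the out-of-order distance of the earliest entry of the bulk, i.e. the number of entries of the window with a later timestamp, and let $\log^+x=\max(0,\log x)$, $\log^+0=0$. Time is the number of elementary steps (following a pointer, comparing timestamps, moving an entry or a child, handing over a promoted entry, applying $\otimes$). Theorem. For every $\mu\ge 2$ there is a constant $C$, depending only on $\mu$, such that for every totally ordered set of timestamps and every monoid: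 (a) (amortized time) in every finite sequence of operations $\mathrm{bulkInsert}$ and $\mathrm{bulkEvict}$ that starts from the empty window, the total time of the bulk insertions is at most $C\sum\bigl(\log^+ d+m\,(1+\log^+\tfrac dm)\bigr)$, where the sum runs over the bulk insertions of the sequence, with $d$ and $m$ taken at each of them; (b) (worst-case time) every single $\mathrm{bulkInsert}$ into a window that satisfies the height, order and arity invariants takes time at most $C\bigl(\log^+ d+m\,(1+\log\tfrac{m+n}{m})\bigr)$. -/

import Mathlib

universe u

namespace FiBA

/-! ### Running time

A computation of type `Timed α` returns a value together with the number of elementary steps it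
took.  Elementary steps are: following a pointer, comparing two timestamps, moving one entry or one
child pointer, creating or handing over one treelet, one application of the monoid operation. -/

/-- A result together with the number of elementary steps spent on it. -/
structure Timed (α : Type u) where
  val : α
  time : ℕ

instance : Monad Timed.{u} where
  pure a := ⟨a, 0⟩
  bind x f := ⟨(f x.val).val, x.time + (f x.val).time⟩

/-- Spend `k` elementary steps. -/
def tick (k : ℕ) : Timed PUnit.{u + 1} := ⟨PUnit.unit, k⟩

/-! ### The data structure -/

/-- A node with children of type `C`: a stored partial aggregate, a first child `c₀`, and the list
`(⟨t₀, v₀⟩, c₁), (⟨t₁, v₁⟩, c₂), …` of entries, each with the child that follows it. -/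
structure Node (T V C : Type u) where
  agg : V
  first : C
  rest : List ((T × V) × C)

/-- Trees in which all leaves have the same depth.  `Tree T V 0` is the null pointer, so a leaf is
a `Tree T V 1`, a node of arity `a` with `a - 1` entries and only null children. -/
def Tree (T V : Type u) : ℕ → Type u
  | 0 => PUnit
  | h + 1 => Node T V (Tree T V h)

section basics

variable {T V C : Type u}

/-- The arity: one more than the number of entries. -/
def Node.arity (y : Node T V C) : ℕ := y.rest.length + 1

/-- The last child. -/
def Node.last (y : Node T V C) : C := (y.rest.getLast?.map Prod.snd).getD y.first

/-- Replace the last entry's child. -/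
def setLastAux (c : C) : List ((T × V) × C) → List ((T × V) × C)
  | [] => []
  | [p] => [(p.1, c)]
  | p :: q :: r => p :: setLastAux c (q :: r)

/-- Replace the last child. -/
def Node.setLast (y : Node T V C) (c : C) : Node T V C :=
  match y.rest with
  | [] => { y with first := c }
  | p :: r => { y with rest := setLastAux c (p :: r) }

/-- The entries of a tree, from left to right. -/
def Tree.toList : (h : ℕ) → Tree T V h → List (T × V)
  | 0, _ => []
  | h + 1, y => Tree.toList h y.first ++ y.rest.flatMap fun p => p.1 :: Tree.toList h p.2

/-- The arity invariant for a subtree below the root: every node has arity between `μ` and `2μ`. -/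
def Tree.ArityOK (μ : ℕ) : (h : ℕ) → Tree T V h → Prop
  | 0, _ => True
  | h + 1, y => μ ≤ Node.arity y ∧ Node.arity y ≤ 2 * μ ∧
      Tree.ArityOK μ h y.first ∧ ∀ p ∈ y.rest, Tree.ArityOK μ h p.2

end basics

/-- A window: a tree of some height, given by its root. -/
structure Window (T V : Type u) where
  height : ℕ
  root : Tree T V (height + 1)

section window

variable {T V : Type u}

/-- The contents of the window, from left to right. -/
def Window.entries (F : Window T V) : List (T × V) := F.root.toList

/-- The empty window: a root without entries. -/
def Window.empty [Monoid V] : Window T V := ⟨0, (⟨1, PUnit.unit, []⟩ : Node T V PUnit)⟩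

/-- The arity invariants: the root has arity between `2` and `2μ` (or it is a leaf without entries,
if the window is empty), all other nodes have arity between `μ` and `2μ`. -/
def Window.ArityOK (μ : ℕ) (F : Window T V) : Prop :=
  ((2 ≤ Node.arity F.root ∧ Node.arity F.root ≤ 2 * μ) ∨ (F.height = 0 ∧ F.root.rest = [])) ∧
    Tree.ArityOK μ F.height F.root.first ∧ ∀ p ∈ F.root.rest, Tree.ArityOK μ F.height p.2

/-- The height, order and arity invariants.  The height invariant is part of the type.  The order
invariant says that the timestamps strictly increase from left to right. -/
def Window.Valid [LinearOrder T] (μ : ℕ) (F : Window T V) : Prop :=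
  F.ArityOK μ ∧ F.entries.Pairwise fun a b => a.1 < b.1

end window

/-! ### Location-sensitive partial aggregates -/

section aggregates

variable {T V : Type u} [Monoid V]

/-- The aggregate stored at a node; the neutral element for a null pointer. -/
def Tree.agg : (h : ℕ) → Tree T V h → V
  | 0, _ => 1
  | _ + 1, y => Node.agg y

/-- `v₀ ⊗ Π(c₁) ⊗ v₁ ⊗ … ⊗ Π(c_{a-2}) ⊗ v_{a-2}`: all entries and the inner children. -/
def innerAgg (h : ℕ) : List ((T × V) × Tree T V h) → V
  | [] => 1
  | [p] => p.1.2
  | p :: q :: r => p.1.2 * p.2.agg * innerAgg h (q :: r)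

/-- `Π(c₀) ⊗ v₀ ⊗ … ⊗ v_{a-2} ⊗ Π(c_{a-1})`: all entries and all children. -/
def upAgg (h : ℕ) (c : Tree T V h) (r : List ((T × V) × Tree T V h)) : V :=
  c.agg * (r.map fun p => p.1.2 * p.2.agg).prod

/-- Repair the left aggregates of the nodes of height at most `top` on the left spine of a subtree,
on the way down; `x` is the left aggregate of the parent (the neutral element below the root). -/
def repairLeft (top : ℕ) : (h : ℕ) → V → Tree T V h → Timed (Tree T V h)
  | 0, _, y => pure y
  | h + 1, x, y => do
      let a ← if h + 1 ≤ top then do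
          tick (2 * Node.arity y + 1)
          pure (innerAgg h y.rest * (Node.last y).agg * x)
        else pure y.agg
      let c ← repairLeft top h a y.first
      pure (⟨a, c, y.rest⟩ : Node T V (Tree T V h))

/-- Repair the right aggregates of the nodes of height at most `top` on the right spine of a
subtree, on the way down; `x` is the right aggregate of the parent (the neutral element below the
root). -/
def repairRight (top : ℕ) : (h : ℕ) → V → Tree T V h → Timed (Tree T V h)
  | 0, _, y => pure y
  | h + 1, x, y => do
      let a ← if h + 1 ≤ top then do
          tick (2 * Node.arity y + 1)
          pure (x * y.first.agg * innerAgg h y.rest)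
        else pure y.agg
      let c ← repairRight top h a (Node.last y)
      pure (Node.setLast (⟨a, y.first, y.rest⟩ : Node T V (Tree T V h)) c)

/-- The pass down: repair the right spine from height `top` down to the right finger and, if
`left` is set, the left spine from the root down to the left finger. -/
def passDown (top : ℕ) (left : Bool) (F : Window T V) : Timed (Window T V) := do
  let c ← repairRight top F.height 1 (Node.last F.root)
  let y : Node T V (Tree T V F.height) := Node.setLast F.root c
  if left then do
    let c' ← repairLeft F.height F.height 1 y.first
    pure ⟨F.height, (⟨y.agg, c', y.rest⟩ : Node T V (Tree T V F.height))⟩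
  else
    pure ⟨F.height, y⟩

/-- Store the up aggregate at every node of a subtree. -/
def Tree.refreshUp : (h : ℕ) → Tree T V h → Tree T V h
  | 0, y => y
  | h + 1, y =>
      let c := Tree.refreshUp h y.first
      let r := y.rest.map fun p => (p.1, Tree.refreshUp h p.2)
      (⟨upAgg h c r, c, r⟩ : Node T V (Tree T V h))

/-- Store at every node the aggregate that the aggregates invariants prescribe: the inner aggregate
at the root, left and right aggregates on the spines, up aggregates elsewhere. -/
def Window.refresh (F : Window T V) : Window T V :=
  let y : Node T V (Tree T V F.height) := Tree.refreshUp (F.height + 1) F.root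
  (passDown F.height true
    ⟨F.height, (⟨innerAgg F.height y.rest, y.first, y.rest⟩ : Node T V (Tree T V F.height))⟩).val

end aggregates

/-! ### Bulk insertion, step 1: insertion sites search -/

section search

variable {T V C S : Type u} [LinearOrder T]

/-- The events found below a node: what happens in the first child, and then, entry by entry, the
value to be combined with the entry (if its timestamp occurs in the bulk) and what happens in the
child after it.  Children that receive nothing have `none`, and the list stops with the last entry
that had to be looked at. -/
structure SiteNode (V S : Type u) where
  first : Option S
  rest : List (Option V × Option S)

/-- The result of the search, in timestamp order and grouped by the node that is to be changed.  At
a null pointer: the new entries that belong there. -/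
def Sites (T V : Type u) : ℕ → Type u
  | 0 => List (T × V)
  | h + 1 => SiteNode V (Sites T V h)

/-- Whether there is a next entry in the bulk and its timestamp lies before `hi`. -/
def before (hi : WithTop T) : List (T × V) → Bool
  | [] => false
  | b :: _ => decide ((b.1 : WithTop T) < hi)

/-- Read the entries of the bulk before `hi`; returns them and the remaining bulk. -/
def takeBefore (hi : WithTop T) : List (T × V) → Timed (List (T × V) × List (T × V))
  | [] => pure ([], [])
  | b :: B => do
      tick 1
      if (b.1 : WithTop T) < hi then do
        let p ← takeBefore hi B
        pure (b :: p.1, p.2)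
      else pure ([], b :: B)

/-- Go down into a child whose timestamps lie before `hi`, if the next entry belongs there. -/
def enter (descend : WithTop T → C → List (T × V) → Timed (S × List (T × V)))
    (hi : WithTop T) (c : C) (B : List (T × V)) : Timed (Option S × List (T × V)) :=
  if before hi B then do
    let p ← descend hi c B
    pure (some p.1, p.2)
  else pure (none, B)

/-- If the next entry of the bulk has timestamp `t`, take its value. -/
def matchEntry (t : T) : List (T × V) → Option V × List (T × V)
  | [] => (none, [])
  | b :: B => if b.1 = t then (some b.2, B) else (none, b :: B)

/-- Scan a node from left to right, going down into the children that receive entries, until the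
next entry of the bulk is not before `hi`, the upper end of the range of the node. -/
def scan (descend : WithTop T → C → List (T × V) → Timed (S × List (T × V))) (hi : WithTop T) :
    C → List ((T × V) × C) → List (T × V) → Timed (SiteNode V S × List (T × V))
  | c, [], B => do
      tick 1
      let p ← enter descend hi c B
      pure (⟨p.1, []⟩, p.2)
  | c, e :: r, B => do
      tick 1
      let p ← enter descend (e.1.1 : WithTop T) c B
      let q := matchEntry e.1.1 p.2
      if before hi q.2 then do
        let w ← scan descend hi e.2 r q.2
        pure (⟨p.1, (q.1, w.1.first) :: w.1.rest⟩, w.2)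
      else pure (⟨p.1, [(q.1, none)]⟩, q.2)

/-- Find the sites of all entries of the bulk before `hi` in the given subtree.  The bulk is read
once; between the sites of consecutive entries the search goes up to their least common ancestor
and down again.  Nothing is modified. -/
def search : (h : ℕ) → WithTop T → Tree T V h → List (T × V) →
    Timed (Sites T V h × List (T × V))
  | 0, hi, _, B => takeBefore hi B
  | h + 1, hi, y, B => scan (search h) hi y.first y.rest B

/-- Whether the first timestamp in the node is at most `t`. -/
def Node.startsBy (y : Node T V C) (t : T) : Bool :=
  match y.rest with
  | [] => false
  | e :: _ => decide (e.1.1 ≤ t)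

/-- The height of the lowest node on the right spine whose first timestamp is at most `t`. -/
def lowestOnSpine (t : T) : (h : ℕ) → Tree T V (h + 1) → Option ℕ
  | 0, y => if Node.startsBy y t then some 1 else none
  | h + 1, y => (lowestOnSpine t h (Node.last y)).or
      (if Node.startsBy y t then some (h + 2) else none)

/-- The height of the node at which the walk up from the right finger stops: the lowest node on the
right spine whose first timestamp is at most `t`, or the root.  This is also the number of nodes
that the walk looks at. -/
def fingerWalk (t : T) (F : Window T V) : ℕ :=
  (lowestOnSpine t F.height F.root).getD (F.height + 1)

end search

/-! ### Bulk insertion, step 2: the interleave&split pass up -/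

section passup

variable {T V C S : Type u} [LinearOrder T] [Monoid V]

/-- A treelet for a target whose children have type `C`: either an entry to be inserted, with the
child that follows it, or an entry of the bulk whose timestamp is already present in the target. -/
inductive Treelet (T V C : Type u) where
  | insertion (entry : T × V) (child : C)
  | recomputation (entry : T × V)

/-- Whether a treelet is a recomputation event. -/
def Treelet.isRecomputation : Treelet T V C → Bool
  | .insertion _ _ => false
  | .recomputation _ => true

/-- Interleave the contents of a node with the treelets that target it, as in merge sort. -/
def interleave : List ((T × V) × C) → List (Treelet T V C) → Timed (List ((T × V) × C))
  | r, [] => pure r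
  | [], .insertion e c :: L => do
      tick 1
      let r ← interleave [] L
      pure ((e, c) :: r)
  | [], .recomputation _ :: L => do
      tick 1
      interleave [] L
  | p :: r, .insertion e c :: L => do
      tick 1
      if e.1 < p.1.1 then do
        let r' ← interleave (p :: r) L
        pure ((e, c) :: r')
      else do
        let r' ← interleave r (.insertion e c :: L)
        pure (p :: r')
  | p :: r, .recomputation e :: L => do
      tick 1
      if e.1 = p.1.1 then do
        let r' ← interleave r L
        pure (((p.1.1, p.1.2 * e.2), p.2) :: r')
      else do
        let r' ← interleave r (.recomputation e :: L)
        pure (p :: r')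
termination_by r L => r.length + L.length

/-- Whether a node lies on the left and on the right spine; the root lies on both. -/
structure Loc where
  left : Bool
  right : Bool

/-- Build a node and compute the aggregates that depend on children only: the up aggregate off the
spines and the inner aggregate at the root.  Left and right aggregates are left to the pass down. -/
def mkNode (h : ℕ) (loc : Loc) (c : Tree T V h) (r : List ((T × V) × Tree T V h)) :
    Timed (Tree T V (h + 1)) := do
  tick (2 * r.length + 2)
  pure (⟨match loc.left, loc.right with
    | false, false => upAgg h c r
    | true, true => innerAgg h r
    | _, _ => 1, c, r⟩ : Node T V (Tree T V h))

/-- The number of arity-`(μ + 1)` nodes that a node of arity `p > 2μ` is split into, besides the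
last node, whose arity is between `μ` and `2μ`. -/
def splitCount (μ p : ℕ) : ℕ :=
  if p % (μ + 1) = μ then p / (μ + 1) else p / (μ + 1) - 1

/-- Cut off `k` nodes of arity `μ + 1`, with one entry between consecutive nodes.  The nodes after
the first one come as treelets for the parent. -/
def bulkSplit (μ h : ℕ) (left right : Bool) : ℕ → Tree T V h → List ((T × V) × Tree T V h) →
    Timed (Tree T V (h + 1) × List (Treelet T V (Tree T V (h + 1))))
  | 0, c, r => do
      let y ← mkNode h ⟨left, right⟩ c r
      pure (y, [])
  | k + 1, c, r =>
      match r.drop μ with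
      | [] => do
          let y ← mkNode h ⟨left, right⟩ c r
          pure (y, [])
      | p :: r' => do
          tick (μ + 1)
          let y ← mkNode h ⟨left, false⟩ c (r.take μ)
          let q ← bulkSplit μ h false right k p.2 r'
          pure (y, .insertion p.1 q.1 :: q.2)

/-- Process one target: interleave its contents with its treelets, and split it if its arity
exceeds `2μ`.  Returns the node that stays in place and the treelets for its parent. -/
def processTarget (μ h : ℕ) (loc : Loc) (c : Tree T V h) (r : List ((T × V) × Tree T V h))
    (L : List (Treelet T V (Tree T V h))) :
    Timed (Tree T V (h + 1) × List (Treelet T V (Tree T V (h + 1)))) := do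
  tick 1
  let r' ← interleave r L
  if r'.length + 1 ≤ 2 * μ then do
    let y ← mkNode h loc c r'
    pure (y, [])
  else
    bulkSplit μ h loc.left loc.right (splitCount μ (r'.length + 1)) c r'

/-- Process the events in a child, if there are any. -/
def visit (up : Loc → C → S → Timed (C × List (Treelet T V C))) (loc : Loc) (c : C) :
    Option S → Timed (C × List (Treelet T V C))
  | none => pure (c, [])
  | some s => do
      let p ← up loc c s
      tick (p.2.length + 1)
      pure p

/-- Process the events in all children of a node and gather, in timestamp order, the treelets that
target the node. -/
def gather (up : Loc → C → S → Timed (C × List (Treelet T V C))) (left right : Bool) :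
    C → List ((T × V) × C) → SiteNode V S →
      Timed ((C × List ((T × V) × C)) × List (Treelet T V C))
  | c, [], s => do
      let p ← visit up ⟨left, right⟩ c s.first
      pure ((p.1, []), p.2)
  | c, e :: r, ⟨s, []⟩ => do
      let p ← visit up ⟨left, false⟩ c s
      pure ((p.1, e :: r), p.2)
  | c, e :: r, ⟨s, w :: ws⟩ => do
      tick 1
      let p ← visit up ⟨left, false⟩ c s
      let q ← gather up false right e.2 r ⟨w.2, ws⟩
      pure ((p.1, (e.1, q.1.1) :: q.1.2),
        p.2 ++ (w.1.map fun v => .recomputation (e.1.1, v)).toList ++ q.2)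

/-- The pass up in a subtree: a node becomes a target once the targets below it are done; it gets
their promoted entries and the recomputation events for its own entries.  At a null pointer, the
new entries become the treelets that target the leaf above.  A recomputation event rides along with
the treelets of all levels below its node, which costs one step for each level. -/
def passUp (μ : ℕ) : (h : ℕ) → Loc → Tree T V h → Sites T V h →
    Timed (Tree T V h × List (Treelet T V (Tree T V h)))
  | 0, _, y, s => do
      tick (List.length (α := T × V) s)
      pure (y, List.map (fun e : T × V => .insertion e y) s)
  | h + 1, loc, y, s => do
      let p ← gather (passUp μ h) loc.left loc.right y.first y.rest s
      tick ((h + 1) * p.2.countP Treelet.isRecomputation)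
      processTarget μ h loc p.1.1 p.1.2 p.2

/-- Search and pass up on the subtree whose root is the node of height `k` on the right spine, and
pass up from there as long as there are treelets.  Returns the new node, the treelets for its
parent, and the height of the highest node that was processed.

The recursion leads from the root to the node of height `k`; the algorithm itself is at that node
already, after its walk up from the right finger, and reaches the nodes above it through parent
pointers.  So a node above it takes time only if it is the target of some treelet. -/
def passUpSpine (μ k : ℕ) (B : List (T × V)) : (h : ℕ) → Loc → Tree T V (h + 1) →
    Timed ((Tree T V (h + 1) × List (Treelet T V (Tree T V (h + 1)))) × ℕ)
  | 0, loc, y => do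
      let s ← search 1 ⊤ y B
      let p ← passUp μ 1 loc y s.1
      pure (p, 1)
  | h + 1, loc, y =>
      if h + 2 ≤ k then do
        let s ← search (h + 2) ⊤ y B
        let p ← passUp μ (h + 2) loc y s.1
        pure (p, h + 2)
      else do
        let p ← passUpSpine μ k B h ⟨false, loc.right⟩ (Node.last y)
        let y' : Node T V (Tree T V (h + 1)) := Node.setLast y p.1.1
        if p.1.2.isEmpty then
          pure ((y', []), p.2)
        else do
          let q ← processTarget μ (h + 1) loc y'.first y'.rest p.1.2
          pure (q, h + 2)

/-- While there are treelets promoted out of the root, put a new root on top, which is their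
target.  Each round leaves fewer treelets, so that a number of rounds equal to the number of
treelets suffices. -/
def growRoot (μ : ℕ) : ℕ → (h : ℕ) → Tree T V (h + 1) → List (Treelet T V (Tree T V (h + 1))) →
    Timed (Window T V)
  | 0, h, y, _ => pure ⟨h, y⟩
  | n + 1, h, y, L =>
      if L.isEmpty then pure ⟨h, y⟩
      else do
        let p ← processTarget μ (h + 1) ⟨true, true⟩ y [] L
        growRoot μ n (h + 1) p.1 p.2

/-- `bulkInsert`, for a bulk in increasing timestamp order: insertion sites search from the right
finger, pass up, and pass down the right spine from the highest node that was processed; the left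
spine is repaired if the bulk reaches it or if the root was split. -/
def bulkInsert (μ : ℕ) (F : Window T V) : List (T × V) → Timed (Window T V)
  | [] => pure F
  | b :: B => do
      let k := fingerWalk b.1 F
      tick k
      let p ← passUpSpine μ k (b :: B) F.height ⟨true, true⟩ F.root
      let G ← growRoot μ p.1.2.length F.height p.1.1 p.1.2
      if F.height < G.height then
        passDown G.height true G
      else
        passDown p.2 (decide (k = F.height + 1) && !(Node.startsBy F.root b.1)) G

end passup

/-! ### Bulk eviction

Only the effect of `bulkEvict` on the tree is needed, not its running time. -/

section evict

variable {T V C : Type u} [LinearOrder T] [Monoid V]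

/-- What is left of a node after its local eviction: either `t` is one of its timestamps and
nothing below needs to change, or the eviction boundary runs through its new first child. -/
inductive Cut (T V C : Type u) where
  | exact (c : C) (r : List ((T × V) × C))
  | inside (c : C) (r : List ((T × V) × C))

/-- Local eviction: drop all entries with timestamps at most `t` and the children before them. -/
def cut (t : T) : C → List ((T × V) × C) → Cut T V C
  | c, [] => .inside c []
  | c, p :: r =>
      if t < p.1.1 then .inside c (p :: r)
      else if p.1.1 = t then .exact p.2 r
      else cut t p.2 r

/-- Repair an underflow of the node with children and entries `c, r` by means of its right neighbor
`z`, where `e` is the entry between the two in their least common ancestor.  If the deficit of the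
node is at most the surplus of `z`, a batch is moved from `z` to the node; otherwise the node is
merged into `z`.  Returns what is left of the node and the new separating entry (nothing after a
merge), and the new neighbor. -/
def rebalance (μ : ℕ) (c : C) (r : List ((T × V) × C)) (e : T × V) (z : Node T V C) :
    Option (Node T V C × (T × V)) × Node T V C :=
  if μ ≤ r.length + 1 then (some (⟨1, c, r⟩, e), z)
  else
    let k := μ - (r.length + 1)
    if k ≤ z.arity - μ then
      match z.rest.drop (k - 1) with
      | [] => (some (⟨1, c, r⟩, e), z)
      | p :: r' => (some (⟨1, c, r ++ (e, z.first) :: z.rest.take (k - 1)⟩, p.1), ⟨1, p.2, r'⟩)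
    else (none, ⟨1, c, r ++ (e, z.first) :: z.rest⟩)

/-- Evict up to `t` in the subtree `x`, through which the eviction boundary runs; `z` is the
neighbor of `x` to the right, at the same height, and `e` the entry between them. -/
def evictPair (μ : ℕ) (t : T) : (h : ℕ) → Tree T V h → T × V → Tree T V h →
    Option (Tree T V h × (T × V)) × Tree T V h
  | 0, x, e, z => (some (x, e), z)
  | h + 1, x, e, z =>
      match cut t x.first x.rest with
      | .exact c r => rebalance μ c r e z
      | .inside c (p :: r) =>
          match evictPair μ t h c p.1 p.2 with
          | (some q, c') => rebalance μ q.1 ((q.2, c') :: r) e z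
          | (none, c') => rebalance μ c' r e z
      | .inside c [] =>
          match evictPair μ t h c e z.first with
          | (some q, z₀) =>
              rebalance μ q.1 [] q.2 (⟨z.agg, z₀, z.rest⟩ : Node T V (Tree T V h))
          | (none, z₀) => (none, (⟨z.agg, z₀, z.rest⟩ : Node T V (Tree T V h)))

/-- Make a node the root, or its only child if it has no entries and is not a leaf. -/
def makeRoot : (h : ℕ) → Tree T V h → List ((T × V) × Tree T V h) → Window T V
  | 0, c, r => ⟨0, (⟨1, c, r⟩ : Node T V (Tree T V 0))⟩
  | h + 1, c, [] => ⟨h, c⟩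
  | h + 1, c, p :: r => ⟨h + 1, (⟨1, c, p :: r⟩ : Node T V (Tree T V (h + 1)))⟩

/-- Evict up to `t` in a node of the right spine all ancestors of which are gone, or in the root. -/
def evictRoot (μ : ℕ) (t : T) : (h : ℕ) → Tree T V (h + 1) → Window T V
  | 0, y =>
      match cut t y.first y.rest with
      | .exact c r => makeRoot 0 c r
      | .inside c r => makeRoot 0 c r
  | h + 1, y =>
      match cut t y.first y.rest with
      | .exact c r => makeRoot (h + 1) c r
      | .inside c [] => evictRoot μ t h c
      | .inside c (p :: r) =>
          match evictPair μ t (h + 1) c p.1 p.2 with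
          | (some q, c') => makeRoot (h + 1) q.1 ((q.2, c') :: r)
          | (none, c') => makeRoot (h + 1) c' r

/-- `bulkEvict t` removes all entries with timestamps at most `t`. -/
def bulkEvict (μ : ℕ) (t : T) (F : Window T V) : Window T V :=
  (evictRoot μ t F.height F.root).refresh

end evict

/-! ### Sequences of operations and the bounds -/

section operations

variable {T V : Type u} [LinearOrder T]

/-- The operations that change the window. -/
inductive Op (T V : Type u) where
  | insert (B : List (T × V))
  | evict (t : T)

/-- A bulk is a nonempty sequence of entries with strictly increasing timestamps. -/
def IsBulk (B : List (T × V)) : Prop := B ≠ [] ∧ B.Pairwise fun a b => a.1 < b.1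

/-- Every bulk that is inserted is a bulk indeed. -/
def Op.WellFormed : Op T V → Prop
  | .insert B => IsBulk B
  | .evict _ => True

/-- The total time of all bulk insertions in a sequence of operations that starts from `F`. -/
def totalInsertTime [Monoid V] (μ : ℕ) : Window T V → List (Op T V) → ℕ
  | _, [] => 0
  | F, .insert B :: ops =>
      (bulkInsert μ F B).time + totalInsertTime μ (bulkInsert μ F B).val ops
  | F, .evict t :: ops => totalInsertTime μ (bulkEvict μ t F) ops

/-- The out-of-order distance `d` of the earliest entry of the bulk: the number of entries of the
window that are later than it. -/
def outOfOrderDistance (F : Window T V) : List (T × V) → ℕ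
  | [] => 0
  | b :: _ => F.entries.countP fun e => decide (b.1 < e.1)

open Real in
/-- `log d + m (1 + log (d / m))`, where negative logarithms, and those of `0`, count as `0`. -/
noncomputable def amortizedBound (F : Window T V) (B : List (T × V)) : ℝ :=
  log⁺ (outOfOrderDistance F B : ℝ) +
    (B.length : ℝ) * (1 + log⁺ ((outOfOrderDistance F B : ℝ) / (B.length : ℝ)))

open Real in
/-- `log d + m (1 + log ((m + n) / m))`, where `log 0` counts as `0`. -/
noncomputable def worstCaseBound (F : Window T V) (B : List (T × V)) : ℝ :=
  log⁺ (outOfOrderDistance F B : ℝ) + (B.length : ℝ) *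
    (1 + Real.log (((B.length : ℝ) + (F.entries.length : ℝ)) / (B.length : ℝ)))

/-- The sum of the amortized bounds of all bulk insertions in a sequence of operations that starts
from `F`, each taken for the window at the time of the insertion. -/
noncomputable def totalAmortizedBound [Monoid V] (μ : ℕ) : Window T V → List (Op T V) → ℝ
  | _, [] => 0
  | F, .insert B :: ops =>
      amortizedBound F B + totalAmortizedBound μ (bulkInsert μ F B).val ops
  | F, .evict t :: ops => totalAmortizedBound μ (bulkEvict μ t F) ops

end operations

end FiBA

namespace FiBA

/-! ### Timed computations -/

section timed

variable {α β : Type u}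

/-! Call a node full if its arity is `2μ`. For one bulk insertion let `k` be the height at which the
walk up from the right finger stops, `w` the cost of search and pass up in the subtree of that node,
and `top` the height of the highest processed node. The time is `O(μ (k + w + top))`, and each of
the three terms has its own reason to be small.

Walk: if the walk leaves a spine node behind, the first entry of that node and the subtree after it
are later than the bulk's earliest entry. Subtrees have exponential size, so `2 ^ k ≤ 4 (d + 1)`
(`two_pow_fingerWalk_le`).

Subtree: cut the tree at any height `l`. Up to height `l`, every bulk entry pays `O(μ)` per level.
Above it, the visited nodes are charged to the window instead: one node per level lies on the path
to the earliest entry, and all others have only timestamps that are not before it. As a subtree of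
height `l` has at least `2 ^ l - 1` timestamps, there are `O((d + 1) / 2 ^ l)` of the latter. Hence
`w = O(μ (m (l + 1) + k + (d + 1) / 2 ^ l))` for every `l` (`workload_le`); the choice `l ≈ log₂ ((d
+ 1) / m)` balances the terms (`WorkloadBound.le`).

Climb: `top - k` is not bounded by `log d`, and the potential, the number of full nodes, pays for
it. If a single treelet splits a node, the node was full and falls apart into arities `μ + 1` and
`μ`, neither of them full because `μ ≥ 2`. If several treelets arrive, fewer leave. So full nodes
plus twice the travelling treelets drop by at least one per level (`TargetSpec.potential`). Each
target creates at most one full node and takes at least one step, so the full nodes created in the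
subtree are covered by `w`. This gives `top + full' ≤ k + full + 2w` (`bulkInsert_spec`). Evictions
never raise the number of full nodes (`bulkEvict_spec`), and the sum over a sequence telescopes.

Worst case: without credit, `top` is at most the height of the tree plus `1 + w`. The height is
`O(log (n + 1))`, and `log (n + 1) ≤ m log ((m + n) / m)` by Bernoulli's inequality. -/

@[simp] theorem Timed.val_pure (a : α) : (pure a : Timed α).val = a := rfl

@[simp] theorem Timed.time_pure (a : α) : (pure a : Timed α).time = 0 := rfl

@[simp] theorem Timed.val_bind (x : Timed α) (f : α → Timed β) :
    (x >>= f).val = (f x.val).val := rfl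

@[simp] theorem Timed.time_bind (x : Timed α) (f : α → Timed β) :
    (x >>= f).time = x.time + (f x.val).time := rfl

@[simp] theorem time_tick (k : ℕ) : (tick.{u} k).time = k := rfl

end timed

/-! ### Sorted lists between two bounds -/

section bounds

variable {T : Type u} [LinearOrder T]

/-- The list is strictly increasing and its members lie strictly between `lo` and `hi`. -/
def Bounded (lo : WithBot T) (hi : WithTop T) (l : List T) : Prop :=
  l.Pairwise (· < ·) ∧ ∀ x ∈ l, lo < (x : WithBot T) ∧ (x : WithTop T) < hi

theorem bounded_bot_top {l : List T} : Bounded ⊥ ⊤ l ↔ l.Pairwise (· < ·) :=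
  ⟨fun h => h.1, fun h => ⟨h, fun x _ => ⟨WithBot.bot_lt_coe x, WithTop.coe_lt_top x⟩⟩⟩

theorem Bounded.split {lo : WithBot T} {hi : WithTop T} {l l' : List T} {x : T}
    (h : Bounded lo hi (l ++ x :: l')) :
    Bounded lo x l ∧ Bounded x hi l' ∧ lo < (x : WithBot T) ∧ (x : WithTop T) < hi := by
  obtain ⟨hs, hb⟩ := h
  rw [List.pairwise_append, List.pairwise_cons] at hs
  obtain ⟨h1, ⟨h2, h3⟩, h4⟩ := hs
  refine ⟨⟨h1, fun y hy => ⟨(hb y (by simp [hy])).1, ?_⟩⟩,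
    ⟨h3, fun y hy => ⟨?_, (hb y (by simp [hy])).2⟩⟩, (hb x (by simp)).1, (hb x (by simp)).2⟩
  · exact WithTop.coe_lt_coe.2 (h4 y hy x (by simp))
  · exact WithBot.coe_lt_coe.2 (h2 y hy)

theorem Bounded.glue {lo : WithBot T} {hi : WithTop T} {l l' : List T} {x : T}
    (h : Bounded lo x l) (h' : Bounded x hi l') (hlo : lo < (x : WithBot T))
    (hhi : (x : WithTop T) < hi) : Bounded lo hi (l ++ x :: l') := by
  refine ⟨?_, ?_⟩
  · rw [List.pairwise_append, List.pairwise_cons]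
    refine ⟨h.1, ⟨fun y hy => WithBot.coe_lt_coe.1 (h'.2 y hy).1, h'.1⟩, ?_⟩
    intro a ha b hb
    have hax : a < x := WithTop.coe_lt_coe.1 (h.2 a ha).2
    rcases List.mem_cons.1 hb with rfl | hb
    · exact hax
    · exact hax.trans (WithBot.coe_lt_coe.1 (h'.2 b hb).1)
  · intro y hy
    rcases List.mem_append.1 hy with hy | hy
    · exact ⟨(h.2 y hy).1, (h.2 y hy).2.trans hhi⟩
    · rcases List.mem_cons.1 hy with rfl | hy
      · exact ⟨hlo, hhi⟩
      · exact ⟨hlo.trans (h'.2 y hy).1, (h'.2 y hy).2⟩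

end bounds

/-! ### Timestamps, full nodes and arities -/

section measures

variable {T V C : Type u}

/-- The timestamps of a list of entries with children, where `f` gives those of a child. -/
def flatKeys (f : C → List T) (r : List ((T × V) × C)) : List T :=
  r.flatMap fun p => p.1.1 :: f p.2

@[simp] theorem flatKeys_nil (f : C → List T) : flatKeys (V := V) f [] = [] := rfl

@[simp] theorem flatKeys_cons (f : C → List T) (p : (T × V) × C) (r : List ((T × V) × C)) :
    flatKeys f (p :: r) = p.1.1 :: (f p.2 ++ flatKeys f r) := by
  simp [flatKeys]

@[simp] theorem flatKeys_append (f : C → List T) (r r' : List ((T × V) × C)) :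
    flatKeys f (r ++ r') = flatKeys f r ++ flatKeys f r' := by
  simp [flatKeys]

/-- The timestamps of a tree, from left to right. -/
def Tree.keys (h : ℕ) (y : Tree T V h) : List T := (Tree.toList h y).map Prod.fst

theorem Tree.keys_zero (y : Tree T V 0) : Tree.keys 0 y = [] := rfl

theorem Tree.keys_succ (h : ℕ) (y : Tree T V (h + 1)) :
    Tree.keys (h + 1) y = Tree.keys h y.first ++ flatKeys (Tree.keys h) y.rest := by
  simp [Tree.keys, Tree.toList, flatKeys, List.map_flatMap]

theorem Tree.keys_mk (h : ℕ) (a : V) (c : Tree T V h) (r : List ((T × V) × Tree T V h)) :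
    Tree.keys (h + 1) (⟨a, c, r⟩ : Node T V (Tree T V h)) =
      Tree.keys h c ++ flatKeys (Tree.keys h) r :=
  Tree.keys_succ h _

/-- The sum of a function over the children in a list of entries with children. -/
def childSum {M : Type*} [AddMonoid M] (f : C → M) (r : List ((T × V) × C)) : M := (r.map fun p => f p.2).sum

@[simp] theorem childSum_nil {M : Type*} [AddMonoid M] (f : C → M) : childSum (T := T) (V := V) f [] = 0 := rfl

@[simp] theorem childSum_cons {M : Type*} [AddMonoid M] (f : C → M)
    (p : (T × V) × C) (r : List ((T × V) × C)) :
    childSum f (p :: r) = f p.2 + childSum f r := by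
  simp [childSum]

@[simp] theorem childSum_append {M : Type*} [AddMonoid M] (f : C → M)
    (r r' : List ((T × V) × C)) :
    childSum f (r ++ r') = childSum f r + childSum f r' := by
  simp [childSum]

/-- Whether a node with `n` entries has the maximal arity `2μ`, as a number. -/
def fullInd (μ n : ℕ) : ℕ := if n + 1 = 2 * μ then 1 else 0

theorem fullInd_le_one (μ n : ℕ) : fullInd μ n ≤ 1 := by
  unfold fullInd; split <;> omega

theorem fullInd_eq_zero {μ n : ℕ} (h : n + 1 < 2 * μ) : fullInd μ n = 0 := by
  unfold fullInd; split <;> omega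

/-- The number of nodes of maximal arity `2μ`, the potential for the amortized analysis. -/
def Tree.full (μ : ℕ) : (h : ℕ) → Tree T V h → ℕ
  | 0, _ => 0
  | h + 1, y =>
      fullInd μ (List.length (α := (T × V) × Tree T V h) y.rest) +
        Tree.full μ h y.first + childSum (Tree.full μ h) y.rest

theorem Tree.full_mk (μ h : ℕ) (a : V) (c : Tree T V h) (r : List ((T × V) × Tree T V h)) :
    Tree.full μ (h + 1) (⟨a, c, r⟩ : Node T V (Tree T V h)) =
      fullInd μ r.length + Tree.full μ h c + childSum (Tree.full μ h) r := rfl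

/-- A node of arity between `a` and `2μ` whose subtrees satisfy the arity invariant. -/
def NodeOK (μ a h : ℕ) (y : Tree T V (h + 1)) : Prop :=
  a ≤ Node.arity y ∧ Node.arity y ≤ 2 * μ ∧
    Tree.ArityOK μ h y.first ∧ ∀ p ∈ y.rest, Tree.ArityOK μ h p.2

theorem arityOK_succ {μ h : ℕ} {y : Tree T V (h + 1)} :
    Tree.ArityOK μ (h + 1) y ↔ NodeOK μ μ h y := Iff.rfl

theorem NodeOK.mono {μ a b h : ℕ} {y : Tree T V (h + 1)} (hy : NodeOK μ a h y) (hab : b ≤ a) :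
    NodeOK μ b h y := ⟨hab.trans hy.1, hy.2⟩

theorem nodeOK_mk {μ a h : ℕ} {x : V} {c : Tree T V h} {r : List ((T × V) × Tree T V h)} :
    NodeOK μ a h (⟨x, c, r⟩ : Node T V (Tree T V h)) ↔
      a ≤ r.length + 1 ∧ r.length + 1 ≤ 2 * μ ∧ Tree.ArityOK μ h c ∧
        ∀ p ∈ r, Tree.ArityOK μ h p.2 := Iff.rfl

/-- The least arity of the root of a window. -/
def rootMin (h : ℕ) : ℕ := if h = 0 then 1 else 2

theorem rootMin_le_two (h : ℕ) : rootMin h ≤ 2 := by unfold rootMin; split <;> omega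

/-- The empty window is a leaf of arity 1, so a lower bound that drops to 1 at height 0 absorbs the
exceptional case; roots and inner nodes can then be treated by the same lemmas, with a variable
lower bound. -/
theorem window_arityOK_iff {μ : ℕ} (hμ : 2 ≤ μ) (F : Window T V) :
    F.ArityOK μ ↔ NodeOK μ (rootMin F.height) F.height F.root := by
  have hlen : Node.arity F.root = F.root.rest.length + 1 := rfl
  unfold Window.ArityOK NodeOK rootMin
  constructor
  · rintro ⟨h1 | h1, h2⟩
    · refine ⟨?_, h1.2, h2⟩
      split <;> omega
    · refine ⟨?_, ?_, h2⟩
      · rw [if_pos h1.1]; omega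
      · rw [hlen, h1.2]; simp; omega
  · rintro ⟨h1, h2, h3⟩
    refine ⟨?_, h3⟩
    by_cases h0 : F.height = 0
    · by_cases h4 : F.root.rest = []
      · exact Or.inr ⟨h0, h4⟩
      · have := List.length_pos_iff.2 h4
        exact Or.inl ⟨by omega, h2⟩
    · rw [if_neg h0] at h1
      exact Or.inl ⟨h1, h2⟩

/-- The timestamps of a window, from left to right. -/
def Window.keys (F : Window T V) : List T := Tree.keys (F.height + 1) F.root

/-- The number of nodes of maximal arity in a window. -/
def Window.full (μ : ℕ) (F : Window T V) : ℕ := Tree.full μ (F.height + 1) F.root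

theorem window_valid_iff [LinearOrder T] {μ : ℕ} (hμ : 2 ≤ μ) (F : Window T V) :
    F.Valid μ ↔ NodeOK μ (rootMin F.height) F.height F.root ∧ F.keys.Pairwise (· < ·) := by
  unfold Window.Valid
  rw [window_arityOK_iff hμ]
  refine and_congr_right fun _ => ?_
  unfold Window.keys Tree.keys Window.entries
  rw [List.pairwise_map]

end measures

/-! ### Changing aggregates and values only -/

section skeleton

variable {T V C : Type u}

/-- The shape and the timestamps of a tree. -/
def Tree.skel : (h : ℕ) → Tree T V h → Tree T PUnit.{u + 1} h
  | 0, _ => PUnit.unit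
  | h + 1, y => (⟨PUnit.unit, Tree.skel h y.first,
      y.rest.map fun p => ((p.1.1, PUnit.unit), Tree.skel h p.2)⟩ : Node T PUnit (Tree T PUnit h))

theorem Tree.keys_skel : ∀ (h : ℕ) (y : Tree T V h), Tree.keys h (Tree.skel h y) = Tree.keys h y
  | 0, _ => rfl
  | h + 1, y => by
    rw [Tree.keys_succ, Tree.keys_succ]
    simp [Tree.skel, flatKeys, List.flatMap_map, Tree.keys_skel h]

theorem Tree.full_skel (μ : ℕ) :
    ∀ (h : ℕ) (y : Tree T V h), Tree.full μ h (Tree.skel h y) = Tree.full μ h y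
  | 0, _ => rfl
  | h + 1, y => by
    simp [Tree.skel, Tree.full, childSum, Tree.full_skel μ h, Function.comp_def]

theorem Tree.arityOK_skel (μ : ℕ) :
    ∀ (h : ℕ) (y : Tree T V h), Tree.ArityOK μ h (Tree.skel h y) ↔ Tree.ArityOK μ h y
  | 0, _ => Iff.rfl
  | h + 1, y => by
    simp only [Tree.skel, Tree.ArityOK, Node.arity, Tree.arityOK_skel μ h, List.length_map,
      List.forall_mem_map]

theorem nodeOK_skel (μ a h : ℕ) (y : Tree T V (h + 1)) :
    NodeOK μ a h (Tree.skel (h + 1) y) ↔ NodeOK μ a h y := by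
  simp only [Tree.skel, NodeOK, Node.arity, Tree.arityOK_skel μ h, List.length_map,
    List.forall_mem_map]

theorem setLastAux_concat (c : C) (e : T × V) (c' : C) :
    ∀ l : List ((T × V) × C), setLastAux c (l ++ [(e, c')]) = l ++ [(e, c)]
  | [] => rfl
  | [p] => rfl
  | p :: q :: l => by
    have := setLastAux_concat c e c' (q :: l)
    simp only [List.cons_append] at this ⊢
    rw [setLastAux, this]

theorem Node.last_concat (a : V) (f : C) (l : List ((T × V) × C)) (e : T × V) (c : C) :
    Node.last ⟨a, f, l ++ [(e, c)]⟩ = c := by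
  simp [Node.last]

theorem Node.setLast_concat (a : V) (f : C) (l : List ((T × V) × C)) (e : T × V) (c c' : C) :
    Node.setLast ⟨a, f, l ++ [(e, c)]⟩ c' = ⟨a, f, l ++ [(e, c')]⟩ := by
  unfold Node.setLast
  have := setLastAux_concat c' e c l
  cases l with
  | nil => rfl
  | cons p l => simpa using this

theorem Node.eq_concat (y : Node T V C) : y.rest = [] ∨
    ∃ l e c, y = ⟨y.agg, y.first, l ++ [(e, c)]⟩ := by
  rcases List.eq_nil_or_concat y.rest with h | ⟨l, p, h⟩
  · exact Or.inl h
  · refine Or.inr ⟨l, p.1, p.2, ?_⟩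
    cases y
    simpa using h

theorem Tree.skel_setFirst (h : ℕ) (a : V) (y : Node T V (Tree T V h)) (c : Tree T V h)
    (hc : Tree.skel h c = Tree.skel h y.first) :
    Tree.skel (h + 1) (⟨a, c, y.rest⟩ : Node T V (Tree T V h)) = Tree.skel (h + 1) y := by
  simp only [Tree.skel, hc]
  rfl

theorem Tree.skel_setLast (h : ℕ) (a : V) (y : Node T V (Tree T V h)) (c : Tree T V h)
    (hc : Tree.skel h c = Tree.skel h y.last) :
    Tree.skel (h + 1) (Node.setLast (⟨a, y.first, y.rest⟩ : Node T V (Tree T V h)) c) =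
      Tree.skel (h + 1) y := by
  rcases y.eq_concat with hy | ⟨l, e, c', hy⟩
  · simp only [Node.last, hy] at hc
    simp [Node.setLast, hy, Tree.skel, hc]
    rfl
  · rw [hy, Node.last_concat] at hc
    rw [hy, Node.setLast_concat]
    simp [Tree.skel, hc]
    rfl

/-- Two windows with the same shape and the same timestamps. -/
def Window.Similar (F G : Window T V) : Prop :=
  ∃ (h : ℕ) (y z : Tree T V (h + 1)), F = ⟨h, y⟩ ∧ G = ⟨h, z⟩ ∧
    Tree.skel (h + 1) y = Tree.skel (h + 1) z

theorem Window.Similar.full_eq {F G : Window T V} (h : F.Similar G) (μ : ℕ) :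
    F.full μ = G.full μ := by
  obtain ⟨h, y, z, rfl, rfl, hs⟩ := h
  simp only [Window.full]
  rw [← Tree.full_skel, hs, Tree.full_skel]

theorem Window.Similar.valid_iff [LinearOrder T] {F G : Window T V} (h : F.Similar G) {μ : ℕ}
    (hμ : 2 ≤ μ) : F.Valid μ ↔ G.Valid μ := by
  rw [window_valid_iff hμ, window_valid_iff hμ]
  obtain ⟨h, y, z, rfl, rfl, hs⟩ := h
  simp only [Window.keys]
  rw [← nodeOK_skel, ← Tree.keys_skel, hs, nodeOK_skel, Tree.keys_skel]

variable [Monoid V]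

theorem Tree.skel_repairLeft (top : ℕ) : ∀ (h : ℕ) (x : V) (y : Tree T V h),
    Tree.skel h (repairLeft top h x y).val = Tree.skel h y
  | 0, _, _ => rfl
  | h + 1, x, y => by
    unfold repairLeft
    split <;> exact Tree.skel_setFirst h _ y _ (Tree.skel_repairLeft top h _ _)

theorem Tree.skel_repairRight (top : ℕ) : ∀ (h : ℕ) (x : V) (y : Tree T V h),
    Tree.skel h (repairRight top h x y).val = Tree.skel h y
  | 0, _, _ => rfl
  | h + 1, x, y => by
    unfold repairRight
    split <;> exact Tree.skel_setLast h _ y _ (Tree.skel_repairRight top h _ _)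

theorem Tree.skel_refreshUp : ∀ (h : ℕ) (y : Tree T V h),
    Tree.skel h (Tree.refreshUp h y) = Tree.skel h y
  | 0, _ => rfl
  | h + 1, y => by
    simp [Tree.refreshUp, Tree.skel, Tree.skel_refreshUp h, Function.comp_def]
    rfl

/-- The repairs rewrite stored aggregates only, while arities, timestamps and full nodes can be read
off the skeleton. So the pass down is invisible to everything but the clock. -/
theorem passDown_similar (top : ℕ) (left : Bool) (F : Window T V) :
    (passDown top left F).val.Similar F := by
  obtain ⟨h, y⟩ := F
  have hR : Tree.skel (h + 1) (Node.setLast y (repairRight top h 1 (Node.last y)).val) =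
      Tree.skel (h + 1) y :=
    Tree.skel_setLast h y.agg y _ (Tree.skel_repairRight top h _ _)
  cases left
  · exact ⟨h, _, _, rfl, rfl, hR⟩
  · refine ⟨h, _, _, rfl, rfl, ?_⟩
    rw [← hR]
    exact Tree.skel_setFirst h _ _ _ (Tree.skel_repairLeft _ h _ _)

theorem refresh_similar (F : Window T V) : F.refresh.Similar F := by
  obtain ⟨h, y⟩ := F
  obtain ⟨h', a, b, h1, h2, h3⟩ := passDown_similar h true
    ⟨h, (⟨innerAgg h (Node.rest (Tree.refreshUp (h + 1) y)),
      Node.first (Tree.refreshUp (h + 1) y), Node.rest (Tree.refreshUp (h + 1) y)⟩ :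
        Node T V (Tree T V h))⟩
  cases h2
  refine ⟨h, a, y, h1, rfl, h3.trans ?_⟩
  exact Tree.skel_refreshUp (h + 1) y

end skeleton

/-! ### Bulk eviction keeps the invariants and creates no nodes of maximal arity -/

section evict

variable {T V C : Type u}

/-- The contents `c', r'` of a node arise from `c, r` by removing an initial part. -/
structure Trim (c : C) (r : List ((T × V) × C)) (c' : C) (r' : List ((T × V) × C)) : Prop where
  length_le : r'.length ≤ r.length
  forall_child : ∀ P : C → Prop, P c → (∀ p ∈ r, P p.2) → P c' ∧ ∀ p ∈ r', P p.2
  sum_le : ∀ f : C → ℕ, f c' + childSum f r' ≤ f c + childSum f r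
  keys_sublist : ∀ f : C → List T, (f c' ++ flatKeys f r').Sublist (f c ++ flatKeys f r)

theorem Trim.refl (c : C) (r : List ((T × V) × C)) : Trim c r c r :=
  ⟨le_rfl, fun _ h h' => ⟨h, h'⟩, fun _ => le_rfl, fun _ => List.Sublist.refl _⟩

theorem Trim.cons {c : C} {p : (T × V) × C} {r : List ((T × V) × C)} {c' : C}
    {r' : List ((T × V) × C)} (h : Trim p.2 r c' r') : Trim c (p :: r) c' r' := by
  refine ⟨h.length_le.trans (by simp), fun P h1 h2 => ?_, fun f => ?_, fun f => ?_⟩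
  · exact h.forall_child P (h2 p (by simp)) fun q hq => h2 q (by simp [hq])
  · have := h.sum_le f
    simp only [childSum_cons]
    omega
  · refine (h.keys_sublist f).trans ?_
    rw [flatKeys_cons]
    exact (List.sublist_cons_self _ _).trans (List.sublist_append_right _ _)

theorem cut_trim [LinearOrder T] (t : T) : ∀ (c : C) (r : List ((T × V) × C)),
    (∀ c' r', cut t c r = .exact c' r' → Trim c r c' r') ∧
      ∀ c' r', cut t c r = .inside c' r' → Trim c r c' r'
  | c, [] => by
    simp only [cut]
    refine ⟨fun _ _ h => (nomatch h), fun c' r' h => ?_⟩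
    cases h
    exact Trim.refl _ _
  | c, p :: r => by
    simp only [cut]
    split
    · refine ⟨fun _ _ h => (nomatch h), fun c' r' h => ?_⟩
      cases h
      exact Trim.refl _ _
    · split
      · refine ⟨fun c' r' h => ?_, fun _ _ h => (nomatch h)⟩
        cases h
        exact (Trim.refl _ _).cons
      · exact ⟨fun c' r' h => ((cut_trim t p.2 r).1 c' r' h).cons,
          fun c' r' h => ((cut_trim t p.2 r).2 c' r' h).cons⟩

/-- The timestamps in two neighboring trees, or in one after a merge. -/
def pairKeys (h : ℕ) : Option (Tree T V h × (T × V)) × Tree T V h → List T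
  | (some q, z) => Tree.keys h q.1 ++ q.2.1 :: Tree.keys h z
  | (none, z) => Tree.keys h z

/-- The number of nodes of maximal arity in two neighboring trees, or in one after a merge. -/
def pairFull (μ h : ℕ) : Option (Tree T V h × (T × V)) × Tree T V h → ℕ
  | (some q, z) => Tree.full μ h q.1 + Tree.full μ h z
  | (none, z) => Tree.full μ h z

/-- Two neighboring trees, or one after a merge, satisfy the arity invariant, have timestamps from
`l` only, and contain at most `n` nodes of maximal arity. -/
def PairSpec (μ h : ℕ) (l : List T) (n : ℕ) (o : Option (Tree T V h × (T × V)) × Tree T V h) :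
    Prop :=
  Tree.ArityOK μ h o.2 ∧ (∀ q ∈ o.1, Tree.ArityOK μ h q.1) ∧ (pairKeys h o).Sublist l ∧
    pairFull μ h o ≤ n

theorem PairSpec.mono {μ h : ℕ} {l l' : List T} {n n' : ℕ}
    {o : Option (Tree T V h × (T × V)) × Tree T V h} (ho : PairSpec μ h l n o)
    (hl : l.Sublist l') (hn : n ≤ n') : PairSpec μ h l' n' o :=
  ⟨ho.1, ho.2.1, ho.2.2.1.trans hl, ho.2.2.2.trans hn⟩

theorem childSum_take_add_drop (f : C → ℕ) (k : ℕ) (r : List ((T × V) × C)) :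
    childSum f (r.take k) + childSum f (r.drop k) = childSum f r := by
  rw [← childSum_append, List.take_append_drop]

theorem flatKeys_take_append_drop (f : C → List T) (k : ℕ) (r : List ((T × V) × C)) :
    flatKeys f (r.take k) ++ flatKeys f (r.drop k) = flatKeys f r := by
  rw [← flatKeys_append, List.take_append_drop]

variable [Monoid V]

/-- No repair creates a full node. A move brings the node to arity exactly `μ` and shrinks the
neighbor. A merge happens only if the deficit exceeds the surplus, which says that the two arities
add up to less than `2μ`. -/
theorem rebalance_spec {μ h : ℕ} (hμ : 2 ≤ μ) (c : Tree T V h) (r : List ((T × V) × Tree T V h))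
    (e : T × V) (z : Tree T V (h + 1)) (hr : r.length + 1 ≤ 2 * μ) (hc : Tree.ArityOK μ h c)
    (hrc : ∀ p ∈ r, Tree.ArityOK μ h p.2) (hz : Tree.ArityOK μ (h + 1) z) :
    PairSpec μ (h + 1)
      (Tree.keys h c ++ flatKeys (Tree.keys h) r ++ e.1 :: Tree.keys (h + 1) z)
      (fullInd μ r.length + (Tree.full μ h c + childSum (Tree.full μ h) r) +
        Tree.full μ (h + 1) z)
      (rebalance μ c r e z) := by
  obtain ⟨a, zc, zr⟩ := z
  obtain ⟨hz1, hz2, hz3, hz4⟩ := nodeOK_mk.1 hz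
  by_cases h1 : μ ≤ r.length + 1
  · rw [rebalance, if_pos h1]
    refine ⟨hz, ?_, ?_, ?_⟩
    · rintro q ⟨⟩
      exact nodeOK_mk.2 ⟨h1, hr, hc, hrc⟩
    · simp only [pairKeys, Tree.keys_mk]
      exact List.Sublist.refl _
    · simp only [pairFull, Tree.full_mk]
      omega
  · by_cases h2 : μ - (r.length + 1) ≤ zr.length + 1 - μ
    · obtain ⟨p, r', h3⟩ : ∃ p r', zr.drop (μ - (r.length + 1) - 1) = p :: r' := by
        refine List.exists_cons_of_ne_nil fun h3 => ?_
        rw [List.drop_eq_nil_iff] at h3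
        omega
      · have heq : rebalance μ c r e ⟨a, zc, zr⟩ = (some ((⟨1, c, r ++ (e, zc) ::
            zr.take (μ - (r.length + 1) - 1)⟩ : Node T V (Tree T V h)), p.1), ⟨1, p.2, r'⟩) := by
          simp only [rebalance, if_neg h1, Node.arity, if_pos h2, h3]
        rw [heq]
        have hlen := congrArg List.length h3
        rw [List.length_drop, List.length_cons] at hlen
        have hmem : ∀ q ∈ p :: r', q ∈ zr := fun q hq => List.mem_of_mem_drop (h3 ▸ hq)
        have hsum := childSum_take_add_drop (Tree.full μ h) (μ - (r.length + 1) - 1) zr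
        have hkeys := flatKeys_take_append_drop (Tree.keys h) (μ - (r.length + 1) - 1) zr
        rw [h3] at hsum hkeys
        -- A batch of `k` children is the first child of the neighbor, which comes with the old
        -- separating entry, and `k - 1` further ones.
        have hlen1 : (r ++ (e, zc) :: zr.take (μ - (r.length + 1) - 1)).length + 1 = μ := by
          simp only [List.length_append, List.length_cons, List.length_take]
          omega
        refine ⟨?_, ?_, ?_, ?_⟩
        · refine nodeOK_mk.2 ⟨by omega, by omega, hz4 p (hmem p (by simp)), fun q hq =>
            hz4 q (hmem q (by simp [hq]))⟩
        · rintro q ⟨⟩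
          refine nodeOK_mk.2 ⟨hlen1.ge, by omega, hc, fun q hq => ?_⟩
          rcases List.mem_append.1 hq with hq | hq
          · exact hrc q hq
          · rcases List.mem_cons.1 hq with rfl | hq
            · exact hz3
            · exact hz4 q (List.mem_of_mem_take hq)
        · simp only [pairKeys, Tree.keys_mk, ← hkeys, flatKeys_append, flatKeys_cons]
          simp
        · simp only [pairFull, Tree.full_mk, childSum_append, childSum_cons] at hsum ⊢
          rw [fullInd_eq_zero (by omega), fullInd_eq_zero (n := r'.length) (by omega)]
          omega
    · have heq : rebalance μ c r e ⟨a, zc, zr⟩ = (none, (⟨1, c, r ++ (e, zc) :: zr⟩ :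
          Node T V (Tree T V h))) := by
        simp only [rebalance, if_neg h1, Node.arity]
        exact if_neg h2
      rw [heq]
      refine ⟨?_, ?_, ?_, ?_⟩
      rotate_left
      · rintro q ⟨⟩
      rotate_right
      · refine nodeOK_mk.2 ⟨?_, ?_, hc, fun q hq => ?_⟩
        · simp; omega
        · simp; omega
        · rcases List.mem_append.1 hq with hq | hq
          · exact hrc q hq
          · rcases List.mem_cons.1 hq with rfl | hq
            · exact hz3
            · exact hz4 q hq
      · simp only [pairKeys, Tree.keys_mk, flatKeys_append, flatKeys_cons]
        simp
      · simp only [pairFull, Tree.full_mk, childSum_append, childSum_cons]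
        rw [fullInd_eq_zero (by simp; omega)]
        omega

/-- The window satisfies the arity invariant, has timestamps from `l` only, and contains at most
`n` nodes of maximal arity. -/
def WindowSpec (μ : ℕ) (l : List T) (n : ℕ) (F : Window T V) : Prop :=
  NodeOK μ (rootMin F.height) F.height F.root ∧ F.keys.Sublist l ∧ F.full μ ≤ n

theorem makeRoot_spec {μ : ℕ} (hμ : 2 ≤ μ) {l : List T} {n : ℕ} : ∀ (h : ℕ) (c : Tree T V h)
    (r : List ((T × V) × Tree T V h)), r.length + 1 ≤ 2 * μ → Tree.ArityOK μ h c →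
    (∀ p ∈ r, Tree.ArityOK μ h p.2) → (Tree.keys h c ++ flatKeys (Tree.keys h) r).Sublist l →
    fullInd μ r.length + (Tree.full μ h c + childSum (Tree.full μ h) r) ≤ n →
    WindowSpec μ l n (makeRoot h c r)
  | 0, c, r, h1, h2, h3, h4, h5 => by
    refine ⟨nodeOK_mk.2 ⟨by simp [makeRoot, rootMin], h1, h2, h3⟩, ?_, ?_⟩
    · simpa only [Window.keys, makeRoot, Tree.keys_mk] using h4
    · simp only [Window.full, makeRoot, Tree.full_mk]
      omega
  | h + 1, c, [], h1, h2, h3, h4, h5 => by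
    refine ⟨(arityOK_succ.1 h2).mono ((rootMin_le_two _).trans hμ), ?_, ?_⟩
    · simpa [Window.keys, makeRoot] using h4
    · simp only [Window.full, makeRoot]
      omega
  | h + 1, c, p :: r, h1, h2, h3, h4, h5 => by
    refine ⟨nodeOK_mk.2 ⟨by simp [makeRoot, rootMin], h1, h2, h3⟩, ?_, ?_⟩
    · simpa only [Window.keys, makeRoot, Tree.keys_mk] using h4
    · simp only [Window.full, makeRoot, Tree.full_mk]
      omega

variable [LinearOrder T]

theorem fullInd_mono {μ m n : ℕ} (h : m ≤ n) (hn : n + 1 ≤ 2 * μ) : fullInd μ m ≤ fullInd μ n := by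
  unfold fullInd; split <;> split <;> omega

/-- Induction on the height: cutting removes an initial part of a node and so cannot make it full,
and what the recursion returns for the two nodes below is repaired by `rebalance_spec`. If the cut
leaves a single child, its right neighbor is the first child of `z`, and `e` still separates the
two. -/
theorem evictPair_spec {μ : ℕ} (hμ : 2 ≤ μ) (t : T) : ∀ (h : ℕ) (x : Tree T V h) (e : T × V)
    (z : Tree T V h), Tree.ArityOK μ h x → Tree.ArityOK μ h z →
    PairSpec μ h (Tree.keys h x ++ e.1 :: Tree.keys h z) (Tree.full μ h x + Tree.full μ h z)
      (evictPair μ t h x e z)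
  | 0, x, e, z, _, _ => ⟨trivial, fun _ _ => trivial, List.Sublist.refl _, le_rfl⟩
  | h + 1, x, e, z, hx, hz => by
    rw [evictPair]
    obtain ⟨ax, xc, xr⟩ := x
    obtain ⟨az, zc, zr⟩ := z
    obtain ⟨hx1, hx2, hx3, hx4⟩ := nodeOK_mk.1 hx
    obtain ⟨hz1, hz2, hz3, hz4⟩ := nodeOK_mk.1 hz
    simp only [Tree.keys_mk, Tree.full_mk]
    split
    · rename_i c r hcut
      have ht := (cut_trim t xc xr).1 _ _ hcut
      obtain ⟨hc, hr⟩ := ht.forall_child _ hx3 hx4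
      have hl := ht.length_le
      have hs := ht.sum_le (Tree.full μ h)
      have hk := ht.keys_sublist (Tree.keys h)
      have hf := fullInd_mono (μ := μ) hl hx2
      refine (rebalance_spec hμ c r e _ (by omega) hc hr hz).mono ?_ ?_
      · simp only [Tree.keys_mk]
        exact hk.append_right _
      · simp only [Tree.full_mk]
        omega
    · rename_i c p r hcut
      have ht := (cut_trim t xc xr).2 _ _ hcut
      obtain ⟨hc, hr⟩ := ht.forall_child _ hx3 hx4
      have hl := ht.length_le
      have hs := ht.sum_le (Tree.full μ h)
      have hk := ht.keys_sublist (Tree.keys h)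
      simp only [List.length_cons, childSum_cons, flatKeys_cons] at hl hs hk
      have ih := evictPair_spec hμ t h c p.1 p.2 hc (hr p (by simp))
      split
      · rename_i q c' heq
        rw [heq] at ih
        obtain ⟨i1, i2, i3, i4⟩ := ih
        have hf := fullInd_mono (μ := μ) hl hx2
        refine (rebalance_spec hμ q.1 ((q.2, c') :: r) e _ (by simp; omega) (i2 q rfl) ?_
          hz).mono ?_ ?_
        · intro p' hp'
          rcases List.mem_cons.1 hp' with rfl | hp'
          · exact i1
          · exact hr p' (by simp [hp'])
        · simp only [Tree.keys_mk, flatKeys_cons, pairKeys] at i3 ⊢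
          refine List.Sublist.append_right ?_ _
          refine List.Sublist.trans ?_ hk
          simpa using i3.append_right (flatKeys (Tree.keys h) r)
        · simp only [Tree.full_mk, childSum_cons, pairFull, List.length_cons] at i4 ⊢
          omega
      · rename_i c' heq
        rw [heq] at ih
        obtain ⟨i1, i2, i3, i4⟩ := ih
        have hf := fullInd_mono (μ := μ) (show r.length ≤ xr.length by omega) hx2
        refine (rebalance_spec hμ c' r e _ (by omega) i1 (fun p' hp' => hr p' (by simp [hp']))
          hz).mono ?_ ?_
        · simp only [Tree.keys_mk, pairKeys] at i3 ⊢
          refine List.Sublist.append_right ?_ _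
          refine List.Sublist.trans ?_ hk
          simpa using i3.append_right (flatKeys (Tree.keys h) r)
        · simp only [Tree.full_mk, pairFull] at i4 ⊢
          omega
    · rename_i c hcut
      have ht := (cut_trim t xc xr).2 _ _ hcut
      obtain ⟨hc, -⟩ := ht.forall_child _ hx3 hx4
      have hs := ht.sum_le (Tree.full μ h)
      have hk := ht.keys_sublist (Tree.keys h)
      simp only [childSum_nil, flatKeys_nil, List.append_nil, Nat.add_zero] at hs hk
      have ih := evictPair_spec hμ t h c e zc hc hz3
      split
      · rename_i q c' heq
        rw [heq] at ih
        obtain ⟨i1, i2, i3, i4⟩ := ih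
        refine (rebalance_spec hμ q.1 [] q.2 _ (by simp; omega) (i2 q rfl) (by simp)
          (nodeOK_mk.2 ⟨hz1, hz2, i1, hz4⟩)).mono ?_ ?_
        · simp only [Tree.keys_mk, pairKeys, flatKeys_nil, List.append_nil] at i3 ⊢
          have := (i3.trans (hk.append_right _)).append_right (flatKeys (Tree.keys h) zr)
          simpa using this
        · simp only [Tree.full_mk, pairFull, childSum_nil, List.length_nil] at i4 ⊢
          rw [fullInd_eq_zero (n := 0) (by omega)]
          omega
      · rename_i c' heq
        rw [heq] at ih
        obtain ⟨i1, i2, i3, i4⟩ := ih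
        refine ⟨nodeOK_mk.2 ⟨hz1, hz2, i1, hz4⟩, by simp, ?_, ?_⟩
        · simp only [Tree.keys_mk, pairKeys] at i3 ⊢
          have := (i3.trans (hk.append_right _)).append_right (flatKeys (Tree.keys h) zr)
          simpa using this
        · simp only [Tree.full_mk, pairFull] at i4 ⊢
          omega

theorem evictRoot_spec {μ : ℕ} (hμ : 2 ≤ μ) (t : T) {l : List T} {n : ℕ} : ∀ (h : ℕ)
    (y : Tree T V (h + 1)), NodeOK μ 1 h y → (Tree.keys (h + 1) y).Sublist l →
    Tree.full μ (h + 1) y ≤ n → WindowSpec μ l n (evictRoot μ t h y)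
  | 0, y, hy, hl, hn => by
    rw [evictRoot]
    obtain ⟨a, yc, yr⟩ := y
    obtain ⟨-, hy2, hy3, hy4⟩ := nodeOK_mk.1 hy
    rw [Tree.keys_mk] at hl
    rw [Tree.full_mk] at hn
    have key : ∀ c r, Trim yc yr c r → WindowSpec μ l n (makeRoot 0 c r) := by
      intro c r ht
      obtain ⟨hc, hr⟩ := ht.forall_child _ hy3 hy4
      have hle := ht.length_le
      have hs := ht.sum_le (Tree.full μ 0)
      have hf := fullInd_mono (μ := μ) hle hy2
      exact makeRoot_spec hμ 0 c r (by omega) hc hr ((ht.keys_sublist _).trans hl) (by omega)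
    simp only
    split
    · rename_i c r hcut
      exact key c r ((cut_trim t yc yr).1 _ _ hcut)
    · rename_i c r hcut
      exact key c r ((cut_trim t yc yr).2 _ _ hcut)
  | h + 1, y, hy, hl, hn => by
    rw [evictRoot]
    obtain ⟨a, yc, yr⟩ := y
    obtain ⟨-, hy2, hy3, hy4⟩ := nodeOK_mk.1 hy
    rw [Tree.keys_mk] at hl
    rw [Tree.full_mk] at hn
    simp only
    split
    · rename_i c r hcut
      have ht := (cut_trim t yc yr).1 _ _ hcut
      obtain ⟨hc, hr⟩ := ht.forall_child _ hy3 hy4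
      have hle := ht.length_le
      have hs := ht.sum_le (Tree.full μ (h + 1))
      have hf := fullInd_mono (μ := μ) hle hy2
      exact makeRoot_spec hμ (h + 1) c r (by omega) hc hr ((ht.keys_sublist _).trans hl) (by omega)
    · rename_i c hcut
      have ht := (cut_trim t yc yr).2 _ _ hcut
      obtain ⟨hc, -⟩ := ht.forall_child _ hy3 hy4
      have hs := ht.sum_le (Tree.full μ (h + 1))
      have hk := ht.keys_sublist (Tree.keys (h + 1))
      simp only [childSum_nil, flatKeys_nil, List.append_nil, Nat.add_zero] at hs hk
      exact evictRoot_spec hμ t h c ((arityOK_succ.1 hc).mono (by omega)) (hk.trans hl) (by omega)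
    · rename_i c p r hcut
      have ht := (cut_trim t yc yr).2 _ _ hcut
      obtain ⟨hc, hr⟩ := ht.forall_child _ hy3 hy4
      have hle := ht.length_le
      have hs := ht.sum_le (Tree.full μ (h + 1))
      have hk := (ht.keys_sublist (Tree.keys (h + 1))).trans hl
      simp only [List.length_cons, childSum_cons, flatKeys_cons] at hle hs hk
      have ih := evictPair_spec hμ t (h + 1) c p.1 p.2 hc (hr p (by simp))
      split
      · rename_i q c' heq
        rw [heq] at ih
        obtain ⟨i1, i2, i3, i4⟩ := ih
        have hf := fullInd_mono (μ := μ) hle hy2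
        refine makeRoot_spec hμ (h + 1) q.1 ((q.2, c') :: r) (by simp; omega) (i2 q rfl) ?_ ?_ ?_
        · intro p' hp'
          rcases List.mem_cons.1 hp' with rfl | hp'
          · exact i1
          · exact hr p' (by simp [hp'])
        · simp only [flatKeys_cons, pairKeys] at i3 ⊢
          refine List.Sublist.trans ?_ hk
          simpa using i3.append_right (flatKeys (Tree.keys (h + 1)) r)
        · simp only [childSum_cons, pairFull, List.length_cons] at i4 ⊢
          omega
      · rename_i c' heq
        rw [heq] at ih
        obtain ⟨i1, i2, i3, i4⟩ := ih
        have hf := fullInd_mono (μ := μ) (show r.length ≤ yr.length by omega) hy2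
        refine makeRoot_spec hμ (h + 1) c' r (by omega) i1 (fun p' hp' => hr p' (by simp [hp']))
          ?_ ?_
        · simp only [pairKeys] at i3
          refine List.Sublist.trans ?_ hk
          simpa using i3.append_right (flatKeys (Tree.keys (h + 1)) r)
        · simp only [pairFull] at i4
          omega

/-- This is all the amortized analysis needs from evictions: they keep the invariants and do not
raise the potential. Order is inherited because the remaining timestamps form a sublist. -/
theorem bulkEvict_spec {μ : ℕ} (hμ : 2 ≤ μ) (t : T) {F : Window T V} (hF : F.Valid μ) :
    (bulkEvict μ t F).Valid μ ∧ (bulkEvict μ t F).full μ ≤ F.full μ := by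
  have hF' := (window_valid_iff hμ F).1 hF
  obtain ⟨h1, h2, h3⟩ := evictRoot_spec hμ t F.height F.root
    (hF'.1.mono (by unfold rootMin; split <;> omega)) (List.Sublist.refl _) le_rfl
  have hs : (bulkEvict μ t F).Similar (evictRoot μ t F.height F.root) := refresh_similar _
  refine ⟨(hs.valid_iff hμ).2 ((window_valid_iff hμ _).2 ⟨h1, hF'.2.sublist h2⟩), ?_⟩
  rw [hs.full_eq]
  exact h3

end evict

/-! ### Interleaving -/

section interleave

variable {T V C : Type u}

/-- The timestamp of a treelet. -/
def Treelet.key : Treelet T V C → T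
  | .insertion e _ => e.1
  | .recomputation e => e.1

/-- Treelets that insert the given entries with the children that follow them. -/
def insertions (R : List ((T × V) × C)) : List (Treelet T V C) :=
  R.map fun p => .insertion p.1 p.2

/-- The number of recomputation events. -/
def recCount (L : List (Treelet T V C)) : ℕ := L.countP Treelet.isRecomputation

/-- The number of insertions among the treelets. -/
def insCount (L : List (Treelet T V C)) : ℕ := L.countP fun x => !x.isRecomputation

theorem insCount_add_recCount (L : List (Treelet T V C)) :
    insCount L + recCount L = L.length := by
  have := List.length_eq_countP_add_countP (l := L) Treelet.isRecomputation
  simp only [insCount, recCount]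
  simp only [Bool.not_eq_true, Bool.decide_eq_false] at this
  omega

@[simp] theorem insertions_length (R : List ((T × V) × C)) :
    (insertions R).length = R.length := by simp [insertions]

@[simp] theorem recCount_insertions (R : List ((T × V) × C)) : recCount (insertions R) = 0 := by
  simp [insertions, recCount, List.countP_map, Function.comp_def, Treelet.isRecomputation]

@[simp] theorem insCount_append (L L' : List (Treelet T V C)) :
    insCount (L ++ L') = insCount L + insCount L' := by simp [insCount]

@[simp] theorem recCount_append (L L' : List (Treelet T V C)) :
    recCount (L ++ L') = recCount L + recCount L' := by simp [recCount]

variable [LinearOrder T] [Monoid V]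

theorem interleave_nil (r : List ((T × V) × C)) : interleave r [] = pure r := by
  unfold interleave; cases r <;> rfl

theorem interleave_time_le (r : List ((T × V) × C)) (L : List (Treelet T V C)) :
    (interleave r L).time ≤ r.length + L.length := by
  fun_induction interleave r L <;> (try simp only [Timed.time_bind]) <;> (try split) <;>
    simp only [Timed.time_bind, Timed.time_pure, time_tick, List.length_cons] at * <;> omega

theorem interleave_length (r : List ((T × V) × C)) (L : List (Treelet T V C)) :
    (interleave r L).val.length = r.length + insCount L := by
  fun_induction interleave r L <;> (try simp only [Timed.val_bind]) <;> (try split) <;>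
    simp_all [insCount, Treelet.isRecomputation] <;> omega

theorem interleave_nil_insertions : ∀ R : List ((T × V) × C),
    (interleave [] (insertions R)).val = R
  | [] => by simp [insertions, interleave_nil]
  | p :: R => by
    have := interleave_nil_insertions R
    simp only [insertions, List.map_cons] at this ⊢
    rw [interleave]
    simp [this]

/-- With `interleave_above`, this evaluates a merge piece by piece, once the timestamps of the
treelets are known to lie on one side of an entry. -/
theorem interleave_below (p : (T × V) × C) (r : List ((T × V) × C)) (L : List (Treelet T V C)) :
    ∀ R : List ((T × V) × C), (∀ x ∈ R, x.1.1 < p.1.1) →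
      (interleave (p :: r) (insertions R ++ L)).val = R ++ (interleave (p :: r) L).val
  | [], _ => by simp [insertions]
  | q :: R, h => by
    have := interleave_below p r L R fun x hx => h x (by simp [hx])
    simp only [insertions, List.map_cons, List.cons_append] at this ⊢
    rw [interleave]
    simp [h q (by simp), this]

theorem interleave_above (p : (T × V) × C) (r : List ((T × V) × C)) (L : List (Treelet T V C))
    (h : ∀ x ∈ L, p.1.1 < x.key) : (interleave (p :: r) L).val = p :: (interleave r L).val := by
  match L with
  | [] => simp [interleave_nil]
  | .insertion e c :: L =>
    have h1 : ¬ e.1 < p.1.1 := not_lt_of_gt (h (.insertion e c) (by simp))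
    rw [interleave]
    simp [h1]
  | .recomputation e :: L =>
    have h1 : ¬ e.1 = p.1.1 := ne_of_gt (h (.recomputation e) (by simp))
    rw [interleave]
    simp [h1]

theorem interleave_append_insertions (R : List ((T × V) × C)) : ∀ r : List ((T × V) × C),
    (∀ p ∈ r, ∀ x ∈ R, p.1.1 < x.1.1) → (interleave r (insertions R)).val = r ++ R
  | [], _ => interleave_nil_insertions R
  | p :: r, h => by
    rw [interleave_above, interleave_append_insertions R r fun q hq => h q (by simp [hq])]
    · rfl
    · intro x hx
      obtain ⟨q, hq, rfl⟩ := List.mem_map.1 hx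
      exact h p (by simp) q hq

end interleave

/-! ### Splitting -/

section split

variable {T V : Type u}

/-- The result of processing a target whose contents, after interleaving, are `c, I`. -/
structure TargetSpec (μ h : ℕ) (c : Tree T V h) (I : List ((T × V) × Tree T V h))
    (y : Tree T V (h + 1)) (R : List ((T × V) × Tree T V (h + 1))) : Prop where
  keys_eq : Tree.keys (h + 1) y ++ flatKeys (Tree.keys (h + 1)) R =
    Tree.keys h c ++ flatKeys (Tree.keys h) I
  full_le : Tree.full μ (h + 1) y + childSum (Tree.full μ (h + 1)) R ≤
    Tree.full μ h c + childSum (Tree.full μ h) I + 1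
  full_le_of_length : I.length = 2 * μ → Tree.full μ (h + 1) y +
    childSum (Tree.full μ (h + 1)) R ≤ Tree.full μ h c + childSum (Tree.full μ h) I
  nodeOK : ∀ a ≤ μ, a ≤ I.length + 1 → NodeOK μ a h y
  arityOK : ∀ p ∈ R, Tree.ArityOK μ (h + 1) p.2
  length_eq : R.length = 0 ∨ 2 * μ ≤ I.length ∧ (R.length + 1) * (μ + 1) ≤ I.length + 2

theorem TargetSpec.nodeOK_of_ne_nil {μ h : ℕ} {c : Tree T V h} {I : List ((T × V) × Tree T V h)}
    {y : Tree T V (h + 1)} {R : List ((T × V) × Tree T V (h + 1))} (H : TargetSpec μ h c I y R)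
    (hR : R ≠ []) : NodeOK μ μ h y := by
  have h1 := List.length_pos_iff.2 hR
  rcases H.length_eq with h2 | h2
  · omega
  · exact H.nodeOK μ le_rfl (by omega)

/-- If treelets arrive at a node, the number of treelets that leave it is not greater, and the
step is paid for by nodes of maximal arity or by the decrease of the number of treelets. -/
theorem TargetSpec.potential {μ h n m : ℕ} (hμ : 2 ≤ μ) {c : Tree T V h}
    {I : List ((T × V) × Tree T V h)} {y : Tree T V (h + 1)}
    {R : List ((T × V) × Tree T V (h + 1))} (H : TargetSpec μ h c I y R)
    (hI : I.length = n + m) (hn : n + 1 ≤ 2 * μ) (hm : 1 ≤ m) :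
    R.length ≤ m ∧ (n = 0 → R.length < m) ∧
    Tree.full μ (h + 1) y + childSum (Tree.full μ (h + 1)) R + 2 * R.length + 1 ≤
      fullInd μ n + (Tree.full μ h c + childSum (Tree.full μ h) I) + 2 * m := by
  have h1 := H.full_le
  rcases H.length_eq with h2 | ⟨h2, h3⟩
  · omega
  · have h4 : R.length ≤ m ∧ (2 ≤ m → R.length < m) ∧ (n = 0 → R.length < m) := by
      generalize R.length = p at *
      rw [hI] at h3
      -- All three follow from `(p + 1) (μ + 1) ≤ n + m + 2` and `n + 1 ≤ 2μ`. Equality `p = m`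
      -- survives only for `m = 1`, where a full node passes one treelet on.
      refine ⟨?_, fun hm2 => ?_, fun hn0 => ?_⟩ <;> by_contra hlt
      · nlinarith
      · nlinarith
      · nlinarith
    refine ⟨h4.1, h4.2.2, ?_⟩
    -- A single treelet that causes a split meets a full node, and the loss of that full node pays
    -- for the level. With two or more treelets at least one fewer leaves, which releases 2: one for
    -- a possible new full node, one for the level.
    rcases Nat.lt_or_ge m 2 with h5 | h5
    · have h6 := H.full_le_of_length (by omega)
      have h7 : fullInd μ n = 1 := by
        unfold fullInd
        rw [if_pos (by omega)]
      omega
    · have := h4.2.1 h5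
      omega

variable [Monoid V]

theorem mkNode_time (h : ℕ) (loc : Loc) (c : Tree T V h) (r : List ((T × V) × Tree T V h)) :
    (mkNode h loc c r).time = 2 * r.length + 2 := rfl

theorem mkNode_val (h : ℕ) (loc : Loc) (c : Tree T V h) (r : List ((T × V) × Tree T V h)) :
    ∃ a, (mkNode h loc c r).val = (⟨a, c, r⟩ : Node T V (Tree T V h)) := ⟨_, rfl⟩

/-- The result of a split of a node with contents `c, r`: a node `y` followed by the nodes in `R`,
with the same contents and at most `n` nodes of maximal arity on top of those below. -/
structure SplitSpec (μ h : ℕ) (c : Tree T V h) (r : List ((T × V) × Tree T V h)) (n : ℕ)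
    (y : Tree T V (h + 1)) (R : List ((T × V) × Tree T V (h + 1))) : Prop where
  keys_eq : Tree.keys (h + 1) y ++ flatKeys (Tree.keys (h + 1)) R =
    Tree.keys h c ++ flatKeys (Tree.keys h) r
  full_le : Tree.full μ (h + 1) y + childSum (Tree.full μ (h + 1)) R ≤
    Tree.full μ h c + childSum (Tree.full μ h) r + n

/-- Pieces of arity `μ + 1` are not full, as `μ ≥ 2`. Only the last piece can be, namely if exactly
`2μ` children are left for it; this is the `if`. -/
theorem bulkSplit_spec {μ h : ℕ} (hμ : 2 ≤ μ) : ∀ (k : ℕ) (left right : Bool) (c : Tree T V h)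
    (r : List ((T × V) × Tree T V h)), k * (μ + 1) + μ ≤ r.length + 1 →
    r.length + 1 ≤ k * (μ + 1) + 2 * μ → Tree.ArityOK μ h c → (∀ p ∈ r, Tree.ArityOK μ h p.2) →
    ∃ R, (bulkSplit μ h left right k c r).val.2 = insertions R ∧ R.length = k ∧
      SplitSpec μ h c r (if r.length + 1 = k * (μ + 1) + 2 * μ then 1 else 0)
        (bulkSplit μ h left right k c r).val.1 R ∧
      Tree.ArityOK μ (h + 1) (bulkSplit μ h left right k c r).val.1 ∧
      ∀ p ∈ R, Tree.ArityOK μ (h + 1) p.2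
  | 0, left, right, c, r, h1, h2, hc, hr => by
    obtain ⟨a, ha⟩ := mkNode_val h ⟨left, right⟩ c r
    have e : bulkSplit μ h left right 0 c r =
      (mkNode h ⟨left, right⟩ c r >>= fun y => pure (y, [])) := rfl
    rw [e]
    simp only [Timed.val_bind, Timed.val_pure, ha]
    refine ⟨[], rfl, rfl, ⟨?_, ?_⟩, ?_, by simp⟩
    · simp [Tree.keys_mk]
    · simp only [Tree.full_mk, fullInd, childSum_nil]
      split <;> split <;> omega
    · exact nodeOK_mk.2 ⟨by omega, by omega, hc, hr⟩
  | k + 1, left, right, c, r, h1, h2, hc, hr => by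
    have hk : (k + 1) * (μ + 1) = k * (μ + 1) + (μ + 1) := Nat.succ_mul k (μ + 1)
    rw [hk] at h1 h2
    obtain ⟨p, r', h3⟩ : ∃ p r', r.drop μ = p :: r' := by
      refine List.exists_cons_of_ne_nil fun h3 => ?_
      rw [List.drop_eq_nil_iff] at h3
      omega
    have hlen := congrArg List.length h3
    rw [List.length_drop, List.length_cons] at hlen
    have hmem : ∀ q ∈ p :: r', q ∈ r := fun q hq => List.mem_of_mem_drop (h3 ▸ hq)
    have hsum := childSum_take_add_drop (Tree.full μ h) μ r
    have hkeys := flatKeys_take_append_drop (Tree.keys h) μ r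
    rw [h3] at hsum hkeys
    obtain ⟨a, ha⟩ := mkNode_val h ⟨left, false⟩ c (r.take μ)
    have e : bulkSplit μ h left right (k + 1) c r = (tick (μ + 1) >>= fun _ =>
        mkNode h ⟨left, false⟩ c (r.take μ) >>= fun y =>
        bulkSplit μ h false right k p.2 r' >>= fun q =>
        pure (y, .insertion p.1 q.1 :: q.2)) := by
      rw [bulkSplit, h3]
    have htake : (r.take μ).length = μ := by rw [List.length_take]; omega
    obtain ⟨R, i2, i3, ⟨i4, i5⟩, i6, i7⟩ := bulkSplit_spec hμ k false right p.2 r' (by omega)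
      (by omega) (hr p (hmem p (by simp))) fun q hq => hr q (hmem q (by simp [hq]))
    rw [e]
    simp only [Timed.val_bind, Timed.val_pure, ha]
    refine ⟨(p.1, (bulkSplit μ h false right k p.2 r').val.1) :: R, ?_, ?_, ⟨?_, ?_⟩, ?_, ?_⟩
    · rw [i2]; rfl
    · simp [i3]
    · rw [← hkeys, Tree.keys_mk, flatKeys_cons, flatKeys_cons, i4]
      simp
    · rw [Tree.full_mk, fullInd_eq_zero (by omega)]
      simp only [childSum_cons] at hsum ⊢
      have : (if r.length + 1 = (k + 1) * (μ + 1) + 2 * μ then 1 else 0) =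
          if r'.length + 1 = k * (μ + 1) + 2 * μ then 1 else 0 := by
        rw [hk]
        split <;> split <;> omega
      rw [this]
      omega
    · exact nodeOK_mk.2 ⟨by omega, by omega, hc, fun q hq => hr q (List.mem_of_mem_take hq)⟩
    · intro q hq
      rcases List.mem_cons.1 hq with rfl | hq
      · exact i6
      · exact i7 q hq

/-- Write `p = q (μ + 1) + s`. If `s = μ`, the remainder is an admissible last node; otherwise it is
joined with one more piece, to an arity `μ + 1 + s ≤ 2μ`. -/
theorem splitCount_bounds {μ p : ℕ} (hp : 2 * μ < p) :
    splitCount μ p * (μ + 1) + μ ≤ p ∧ p ≤ splitCount μ p * (μ + 1) + 2 * μ ∧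
      1 ≤ splitCount μ p := by
  have h1 := Nat.div_add_mod p (μ + 1)
  have h2 := Nat.mod_lt p (Nat.succ_pos μ)
  unfold splitCount
  generalize p / (μ + 1) = q at *
  generalize p % (μ + 1) = s at *
  rw [mul_comm] at h1
  rcases q with _ | _ | q
  · split <;> omega
  · split
    · omega
    · omega
  · simp only [Nat.succ_eq_add_one, add_mul, one_mul, Nat.add_sub_cancel] at *
    split <;> simp only [add_mul, one_mul] <;> omega

theorem bulkSplit_cost (μ h : ℕ) : ∀ (k : ℕ) (left right : Bool) (c : Tree T V h)
    (r : List ((T × V) × Tree T V h)),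
    (bulkSplit μ h left right k c r).time ≤ 2 * r.length + 2 + (μ + 1) * k ∧
    (bulkSplit μ h left right k c r).val.2.length ≤ k ∧
    recCount (bulkSplit μ h left right k c r).val.2 = 0
  | 0, left, right, c, r => by
    have e : bulkSplit μ h left right 0 c r =
      (mkNode h ⟨left, right⟩ c r >>= fun y => pure (y, [])) := rfl
    rw [e]
    simp [mkNode_time, recCount]
  | k + 1, left, right, c, r => by
    rw [bulkSplit]
    split
    · simp [mkNode_time, recCount]
    · rename_i p r' h3
      have hlen := congrArg List.length h3
      rw [List.length_drop, List.length_cons] at hlen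
      obtain ⟨i1, i2, i3⟩ := bulkSplit_cost μ h k false right p.2 r'
      have htake : (r.take μ).length = μ := by rw [List.length_take]; omega
      simp only [Timed.val_bind, Timed.time_bind, Timed.val_pure, Timed.time_pure, mkNode_time,
        time_tick, htake, Nat.mul_succ, List.length_cons]
      refine ⟨by omega, by omega, ?_⟩
      simpa [recCount, Treelet.isRecomputation] using i3

variable [LinearOrder T]

/-- The lower bound on the time matters for the potential: a target produces at most one new full
node, and its own first step pays for it. -/
theorem processTarget_spec {μ h : ℕ} (hμ : 2 ≤ μ) (loc : Loc) (c : Tree T V h)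
    (r : List ((T × V) × Tree T V h)) (L : List (Treelet T V (Tree T V h)))
    (hc : Tree.ArityOK μ h c) (hI : ∀ p ∈ (interleave r L).val, Tree.ArityOK μ h p.2) :
    ∃ R, (processTarget μ h loc c r L).val.2 = insertions R ∧
      TargetSpec μ h c (interleave r L).val (processTarget μ h loc c r L).val.1 R ∧
      1 ≤ (processTarget μ h loc c r L).time := by
  have e : processTarget μ h loc c r L = (tick 1 >>= fun _ => interleave r L >>= fun r' =>
    if r'.length + 1 ≤ 2 * μ then mkNode h loc c r' >>= fun y => pure (y, [])
    else bulkSplit μ h loc.left loc.right (splitCount μ (r'.length + 1)) c r') := rfl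
  rw [e]
  simp only [Timed.val_bind, Timed.time_bind, time_tick]
  generalize (interleave r L).val = I at *
  split
  · rename_i h1
    obtain ⟨a, ha⟩ := mkNode_val h loc c I
    simp only [Timed.val_bind, Timed.time_bind, Timed.val_pure, Timed.time_pure, ha, mkNode_time]
    refine ⟨[], rfl, ⟨?_, ?_, ?_, ?_, ?_, ?_⟩, ?_⟩
    · simp [Tree.keys_mk]
    · have := fullInd_le_one μ I.length
      simp only [Tree.full_mk, childSum_nil]
      omega
    · intro; omega
    · intro a _ h2
      exact nodeOK_mk.2 ⟨h2, h1, hc, hI⟩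
    · simp
    · simp
    · omega
  · rename_i h1
    obtain ⟨b1, b2, b3⟩ := splitCount_bounds (μ := μ) (p := I.length + 1) (by omega)
    obtain ⟨R, s2, s3, ⟨s4, s5⟩, s6, s7⟩ := bulkSplit_spec hμ (splitCount μ (I.length + 1))
      loc.left loc.right c I b1 b2 hc hI
    refine ⟨R, s2, ⟨s4, ?_, ?_, ?_, s7, ?_⟩, ?_⟩
    · refine s5.trans ?_
      split <;> omega
    · intro h2
      refine s5.trans ?_
      rw [if_neg]
      · exact le_rfl
      · rcases Nat.exists_eq_add_of_le' b3 with ⟨j, hj⟩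
        rw [hj, add_mul]
        have := Nat.zero_le (j * (μ + 1))
        omega
    · intro a ha _
      exact (arityOK_succ.1 s6).mono ha
    · refine Or.inr ⟨by omega, ?_⟩
      rw [s3, add_mul]
      omega
    · omega

/-- With `k` nodes split off, `k (μ + 1)` is at most the size of the contents, and `μ + 1 ≥ 3` gives
`9 k ≤ 3 k (μ + 1)`. So even with 9 steps put aside per promoted treelet the cost is linear in the
contents: the at most `2μ - 1` old entries account for `10 μ`, each arriving treelet for 7. Since 7
is less than 9, the reserve of a treelet covers its treatment one level up. -/
theorem processTarget_cost {μ h : ℕ} (hμ : 2 ≤ μ) (loc : Loc) (c : Tree T V h)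
    (r : List ((T × V) × Tree T V h)) (L : List (Treelet T V (Tree T V h)))
    (hr : r.length + 1 ≤ 2 * μ) :
    (processTarget μ h loc c r L).time + 9 * (processTarget μ h loc c r L).val.2.length ≤
      10 * μ + 7 * L.length ∧ recCount (processTarget μ h loc c r L).val.2 = 0 := by
  have ht := interleave_time_le r L
  have hl := interleave_length r L
  have hL := insCount_add_recCount L
  have e : processTarget μ h loc c r L = (tick 1 >>= fun _ => interleave r L >>= fun r' =>
    if r'.length + 1 ≤ 2 * μ then mkNode h loc c r' >>= fun y => pure (y, [])
    else bulkSplit μ h loc.left loc.right (splitCount μ (r'.length + 1)) c r') := rfl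
  rw [e]
  simp only [Timed.val_bind, Timed.time_bind, time_tick]
  generalize (interleave r L).val = I at *
  split
  · simp only [Timed.val_bind, Timed.time_bind, Timed.val_pure, Timed.time_pure, mkNode_time]
    refine ⟨?_, rfl⟩
    simp only [List.length_nil]
    omega
  · rename_i h1
    obtain ⟨b1, b2, b3⟩ := splitCount_bounds (μ := μ) (p := I.length + 1) (by omega)
    obtain ⟨s1, s2, s3⟩ := bulkSplit_cost μ h (splitCount μ (I.length + 1)) loc.left loc.right c I
    refine ⟨?_, s3⟩
    generalize splitCount μ (I.length + 1) = k at *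
    have h3 : 3 * k ≤ k * (μ + 1) := by
      rw [mul_comm]
      exact Nat.mul_le_mul_left k (by omega)
    rw [mul_comm (μ + 1) k] at s1
    generalize k * (μ + 1) = x at *
    omega

end split

/-! ### The result of the search and the pass up -/

section values

variable {T V C S : Type u}

theorem gather_none (up : Loc → C → S → Timed (C × List (Treelet T V C))) (left right : Bool)
    (c : C) (r : List ((T × V) × C)) :
    gather up left right c r ⟨none, []⟩ = ⟨((c, r), []), 0⟩ := by
  cases r <;> rfl

theorem gather_length (up : Loc → C → S → Timed (C × List (Treelet T V C))) :
    ∀ (r : List ((T × V) × C)) (left right : Bool) (c : C) (s : SiteNode V S),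
      (gather up left right c r s).val.1.2.length = r.length
  | [], _, _, _, _ => rfl
  | _ :: _, _, _, _, ⟨_, []⟩ => rfl
  | e :: r, _, right, _, ⟨_, w :: ws⟩ => by
    simp [gather, gather_length up r false right e.2 ⟨w.2, ws⟩]

variable [LinearOrder T]

/-- Scan a node if the next entry of the bulk belongs to its range. -/
def scanIf (descend : WithTop T → C → List (T × V) → Timed (S × List (T × V))) (hi : WithTop T)
    (c : C) (r : List ((T × V) × C)) (B : List (T × V)) : Timed (SiteNode V S × List (T × V)) :=
  if before hi B then scan descend hi c r B else pure (⟨none, []⟩, B)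

section scan

variable (descend : WithTop T → C → List (T × V) → Timed (S × List (T × V))) (hi : WithTop T)

theorem scan_nil_val (c : C) (B : List (T × V)) : (scan descend hi c [] B).val =
    (⟨(enter descend hi c B).val.1, []⟩, (enter descend hi c B).val.2) := rfl

theorem scan_nil_time (c : C) (B : List (T × V)) :
    (scan descend hi c [] B).time = 1 + (enter descend hi c B).time := rfl

theorem scan_cons_val (c : C) (e : (T × V) × C) (r : List ((T × V) × C)) (B : List (T × V)) :
    (scan descend hi c (e :: r) B).val =
      (⟨(enter descend e.1.1 c B).val.1,
        ((matchEntry e.1.1 (enter descend e.1.1 c B).val.2).1,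
          (scanIf descend hi e.2 r
            (matchEntry e.1.1 (enter descend e.1.1 c B).val.2).2).val.1.first) ::
          (scanIf descend hi e.2 r
            (matchEntry e.1.1 (enter descend e.1.1 c B).val.2).2).val.1.rest⟩,
        (scanIf descend hi e.2 r (matchEntry e.1.1 (enter descend e.1.1 c B).val.2).2).val.2) := by
  rw [scan]
  simp only [Timed.val_bind, scanIf]
  split <;> rfl

theorem scan_cons_time (c : C) (e : (T × V) × C) (r : List ((T × V) × C)) (B : List (T × V)) :
    (scan descend hi c (e :: r) B).time = 1 + (enter descend e.1.1 c B).time +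
      (scanIf descend hi e.2 r (matchEntry e.1.1 (enter descend e.1.1 c B).val.2).2).time := by
  rw [scan]
  simp only [Timed.time_bind, scanIf, time_tick]
  split
  · simp
    omega
  · simp

end scan

/-- `B'` is what remains of the bulk `B` after its entries before `hi` have been read. -/
def Remains (hi : WithTop T) (B B' : List (T × V)) : Prop :=
  B' <:+ B ∧ ∀ b ∈ B', hi ≤ (b.1 : WithTop T)

theorem remains_self {hi : WithTop T} {B : List (T × V)} (hB : B.Pairwise fun a b => a.1 < b.1)
    (h : ¬ before hi B) : Remains hi B B := by
  refine ⟨List.suffix_rfl, fun b hb => ?_⟩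
  match B, hB, h, hb with
  | a :: B, hB, h, hb =>
    have h1 : hi ≤ (a.1 : WithTop T) := by simpa [before] using h
    rcases List.mem_cons.1 hb with rfl | hb
    · exact h1
    · exact h1.trans (WithTop.coe_le_coe.2 ((List.pairwise_cons.1 hB).1 b hb).le)

theorem matchEntry_spec (t : T) {B : List (T × V)} (hB : B.Pairwise fun a b => a.1 < b.1)
    (h : ∀ b ∈ B, (t : WithTop T) ≤ (b.1 : WithTop T)) :
    (matchEntry t B).2 <:+ B ∧ ∀ b ∈ (matchEntry t B).2, t < b.1 := by
  match B, hB, h with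
  | [], _, _ => simp [matchEntry]
  | a :: B, hB, h =>
    have h1 : t ≤ a.1 := WithTop.coe_le_coe.1 (h a (by simp))
    have h2 := (List.pairwise_cons.1 hB).1
    simp only [matchEntry]
    split
    · rename_i h3
      exact ⟨List.suffix_cons a B, fun b hb => h3 ▸ h2 b hb⟩
    · rename_i h3
      refine ⟨List.suffix_rfl, fun b hb => ?_⟩
      have h4 : t < a.1 := lt_of_le_of_ne h1 (Ne.symm h3)
      rcases List.mem_cons.1 hb with rfl | hb
      · exact h4
      · exact h4.trans (h2 b hb)

/-- What a pass up returns for a subtree with timestamps between `lo` and `hi`: insertions of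
entries with subtrees that satisfy `ok`, all in timestamp order, with `fl`-values at most `n` in
total. -/
def UpSpec (kk : C → List T) (ok : C → Prop) (fl : C → ℕ) (lo : WithBot T) (hi : WithTop T)
    (n : ℕ) (p : C × List (Treelet T V C)) : Prop :=
  ∃ R, p.2 = insertions R ∧ Bounded lo hi (kk p.1 ++ flatKeys kk R) ∧ ok p.1 ∧
    (∀ x ∈ R, ok x.2) ∧ fl p.1 + childSum fl R ≤ n

/-- The search `descend` and the pass up `up` are correct for subtrees. -/
def ChildSpec (kk : C → List T) (ok : C → Prop) (fl : C → ℕ)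
    (descend : WithTop T → C → List (T × V) → Timed (S × List (T × V)))
    (up : Loc → C → S → Timed (C × List (Treelet T V C))) : Prop :=
  ∀ (loc : Loc) (lo : WithBot T) (hi : WithTop T) (c : C) (B : List (T × V)),
    Bounded lo hi (kk c) → ok c → B.Pairwise (fun a b => a.1 < b.1) →
    (∀ b ∈ B, lo < (b.1 : WithBot T)) → before hi B →
    Remains hi B (descend hi c B).val.2 ∧
      UpSpec kk ok fl lo hi (fl c + (up loc c (descend hi c B).val.1).time)
        (up loc c (descend hi c B).val.1).val

variable {kk : C → List T} {ok : C → Prop} {fl : C → ℕ}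
  {descend : WithTop T → C → List (T × V) → Timed (S × List (T × V))}
  {up : Loc → C → S → Timed (C × List (Treelet T V C))}

theorem ChildSpec.enter_visit (H : ChildSpec kk ok fl descend up) (loc : Loc) {lo : WithBot T}
    {hi : WithTop T} {c : C} {B : List (T × V)} (hc : Bounded lo hi (kk c)) (hok : ok c)
    (hB : B.Pairwise fun a b => a.1 < b.1) (hlo : ∀ b ∈ B, lo < (b.1 : WithBot T)) :
    Remains hi B (enter descend hi c B).val.2 ∧
      UpSpec kk ok fl lo hi (fl c + (visit up loc c (enter descend hi c B).val.1).time)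
        (visit up loc c (enter descend hi c B).val.1).val := by
  unfold enter
  split
  · rename_i h
    obtain ⟨h1, R, h2, h3, h4, h5, h6⟩ := H loc lo hi c B hc hok hB hlo h
    refine ⟨h1, R, h2, h3, h4, h5, h6.trans ?_⟩
    simp only [Timed.val_bind, Timed.val_pure, visit, Timed.time_bind]
    omega
  · rename_i h
    refine ⟨remains_self hB h, [], rfl, ?_, hok, by simp, ?_⟩
    · simpa [visit] using hc
    · simp [visit]

variable [Monoid V]

/-- What the interleaved contents of a node are after its children have been processed. -/
def GatherSpec (kk : C → List T) (ok : C → Prop) (fl : C → ℕ) (lo : WithBot T) (hi : WithTop T)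
    (n : ℕ) (g : (C × List ((T × V) × C)) × List (Treelet T V C)) : Prop :=
  Bounded lo hi (kk g.1.1 ++ flatKeys kk (interleave g.1.2 g.2).val) ∧ ok g.1.1 ∧
    (∀ x ∈ (interleave g.1.2 g.2).val, ok x.2) ∧
    fl g.1.1 + childSum fl (interleave g.1.2 g.2).val ≤ n ∧
    ∀ x ∈ g.2, lo < (x.key : WithBot T)

/-- A recomputation event changes a value and nothing else, so shape and timestamps after the merge
are as if it were absent. -/
theorem interleave_recomputation (e : T × V) (c : C) (r : List ((T × V) × C)) (o : Option V)
    (L : List (Treelet T V C)) (hL : ∀ x ∈ L, e.1 < x.key) :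
    ∃ v, (interleave ((e, c) :: r)
      ((o.map fun v => Treelet.recomputation (e.1, v)).toList ++ L)).val =
        ((e.1, v), c) :: (interleave r L).val := by
  cases o with
  | none => exact ⟨e.2, interleave_above (e, c) r L hL⟩
  | some v =>
    refine ⟨e.2 * v, ?_⟩
    simp only [Option.map_some, Option.toList_some, List.singleton_append]
    rw [interleave]
    simp

/-- Induction along the entries of the node. The treelets from the child before an entry are earlier
than the entry, those from the rest of the node are later: the range of the rest starts at the
entry. The last clause of `GatherSpec` carries this lower bound. So the merge yields the treelets of
the child, the entry, and the merged rest, in order. -/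
theorem ChildSpec.scan_gather (H : ChildSpec kk ok fl descend up) : ∀ (r : List ((T × V) × C))
    (left right : Bool) (lo : WithBot T) (hi : WithTop T) (c : C) (B : List (T × V)),
    Bounded lo hi (kk c ++ flatKeys kk r) → ok c → (∀ x ∈ r, ok x.2) →
    B.Pairwise (fun a b => a.1 < b.1) → (∀ b ∈ B, lo < (b.1 : WithBot T)) →
    Remains hi B (scan descend hi c r B).val.2 ∧
      GatherSpec kk ok fl lo hi
        (fl c + childSum fl r + (gather up left right c r (scan descend hi c r B).val.1).time)
        (gather up left right c r (scan descend hi c r B).val.1).val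
  | [], left, right, lo, hi, c, B, hk, hc, _, hB, hlo => by
    rw [scan_nil_val]
    rw [flatKeys_nil, List.append_nil] at hk
    obtain ⟨h1, R, h2, h3, h4, h5, h6⟩ := H.enter_visit ⟨left, right⟩ hk hc hB hlo
    refine ⟨h1, ?_⟩
    simp only [gather, GatherSpec, Timed.val_bind, Timed.val_pure, Timed.time_bind,
      Timed.time_pure, h2, interleave_nil_insertions, childSum_nil]
    refine ⟨h3, h4, h5, by omega, fun x hx => ?_⟩
    obtain ⟨q, hq, rfl⟩ := List.mem_map.1 hx
    refine (h3.2 q.1.1 ?_).1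
    simp only [List.mem_append, flatKeys, List.mem_flatMap]
    exact Or.inr ⟨q, hq, by simp⟩
  | e :: r, left, right, lo, hi, c, B, hk, hc, hr, hB, hlo => by
    rw [scan_cons_val]
    rw [flatKeys_cons] at hk
    obtain ⟨k1, k2, k3, k4⟩ := hk.split
    obtain ⟨⟨h1, h1'⟩, R, h2, h3, h4, h5, h6⟩ := H.enter_visit ⟨left, false⟩ k1 hc hB hlo
    generalize hp : (enter descend e.1.1 c B).val = p at *
    have hB1 := hB.sublist h1.sublist
    obtain ⟨m1, m2⟩ := matchEntry_spec e.1.1 hB1 h1'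
    generalize matchEntry e.1.1 p.2 = q at *
    have hB2 := hB1.sublist m1.sublist
    have tail : Remains hi q.2 (scanIf descend hi e.2 r q.2).val.2 ∧
        GatherSpec kk ok fl e.1.1 hi (fl e.2 + childSum fl r +
            (gather up false right e.2 r (scanIf descend hi e.2 r q.2).val.1).time)
          (gather up false right e.2 r (scanIf descend hi e.2 r q.2).val.1).val := by
      unfold scanIf
      split
      · exact ChildSpec.scan_gather H r false right e.1.1 hi e.2 q.2 k2 (hr e (by simp))
          (fun x hx => hr x (by simp [hx])) hB2 fun b hb => WithBot.coe_lt_coe.2 (m2 b hb)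
      · rename_i hnb
        refine ⟨remains_self hB2 hnb, ?_⟩
        simp only [Timed.val_pure, gather_none, GatherSpec, interleave_nil]
        exact ⟨k2, hr e (by simp), fun x hx => hr x (by simp [hx]), by omega, by simp⟩
    generalize (scanIf descend hi e.2 r q.2).val = w at *
    obtain ⟨⟨t1, t1'⟩, t2, t3, t4, t5, t6⟩ := tail
    refine ⟨⟨t1.trans (m1.trans h1), t1'⟩, ?_⟩
    have hg : gather up left right c (e :: r) ⟨p.1, (q.1, w.1.first) :: w.1.rest⟩ =
      (tick 1 >>= fun _ => visit up ⟨left, false⟩ c p.1 >>= fun p =>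
        gather up false right e.2 r w.1 >>= fun q' =>
        pure ((p.1, (e.1, q'.1.1) :: q'.1.2),
          p.2 ++ (q.1.map fun v => .recomputation (e.1.1, v)).toList ++ q'.2)) := rfl
    rw [hg]
    simp only [Timed.val_bind, Timed.val_pure, Timed.time_bind, Timed.time_pure, time_tick]
    generalize gather up false right e.2 r w.1 = g at *
    generalize visit up ⟨left, false⟩ c p.1 = p' at *
    have hbelow : ∀ x ∈ R, x.1.1 < e.1.1 := by
      intro x hx
      refine WithTop.coe_lt_coe.1 (h3.2 x.1.1 ?_).2
      simp only [List.mem_append, flatKeys, List.mem_flatMap]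
      exact Or.inr ⟨x, hx, by simp⟩
    obtain ⟨v, hv⟩ := interleave_recomputation e.1 g.val.1.1 g.val.1.2 q.1 g.val.2
      fun x hx => WithBot.coe_lt_coe.1 (t6 x hx)
    have hI : (interleave ((e.1, g.val.1.1) :: g.val.1.2) (p'.val.2 ++
        (q.1.map fun v => Treelet.recomputation (e.1.1, v)).toList ++ g.val.2)).val =
        R ++ ((e.1.1, v), g.val.1.1) :: (interleave g.val.1.2 g.val.2).val := by
      rw [h2, List.append_assoc, interleave_below (e.1, g.val.1.1) _ _ _ hbelow, hv]
    simp only [GatherSpec, hI]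
    refine ⟨?_, h4, ?_, ?_, ?_⟩
    · rw [flatKeys_append, flatKeys_cons, ← List.append_assoc]
      exact h3.glue t2 k3 k4
    · intro x hx
      rcases List.mem_append.1 hx with hx | hx
      · exact h5 x hx
      · rcases List.mem_cons.1 hx with rfl | hx
        · exact t3
        · exact t4 x hx
    · simp only [childSum_append, childSum_cons]
      omega
    · intro x hx
      rw [h2] at hx
      rcases List.mem_append.1 hx with hx | hx
      · rcases List.mem_append.1 hx with hx | hx
        · obtain ⟨y, hy, rfl⟩ := List.mem_map.1 hx
          refine (h3.2 y.1.1 ?_).1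
          simp only [List.mem_append, flatKeys, List.mem_flatMap]
          exact Or.inr ⟨y, hy, by simp⟩
        · obtain ⟨v', rfl⟩ : ∃ v', x = .recomputation (e.1.1, v') := by
            rw [Option.mem_toList] at hx
            obtain ⟨v', -, h⟩ := Option.map_eq_some_iff.1 hx
            exact ⟨v', h.symm⟩
          exact k3
      · exact k3.trans (t6 x hx)

end values

/-! ### Correctness of search and pass up in subtrees, by induction on the height. -/

section passup

variable {T V : Type u} [LinearOrder T]

theorem takeBefore_spec (hi : WithTop T) : ∀ B : List (T × V),
    B.Pairwise (fun a b => a.1 < b.1) →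
    (takeBefore hi B).val.1 ++ (takeBefore hi B).val.2 = B ∧
    (∀ b ∈ (takeBefore hi B).val.1, (b.1 : WithTop T) < hi) ∧
    ∀ b ∈ (takeBefore hi B).val.2, hi ≤ (b.1 : WithTop T)
  | [], _ => by simp [takeBefore]
  | b :: B, hB => by
    simp only [takeBefore, Timed.val_bind]
    obtain ⟨h1, h2⟩ := List.pairwise_cons.1 hB
    split
    · rename_i h
      obtain ⟨i1, i2, i3⟩ := takeBefore_spec hi B h2
      simp only [Timed.val_bind, Timed.val_pure, List.cons_append, i1]
      refine ⟨trivial, fun x hx => ?_, i3⟩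
      rcases List.mem_cons.1 hx with rfl | hx
      · exact h
      · exact i2 x hx
    · rename_i h
      simp only [Timed.val_pure]
      refine ⟨rfl, by simp, fun x hx => ?_⟩
      rcases List.mem_cons.1 hx with rfl | hx
      · exact not_lt.1 h
      · exact (not_lt.1 h).trans (WithTop.coe_le_coe.2 (h1 x hx).le)

variable [Monoid V]

/-- The result of search and pass up for a node whose arity is at least `a`. -/
theorem passUp_node_spec {μ h : ℕ} (hμ : 2 ≤ μ)
    (H : ChildSpec (Tree.keys h) (Tree.ArityOK μ h) (Tree.full μ h) (search h)
      (passUp (T := T) (V := V) μ h)) (a : ℕ) (ha : a ≤ μ) (loc : Loc) (lo : WithBot T)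
    (hi : WithTop T) (y : Tree T V (h + 1)) (B : List (T × V))
    (hk : Bounded lo hi (Tree.keys (h + 1) y)) (hy : NodeOK μ a h y)
    (hB : B.Pairwise (fun a b => a.1 < b.1)) (hlo : ∀ b ∈ B, lo < (b.1 : WithBot T)) :
    Remains hi B (search (h + 1) hi y B).val.2 ∧
    ∃ R, (passUp μ (h + 1) loc y (search (h + 1) hi y B).val.1).val.2 = insertions R ∧
      Bounded lo hi (Tree.keys (h + 1)
        (passUp μ (h + 1) loc y (search (h + 1) hi y B).val.1).val.1 ++
          flatKeys (Tree.keys (h + 1)) R) ∧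
      NodeOK μ a h (passUp μ (h + 1) loc y (search (h + 1) hi y B).val.1).val.1 ∧
      (R ≠ [] → NodeOK μ μ h (passUp μ (h + 1) loc y (search (h + 1) hi y B).val.1).val.1) ∧
      (∀ x ∈ R, Tree.ArityOK μ (h + 1) x.2) ∧
      Tree.full μ (h + 1) (passUp μ (h + 1) loc y (search (h + 1) hi y B).val.1).val.1 +
        childSum (Tree.full μ (h + 1)) R ≤ Tree.full μ (h + 1) y +
          (passUp μ (h + 1) loc y (search (h + 1) hi y B).val.1).time := by
  rw [Tree.keys_succ] at hk
  obtain ⟨hs, g1, g2, g3, g4, -⟩ := H.scan_gather y.rest loc.left loc.right lo hi y.first B hk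
    hy.2.2.1 hy.2.2.2 hB hlo
  refine ⟨hs, ?_⟩
  have e : passUp μ (h + 1) loc y (search (h + 1) hi y B).val.1 =
    (gather (passUp μ h) loc.left loc.right y.first y.rest
      (scan (search h) hi y.first y.rest B).val.1 >>= fun p =>
        tick ((h + 1) * recCount p.2) >>= fun _ => processTarget μ h loc p.1.1 p.1.2 p.2) := rfl
  have hlen : y.rest.length ≤ (gather (passUp μ h) loc.left loc.right y.first y.rest
      (scan (search h) hi y.first y.rest B).val.1).val.1.2.length := by
    rw [gather_length]
  rw [e]
  generalize gather (passUp μ h) loc.left loc.right y.first y.rest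
      (scan (search h) hi y.first y.rest B).val.1 = g at *
  simp only [Timed.val_bind, Timed.time_bind, time_tick]
  obtain ⟨R, r1, r2, r3⟩ := processTarget_spec hμ loc g.val.1.1 g.val.1.2 g.val.2 g2 g3
  refine ⟨R, r1, ?_, ?_, r2.nodeOK_of_ne_nil, r2.arityOK, ?_⟩
  · rw [r2.keys_eq]
    exact g1
  · refine r2.nodeOK a ha ?_
    rw [interleave_length]
    have : a ≤ y.rest.length + 1 := hy.1
    omega
  -- At most one full node is new at this level, and the time of the target is at least 1.
  · have h1 := r2.full_le
    have h2 : Tree.full μ (h + 1) y = fullInd μ (List.length (α := (T × V) × Tree T V h) y.rest) +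
        Tree.full μ h y.first + childSum (Tree.full μ h) y.rest := rfl
    omega

theorem passUp_childSpec {μ : ℕ} (hμ : 2 ≤ μ) : ∀ h : ℕ, ChildSpec (Tree.keys h)
    (Tree.ArityOK μ h) (Tree.full μ h) (search h) (passUp (T := T) (V := V) μ h)
  | 0 => by
    intro loc lo hi c B _ _ hB hlo _
    obtain ⟨h1, h2, h3⟩ := takeBefore_spec hi B hB
    refine ⟨⟨⟨_, h1⟩, h3⟩, (takeBefore hi B).val.1.map fun e => (e, c), ?_, ?_, trivial,
      fun _ _ => trivial, ?_⟩
    · simp [passUp, insertions, search, Function.comp_def]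
    · have hf : flatKeys (Tree.keys 0) ((takeBefore hi B).val.1.map fun e => (e, c)) =
          (takeBefore hi B).val.1.map Prod.fst := by
        generalize (takeBefore hi B).val.1 = l
        induction l with
        | nil => rfl
        | cons x l ih => simp [ih, Tree.keys_zero]
      rw [hf, Tree.keys_zero, List.nil_append]
      rw [← h1] at hB hlo
      refine ⟨List.pairwise_map.2 (List.pairwise_append.1 hB).1, fun x hx => ?_⟩
      obtain ⟨b, hb, rfl⟩ := List.mem_map.1 hx
      exact ⟨hlo b (by simp [hb]), h2 b hb⟩
    · have : ∀ l : List ((T × V) × Tree T V 0), childSum (Tree.full μ 0) l = 0 := by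
        intro l
        induction l with
        | nil => rfl
        | cons x l ih => rw [childSum_cons, ih]; rfl
      rw [this]
      simp [Tree.full]
  | h + 1 => fun loc lo hi c B hk hc hB hlo _ => by
    obtain ⟨h1, R, h2, h3, h4, -, h5⟩ := passUp_node_spec hμ (passUp_childSpec hμ h) μ le_rfl loc
      lo hi c B hk (arityOK_succ.1 hc) hB hlo
    exact ⟨h1, R, h2, h3, h4, h5⟩

end passup

/-! ### The cost of the search and the pass up, given the cost for the children -/

section cost

variable {T V C S : Type u}

theorem recCount_visit {up : Loc → C → S → Timed (C × List (Treelet T V C))}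
    (H0 : ∀ loc c s, recCount (up loc c s).val.2 = 0) (loc : Loc) (c : C)
    (o : Option S) : recCount (visit up loc c o).val.2 = 0 := by
  cases o with
  | none => rfl
  | some s => exact H0 loc c s

theorem counts_toList (t : T) (o : Option V) :
    insCount (C := C) (o.map fun v => Treelet.recomputation (t, v)).toList = 0 ∧
      recCount (C := C) (o.map fun v => Treelet.recomputation (t, v)).toList = o.toList.length := by
  cases o <;> simp [insCount, recCount, Treelet.isRecomputation]

theorem length_toList_le_one (o : Option V) : o.toList.length ≤ 1 := by cases o <;> simp

theorem childSum_nonneg {f : C → ℝ} : ∀ r : List ((T × V) × C), (∀ x ∈ r, 0 ≤ f x.2) →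
    0 ≤ childSum f r
  | [], _ => le_rfl
  | p :: r, h => by
    rw [childSum_cons]
    exact add_nonneg (h p (by simp)) (childSum_nonneg r fun x hx => h x (by simp [hx]))

/-- The sum of the sizes of the subtrees of a node, where a size is the number of entries plus
one. -/
theorem childSum_size (kk : C → List T) (β s : ℝ) : ∀ (r : List ((T × V) × C)) (c : C),
    (β * ((kk c).length + 1) - s) + childSum (fun c => β * ((kk c).length + 1) - s) r =
      β * ((kk c ++ flatKeys kk r).length + 1) - s * (r.length + 1)
  | [], c => by simp
  | e :: r, c => by
    rw [childSum_cons, childSum_size kk β s r e.2]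
    simp only [List.length_append, flatKeys_cons, List.length_cons]
    push_cast
    ring

variable [LinearOrder T]

theorem matchEntry_length (t : T) (B : List (T × V)) :
    (matchEntry t B).2.length + (matchEntry t B).1.toList.length = B.length := by
  cases B with
  | nil => rfl
  | cons b B =>
    simp only [matchEntry]
    split <;> simp

/-- The number of entries of the bulk that have been read. -/
def consumed (B B' : List (T × V)) : ℝ := (B.length : ℝ) - B'.length

/-- Search and pass up in a child that satisfies `ok` take time at most `α` for each entry read,
plus `f`; here 9 steps are put aside for each promoted treelet. -/
def ChildCost (ok : C → Prop) (α : ℝ) (f : C → ℝ)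
    (descend : WithTop T → C → List (T × V) → Timed (S × List (T × V)))
    (up : Loc → C → S → Timed (C × List (Treelet T V C))) : Prop :=
  ∀ (loc : Loc) (hi : WithTop T) (c : C) (B : List (T × V)), ok c → before hi B →
    (((descend hi c B).time + (up loc c (descend hi c B).val.1).time +
      9 * (up loc c (descend hi c B).val.1).val.2.length : ℕ) : ℝ) ≤
        α * consumed B (descend hi c B).val.2 + f c

variable {descend : WithTop T → C → List (T × V) → Timed (S × List (T × V))}
  {up : Loc → C → S → Timed (C × List (Treelet T V C))}

/-- The cost of a visit to a child, in terms of the cost of search and pass up there. -/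
theorem enter_visit_cost (H0 : ∀ loc c s, recCount (up loc c s).val.2 = 0) (loc : Loc)
    (hi : WithTop T) (c : C) (B : List (T × V)) {α x : ℝ} (hx : 0 ≤ x)
    (h : before hi B → (((descend hi c B).time + (up loc c (descend hi c B).val.1).time +
      9 * (up loc c (descend hi c B).val.1).val.2.length : ℕ) : ℝ) ≤
        α * consumed B (descend hi c B).val.2 + x) :
    (((enter descend hi c B).time + (visit up loc c (enter descend hi c B).val.1).time +
      8 * insCount (visit up loc c (enter descend hi c B).val.1).val.2 : ℕ) : ℝ) ≤
        1 + α * consumed B (enter descend hi c B).val.2 + x := by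
  unfold enter
  split
  · rename_i hb
    have h1 := h hb
    have h2 := insCount_add_recCount (up loc c (descend hi c B).val.1).val.2
    rw [H0] at h2
    simp only [Timed.val_bind, Timed.val_pure, Timed.time_bind, Timed.time_pure, visit, time_tick]
    push_cast at h1 ⊢
    have h3 : (insCount (up loc c (descend hi c B).val.1).val.2 : ℝ) =
      (up loc c (descend hi c B).val.1).val.2.length := by exact_mod_cast h2
    rw [h3]
    linarith
  · simp [visit, consumed, insCount]
    linarith

/-- The steps of a scan of a node and of the subsequent visits to its children, with 8 steps for
each treelet promoted from a child. -/
def scanCost (left right : Bool)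
    (up : Loc → C → S → Timed (C × List (Treelet T V C))) (c : C) (r : List ((T × V) × C))
    (s : Timed (SiteNode V S × List (T × V))) : ℕ :=
  s.time + (gather up left right c r s.val.1).time +
    8 * insCount (gather up left right c r s.val.1).val.2

theorem scanCost_nil (left right : Bool) (hi : WithTop T) (c : C) (B : List (T × V)) :
    scanCost left right up c [] (scan descend hi c [] B) =
      1 + ((enter descend hi c B).time +
        (visit up ⟨left, right⟩ c (enter descend hi c B).val.1).time +
        8 * insCount (visit up ⟨left, right⟩ c (enter descend hi c B).val.1).val.2) := by
  simp only [scanCost, scan_nil_val, scan_nil_time, gather, Timed.val_bind, Timed.time_bind,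
    Timed.val_pure, Timed.time_pure]
  omega

theorem recCount_gather_nil (H0 : ∀ loc c s, recCount (up loc c s).val.2 = 0) (left right : Bool)
    (hi : WithTop T) (c : C) (B : List (T × V)) :
    recCount (gather up left right c [] (scan descend hi c [] B).val.1).val.2 = 0 :=
  recCount_visit H0 _ _ _

section cons

variable (left right : Bool) (hi : WithTop T) (c : C) (e : (T × V) × C) (r : List ((T × V) × C))
  (B : List (T × V))

theorem gather_scan_cons :
    gather up left right c (e :: r) (scan descend hi c (e :: r) B).val.1 =
      (tick 1 >>= fun _ => visit up ⟨left, false⟩ c (enter descend e.1.1 c B).val.1 >>= fun p =>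
        gather up false right e.2 r (scanIf descend hi e.2 r
          (matchEntry e.1.1 (enter descend e.1.1 c B).val.2).2).val.1 >>= fun q' =>
        pure ((p.1, (e.1, q'.1.1) :: q'.1.2), p.2 ++
          ((matchEntry e.1.1 (enter descend e.1.1 c B).val.2).1.map
            fun v => .recomputation (e.1.1, v)).toList ++ q'.2)) := by
  rw [scan_cons_val]
  rfl

theorem scanCost_cons :
    scanCost left right up c (e :: r) (scan descend hi c (e :: r) B) =
      2 + ((enter descend e.1.1 c B).time +
        (visit up ⟨left, false⟩ c (enter descend e.1.1 c B).val.1).time +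
        8 * insCount (visit up ⟨left, false⟩ c (enter descend e.1.1 c B).val.1).val.2) +
      scanCost false right up e.2 r
        (scanIf descend hi e.2 r (matchEntry e.1.1 (enter descend e.1.1 c B).val.2).2) := by
  simp only [scanCost, gather_scan_cons, scan_cons_time, Timed.val_bind, Timed.time_bind,
    Timed.val_pure, Timed.time_pure, time_tick, insCount_append, counts_toList]
  omega

theorem recCount_gather_cons (H0 : ∀ loc c s, recCount (up loc c s).val.2 = 0) :
    recCount (gather up left right c (e :: r) (scan descend hi c (e :: r) B).val.1).val.2 =
      (matchEntry e.1.1 (enter descend e.1.1 c B).val.2).1.toList.length +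
        recCount (gather up false right e.2 r (scanIf descend hi e.2 r
          (matchEntry e.1.1 (enter descend e.1.1 c B).val.2).2).val.1).val.2 := by
  simp only [gather_scan_cons, Timed.val_bind, Timed.val_pure, recCount_append, counts_toList,
    recCount_visit H0]
  omega

end cons

/-- Each child costs its parent at most 3 steps: one in the scan, one in the gathering, one for the
visit. A bulk entry that matches an entry of the node is read outside the children, so its `α` is
not spent there; it appears as `α` times the number of recomputation events on the left and is left
over to pay for those events. -/
theorem ChildCost.scan {ok : C → Prop} {α : ℝ} {f : C → ℝ}
    (H : ChildCost ok α f descend up) (H0 : ∀ loc c s, recCount (up loc c s).val.2 = 0)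
    (hf : ∀ c, ok c → 0 ≤ f c) (right : Bool) (hi : WithTop T) :
    ∀ (r : List ((T × V) × C)) (left : Bool) (c : C) (B : List (T × V)), ok c →
      (∀ x ∈ r, ok x.2) →
      (scanCost left right up c r (scan descend hi c r B) : ℝ) +
        α * recCount (gather up left right c r (FiBA.scan descend hi c r B).val.1).val.2 ≤
        3 * (r.length + 1) + α * consumed B (FiBA.scan descend hi c r B).val.2 +
          (f c + childSum f r) ∧
      recCount (gather up left right c r (FiBA.scan descend hi c r B).val.1).val.2 ≤ r.length
  | [], left, c, B, hc, _ => by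
    rw [scanCost_nil, recCount_gather_nil H0, scan_nil_val]
    have h1 := enter_visit_cost H0 ⟨left, right⟩ hi c B (hf c hc) (H ⟨left, right⟩ hi c B hc)
    push_cast at h1 ⊢
    simp only [List.length_nil, Nat.cast_zero, childSum_nil]
    refine ⟨by linarith, le_rfl⟩
  | e :: r, left, c, B, hc, hr => by
    rw [scanCost_cons, recCount_gather_cons _ _ _ _ _ _ _ H0, scan_cons_val]
    have h1 := enter_visit_cost H0 ⟨left, false⟩ e.1.1 c B (hf c hc)
      (H ⟨left, false⟩ e.1.1 c B hc)
    have h2 := matchEntry_length e.1.1 (enter descend e.1.1 c B).val.2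
    have h2' := length_toList_le_one (matchEntry e.1.1 (enter descend e.1.1 c B).val.2).1
    generalize (enter descend e.1.1 c B).val.2 = B1 at *
    generalize matchEntry e.1.1 B1 = q at *
    have hre : ok e.2 := hr e (by simp)
    have hrr : ∀ x ∈ r, ok x.2 := fun x hx => hr x (by simp [hx])
    have tail : (scanCost false right up e.2 r (scanIf descend hi e.2 r q.2) : ℝ) + α *
          recCount (gather up false right e.2 r (scanIf descend hi e.2 r q.2).val.1).val.2 ≤
        3 * (r.length + 1) + α * consumed q.2 (scanIf descend hi e.2 r q.2).val.2 +
          (f e.2 + childSum f r) ∧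
        recCount (gather up false right e.2 r (scanIf descend hi e.2 r q.2).val.1).val.2 ≤
          r.length := by
      unfold scanIf
      split
      · exact ChildCost.scan H H0 hf right hi r false e.2 q.2 hre hrr
      · have := hf e.2 hre
        have := childSum_nonneg r fun x hx => hf x.2 (hrr x hx)
        simp only [scanCost, Timed.val_pure, gather_none, Timed.time_pure, consumed]
        refine ⟨?_, by simp [recCount]⟩
        simp [insCount, recCount]
        linarith
    obtain ⟨t1, t2⟩ := tail
    refine ⟨?_, by simp only [List.length_cons]; omega⟩
    have h2r : (q.2.length : ℝ) + q.1.toList.length = B1.length := by exact_mod_cast h2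
    have h3 : α * consumed B (scanIf descend hi e.2 r q.2).val.2 =
        α * consumed B B1 + α * q.1.toList.length +
          α * consumed q.2 (scanIf descend hi e.2 r q.2).val.2 := by
      simp only [consumed, ← h2r]
      ring
    simp only [h3, childSum_cons, List.length_cons]
    push_cast at h1 ⊢
    linarith

/-- Number of timestamps in the list that are at least `t`. -/
def lateCount (t : T) (l : List T) : ℕ := l.countP fun x => decide (t ≤ x)

theorem lateCount_append (t : T) (l l' : List T) :
    lateCount t (l ++ l') = lateCount t l + lateCount t l' := by simp [lateCount]

theorem lateCount_eq_length {t : T} {l : List T} (h : ∀ x ∈ l, t ≤ x) :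
    lateCount t l = l.length := by
  rw [lateCount, List.countP_eq_length]
  simpa using h

/-- The cost of a scan by a bulk with earliest entry `b`, if the cost of a visit to a subtree is
at most `x + β n`, where `n` is the number of timestamps not before `b`, and at most
`β (n + 1) - s` if all `n` timestamps are later than `b`. -/
theorem scan_cost_left {kk : C → List T} {ok : C → Prop} {α β x s γ : ℝ} {b : T × V}
    (H0 : ∀ loc c s, recCount (up loc c s).val.2 = 0)
    (Hfull : ChildCost ok α (fun c => β * ((kk c).length + 1) - s) descend up)
    (hf : ∀ c, ok c → 0 ≤ β * ((kk c).length + 1) - s)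
    (Hleft : ∀ (loc : Loc) (hi : WithTop T) (c : C) (B : List (T × V)), ok c →
      (kk c).Pairwise (· < ·) → before hi (b :: B) →
      (((descend hi c (b :: B)).time + (up loc c (descend hi c (b :: B)).val.1).time +
        9 * (up loc c (descend hi c (b :: B)).val.1).val.2.length : ℕ) : ℝ) ≤
          α * consumed (b :: B) (descend hi c (b :: B)).val.2 + (x + β * lateCount b.1 (kk c)))
    (hx : 0 ≤ x) (hβ : 0 ≤ β) (hs : 0 ≤ s) (hγ : γ ≤ α + s) (right : Bool) (hi : WithTop T)
    (B : List (T × V)) :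
    ∀ (r : List ((T × V) × C)) (left : Bool) (c : C), ok c → (∀ x ∈ r, ok x.2) →
      (kk c ++ flatKeys kk r).Pairwise (· < ·) →
      (scanCost left right up c r (scan descend hi c r (b :: B)) : ℝ) +
        γ * recCount (gather up left right c r (scan descend hi c r (b :: B)).val.1).val.2 ≤
        3 * (r.length + 1) + α * consumed (b :: B) (scan descend hi c r (b :: B)).val.2 +
          (x + β * lateCount b.1 (kk c ++ flatKeys kk r))
  | [], left, c, hc, _, hk => by
    rw [flatKeys_nil, List.append_nil] at hk ⊢
    rw [scanCost_nil, recCount_gather_nil H0, scan_nil_val]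
    have h1 := enter_visit_cost (up := up) H0 ⟨left, right⟩ hi c (b :: B)
      (add_nonneg hx (mul_nonneg hβ (Nat.cast_nonneg (lateCount b.1 (kk c)))))
      (Hleft ⟨left, right⟩ hi c B hc hk)
    push_cast at h1 ⊢
    simp only [List.length_nil, Nat.cast_zero]
    linarith
  | e :: r, left, c, hc, hr, hk => by
    have hre : ok e.2 := hr e (by simp)
    have hrr : ∀ x ∈ r, ok x.2 := fun x hx => hr x (by simp [hx])
    rw [flatKeys_cons] at hk ⊢
    obtain ⟨k1, k2, k3⟩ := List.pairwise_append.1 hk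
    obtain ⟨k4, k5⟩ := List.pairwise_cons.1 k2
    rw [scanCost_cons, recCount_gather_cons _ _ _ _ _ _ _ H0, scan_cons_val]
    have hlc : lateCount b.1 (kk c ++ e.1.1 :: (kk e.2 ++ flatKeys kk r)) =
        lateCount b.1 (kk c) + lateCount b.1 [e.1.1] + lateCount b.1 (kk e.2 ++ flatKeys kk r) := by
      rw [lateCount_append, ← List.singleton_append, lateCount_append]
      omega
    -- If the entry lies before the bulk, neither it nor the child before it receives anything, and
    -- the boundary is further right. Otherwise the boundary concerns only the child `c`, and
    -- everything from the entry on is late.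
    rcases lt_or_ge e.1.1 b.1 with hlt | hge
    · have e1 : enter descend e.1.1 c (b :: B) = pure (none, b :: B) := by
        have : ¬ before (e.1.1 : WithTop T) (b :: B) := by
          simpa [before] using hlt.le
        rw [enter, if_neg this]
      have e2 : matchEntry e.1.1 (b :: B) = (none, b :: B) := by
        simp [matchEntry, hlt.ne']
      simp only [e1, Timed.val_pure, Timed.time_pure, e2, visit]
      have tail : (scanCost false right up e.2 r (scanIf descend hi e.2 r (b :: B)) : ℝ) + γ *
            recCount (gather up false right e.2 r (scanIf descend hi e.2 r (b :: B)).val.1).val.2 ≤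
          3 * (r.length + 1) + α * consumed (b :: B) (scanIf descend hi e.2 r (b :: B)).val.2 +
            (x + β * lateCount b.1 (kk e.2 ++ flatKeys kk r)) := by
        unfold scanIf
        split
        · exact scan_cost_left H0 Hfull hf Hleft hx hβ hs hγ right hi B r false e.2 hre hrr k5
        · simp only [scanCost, Timed.val_pure, gather_none, Timed.time_pure, consumed]
          have := mul_nonneg hβ (Nat.cast_nonneg (lateCount b.1 (kk e.2 ++ flatKeys kk r)))
          simp [insCount, recCount]
          linarith
      have h0 : β * (lateCount b.1 (kk e.2 ++ flatKeys kk r) : ℝ) ≤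
          β * (lateCount b.1 (kk c ++ e.1.1 :: (kk e.2 ++ flatKeys kk r)) : ℝ) := by
        refine mul_le_mul_of_nonneg_left ?_ hβ
        rw [hlc]
        push_cast
        have := Nat.cast_nonneg (α := ℝ) (lateCount b.1 (kk c))
        have := Nat.cast_nonneg (α := ℝ) (lateCount b.1 [e.1.1])
        linarith
      simp only [insCount, List.countP_nil, Option.toList_none, List.length_nil, List.length_cons]
      push_cast
      linarith
    · have h1 := enter_visit_cost (up := up) H0 ⟨left, false⟩ e.1.1 c (b :: B)
        (add_nonneg hx (mul_nonneg hβ (Nat.cast_nonneg (lateCount b.1 (kk c)))))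
        (Hleft ⟨left, false⟩ e.1.1 c B hc k1)
      have h2 := matchEntry_length e.1.1 (enter descend e.1.1 c (b :: B)).val.2
      have h2' := length_toList_le_one (matchEntry e.1.1 (enter descend e.1.1 c (b :: B)).val.2).1
      generalize (enter descend e.1.1 c (b :: B)).val.2 = B1 at *
      generalize matchEntry e.1.1 B1 = q at *
      -- The `+ 1` of a subtree's size stands for one entry of the node; the one left over after
      -- summation is the entry `e` itself. The amounts `s` of the `r.length + 1` subtrees help to
      -- pay for the recomputation events, of which there are at most as many.
      have hsum := childSum_size kk β s r e.2
      have hsum0 : 0 ≤ (β * ((kk e.2).length + 1) - s) +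
          childSum (fun c => β * ((kk c).length + 1) - s) r :=
        add_nonneg (hf e.2 hre) (childSum_nonneg r fun x hx => hf x.2 (hrr x hx))
      have tail : (scanCost false right up e.2 r (scanIf descend hi e.2 r q.2) : ℝ) + α *
            recCount (gather up false right e.2 r (scanIf descend hi e.2 r q.2).val.1).val.2 ≤
          3 * (r.length + 1) + α * consumed q.2 (scanIf descend hi e.2 r q.2).val.2 +
            ((β * ((kk e.2).length + 1) - s) +
              childSum (fun c => β * ((kk c).length + 1) - s) r) ∧
          recCount (gather up false right e.2 r (scanIf descend hi e.2 r q.2).val.1).val.2 ≤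
            r.length := by
        unfold scanIf
        split
        · exact Hfull.scan H0 hf right hi r false e.2 q.2 hre hrr
        · simp only [scanCost, Timed.val_pure, gather_none, Timed.time_pure, consumed]
          refine ⟨?_, by simp [recCount]⟩
          simp [insCount, recCount]
          linarith
      obtain ⟨t1, t2⟩ := tail
      rw [hsum] at t1
      have hl1 : lateCount b.1 [e.1.1] = 1 := lateCount_eq_length (by simpa using hge)
      have hl2 : lateCount b.1 (kk e.2 ++ flatKeys kk r) = (kk e.2 ++ flatKeys kk r).length :=
        lateCount_eq_length fun y hy => hge.trans (k4 y hy).le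
      have h2r : (q.2.length : ℝ) + q.1.toList.length = B1.length := by exact_mod_cast h2
      have h3 : α * consumed (b :: B) (scanIf descend hi e.2 r q.2).val.2 =
          α * consumed (b :: B) B1 + α * q.1.toList.length +
            α * consumed q.2 (scanIf descend hi e.2 r q.2).val.2 := by
        simp only [consumed, ← h2r]
        ring
      rw [hlc, hl1, hl2, h3]
      generalize recCount (gather up false right e.2 r
        (scanIf descend hi e.2 r q.2).val.1).val.2 = n at *
      have h4 : γ * (q.1.toList.length + n : ℝ) ≤ (α + s) * (q.1.toList.length + n) :=
        mul_le_mul_of_nonneg_right hγ (by positivity)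
      have h5 : s * (q.1.toList.length + n : ℝ) ≤ s * (r.length + 1) := by
        refine mul_le_mul_of_nonneg_left ?_ hs
        have : q.1.toList.length + n ≤ r.length + 1 := by omega
        exact_mod_cast this
      simp only [List.length_cons]
      push_cast at h1 ⊢
      linarith

end cost

/-! ### The cost of the search and the pass up in a subtree -/

section workload

variable {T V : Type u}

theorem childSum_zero {C : Type u} : ∀ r : List ((T × V) × C),
    childSum (fun _ => (0 : ℝ)) r = 0
  | [] => rfl
  | p :: r => by rw [childSum_cons, childSum_zero r, add_zero]

theorem arity_cast_le {μ h : ℕ} {y : Tree T V (h + 1)} (hy : Node.arity y ≤ 2 * μ) :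
    3 * ((List.length (α := (T × V) × Tree T V h) y.rest : ℝ) + 1) ≤ 6 * μ := by
  have : ((List.length (α := (T × V) × Tree T V h) y.rest : ℝ) + 1) ≤ 2 * μ := by
    exact_mod_cast hy
  linarith

/-- Every node has at least two children. The size with one added is additive over children, so it
at least doubles at each level. -/
theorem two_pow_le_size {μ : ℕ} (hμ : 2 ≤ μ) : ∀ (h : ℕ) (y : Tree T V h), Tree.ArityOK μ h y →
    2 ^ h ≤ (Tree.keys h y).length + 1
  | 0, y, _ => by simp [Tree.keys_zero]
  | h + 1, y, hy => by
    have h1 := two_pow_le_size hμ h y.first hy.2.2.1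
    have h2 : 2 ≤ y.rest.length + 1 := hμ.trans hy.1
    rw [Tree.keys_succ]
    obtain ⟨p, r, hr⟩ := List.exists_cons_of_ne_nil (l := y.rest)
      (fun h => by rw [h] at h2; simp at h2)
    have h3 := two_pow_le_size hμ h p.2 (hy.2.2.2 p (by rw [hr]; simp))
    rw [hr, flatKeys_cons, pow_succ]
    simp only [List.length_append, List.length_cons]
    omega

variable [LinearOrder T]

theorem takeBefore_length (hi : WithTop T) : ∀ B : List (T × V),
    (takeBefore hi B).val.1.length + (takeBefore hi B).val.2.length = B.length ∧
    (takeBefore hi B).time ≤ (takeBefore hi B).val.1.length + 1 ∧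
    (before hi B → 1 ≤ (takeBefore hi B).val.1.length)
  | [] => by simp [takeBefore, before]
  | b :: B => by
    obtain ⟨h1, h2, -⟩ := takeBefore_length hi B
    simp only [takeBefore, Timed.val_bind, Timed.time_bind, time_tick, before]
    split
    · simp
      omega
    · rename_i h
      simp [h]

/-- A search does not put entries back, and it reads at least one entry if it has to. -/
theorem search_consumes : ∀ (h : ℕ) (hi : WithTop T) (y : Tree T V h) (B : List (T × V)),
    (search h hi y B).val.2.length ≤ B.length ∧
      (before hi B → (search h hi y B).val.2.length < B.length)
  | 0, hi, y, B => by
    obtain ⟨h1, -, h3⟩ := takeBefore_length hi B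
    refine ⟨?_, fun hb => ?_⟩
    · simp only [search]; omega
    · have := h3 hb
      simp only [search]; omega
  | h + 1, hi, y, B => by
    have henter : ∀ (hi : WithTop T) (c : Tree T V h) (B : List (T × V)),
        (enter (search h) hi c B).val.2.length ≤ B.length ∧
          (before hi B → (enter (search h) hi c B).val.2.length < B.length) := by
      intro hi c B
      unfold enter
      split
      · exact search_consumes h hi c B
      · rename_i hb
        exact ⟨le_rfl, fun hb' => absurd hb' hb⟩
    have key : ∀ (r : List ((T × V) × Tree T V h)) (c : Tree T V h) (B : List (T × V)),
        (scan (search h) hi c r B).val.2.length ≤ B.length ∧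
          (before hi B → (scan (search h) hi c r B).val.2.length < B.length) := by
      intro r
      induction r with
      | nil => exact fun c B => henter hi c B
      | cons e r ih =>
        intro c B
        rw [scan_cons_val]
        have h1 := henter e.1.1 c B
        have h2 := matchEntry_length e.1.1 (enter (search h) e.1.1 c B).val.2
        have tail : ∀ B', (scanIf (search h) hi e.2 r B').val.2.length ≤ B'.length ∧
            (before hi B' → (scanIf (search h) hi e.2 r B').val.2.length < B'.length) := by
          intro B'
          unfold scanIf
          split
          · exact ih e.2 B'
          · rename_i hb
            exact ⟨le_rfl, fun hb' => absurd hb' hb⟩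
        have h3 := tail (matchEntry e.1.1 (enter (search h) e.1.1 c B).val.2).2
        refine ⟨by simp only; omega, fun hb => ?_⟩
        by_cases hbe : before (e.1.1 : WithTop T) B
        · have := h1.2 hbe
          simp only
          omega
        · have he : (enter (search h) e.1.1 c B).val.2 = B := by
            rw [enter, if_neg hbe]; rfl
          rw [he] at h2 h3 ⊢
          match B, hb, hbe with
          | b :: B, hb, hbe =>
            by_cases hm : b.1 = e.1.1
            · have : (matchEntry e.1.1 (b :: B)).2.length = B.length := by
                simp [matchEntry, hm]
              simp only [List.length_cons] at h3 ⊢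
              omega
            · have hm' : matchEntry e.1.1 (b :: B) = (none, b :: B) := by
                simp [matchEntry, hm]
              rw [hm'] at h3 ⊢
              exact h3.2 hb
    exact key y.rest y.first B

theorem one_le_consumed {h : ℕ} {hi : WithTop T} {y : Tree T V h} {B : List (T × V)}
    (hb : before hi B) : 1 ≤ consumed B (search h hi y B).val.2 := by
  have := (search_consumes h hi y B).2 hb
  have : ((search h hi y B).val.2.length : ℝ) + 1 ≤ B.length := by exact_mod_cast this
  unfold consumed
  linarith

theorem consumed_nonneg (h : ℕ) (hi : WithTop T) (y : Tree T V h) (B : List (T × V)) :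
    0 ≤ consumed B (search h hi y B).val.2 := by
  have : ((search h hi y B).val.2.length : ℝ) ≤ B.length := by
    exact_mod_cast (search_consumes h hi y B).1
  unfold consumed
  linarith

variable [Monoid V]

/-- The time of search and pass up in a subtree, with 9 steps for each promoted treelet. -/
def workload (μ h : ℕ) (loc : Loc) (hi : WithTop T) (y : Tree T V h) (B : List (T × V)) : ℕ :=
  (search h hi y B).time + (passUp μ h loc y (search h hi y B).val.1).time +
    9 * (passUp μ h loc y (search h hi y B).val.1).val.2.length

theorem passUp_zero_val (μ : ℕ) (loc : Loc) (y : Tree T V 0) (s : List (T × V)) :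
    (passUp μ 0 loc y s).val.2 = insertions (s.map fun e => (e, y)) := by
  unfold insertions
  rw [List.map_map]
  rfl

theorem recCount_passUp (μ : ℕ) : ∀ (h : ℕ) (loc : Loc) (y : Tree T V h) (s : Sites T V h),
    recCount (passUp μ h loc y s).val.2 = 0
  | 0, loc, y, s => (congrArg recCount (passUp_zero_val μ loc y s)).trans (recCount_insertions _)
  | h + 1, loc, y, s => by
    have e : passUp μ (h + 1) loc y s =
      (gather (passUp μ h) loc.left loc.right y.first y.rest s >>= fun p =>
        tick ((h + 1) * recCount p.2) >>= fun _ => processTarget μ h loc p.1.1 p.1.2 p.2) := rfl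
    rw [e]
    simp only [Timed.val_bind]
    rw [processTarget]
    simp only [Timed.val_bind]
    split
    · rfl
    · exact (bulkSplit_cost _ _ _ _ _ _ _).2.2

/-- Of the 9 steps put aside for a treelet by a child, one went into handing it over, and the
remaining 8 cover the 7 of `processTarget_cost`. A recomputation event has no such reserve: it costs
7 there and `h + 1` for riding along. -/
theorem workload_succ_le {μ h : ℕ} (hμ : 2 ≤ μ) (loc : Loc) (hi : WithTop T)
    (y : Tree T V (h + 1)) (B : List (T × V)) (hy : Node.arity y ≤ 2 * μ) :
    workload μ (h + 1) loc hi y B ≤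
      scanCost loc.left loc.right (passUp μ h) y.first y.rest
        (scan (search h) hi y.first y.rest B) +
      (h + 8) * recCount (gather (passUp μ h) loc.left loc.right y.first y.rest
        (scan (search h) hi y.first y.rest B).val.1).val.2 + 10 * μ := by
  have e : passUp μ (h + 1) loc y (search (h + 1) hi y B).val.1 =
    (gather (passUp μ h) loc.left loc.right y.first y.rest
      (scan (search h) hi y.first y.rest B).val.1 >>= fun p =>
        tick ((h + 1) * recCount p.2) >>= fun _ => processTarget μ h loc p.1.1 p.1.2 p.2) := rfl
  have e' : search (h + 1) hi y B = scan (search h) hi y.first y.rest B := rfl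
  have hlen := gather_length (passUp μ h) y.rest loc.left loc.right y.first
    (scan (search h) hi y.first y.rest B).val.1
  rw [workload, e, e', scanCost]
  generalize gather (passUp μ h) loc.left loc.right y.first y.rest
    (scan (search h) hi y.first y.rest B).val.1 = g at *
  have h1 := (processTarget_cost hμ loc g.val.1.1 g.val.1.2 g.val.2
    (by rw [hlen]; exact hy)).1
  have h2 := insCount_add_recCount g.val.2
  simp only [Timed.val_bind, Timed.time_bind, time_tick, add_mul] at h1 ⊢
  omega

/-- A bound that is good for subtrees with few timestamps. -/
theorem workload_node_le_mul {μ h : ℕ} (hμ : 2 ≤ μ)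
    (H : ChildCost (Tree.ArityOK μ h) (40 * μ * (h + 1)) (fun _ => 0) (search h)
      (passUp (T := T) (V := V) μ h))
    (loc : Loc) (hi : WithTop T) (y : Tree T V (h + 1)) (B : List (T × V))
    (hy : NodeOK μ 1 h y) (hb : before hi B) :
    (workload μ (h + 1) loc hi y B : ℝ) ≤
      40 * μ * ((h + 1 : ℕ) + 1) * consumed B (search (h + 1) hi y B).val.2 := by
  have h1 := workload_succ_le hμ loc hi y B hy.2.1
  obtain ⟨h2, -⟩ := H.scan (recCount_passUp μ h) (fun _ _ => le_rfl) loc.right hi y.rest loc.left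
    y.first B hy.2.2.1 hy.2.2.2
  have h3 : (1 : ℝ) ≤ consumed B (search (h + 1) hi y B).val.2 := one_le_consumed hb
  have h4 := arity_cast_le hy.2.1
  have e : (search (h + 1) hi y B) = scan (search h) hi y.first y.rest B := rfl
  rw [e] at h3 ⊢
  rw [childSum_zero] at h2
  generalize recCount (gather (passUp μ h) loc.left loc.right y.first y.rest
    (scan (search h) hi y.first y.rest B).val.1).val.2 = n at *
  generalize consumed B (scan (search h) hi y.first y.rest B).val.2 = m at *
  have h1' := (Nat.cast_le (α := ℝ)).2 h1
  push_cast at h1' ⊢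
  have hμ' : (2 : ℝ) ≤ μ := by exact_mod_cast hμ
  -- The recomputation events are paid by the unspent per-entry amounts. The remaining `16 μ` steps
  -- at this node are paid by the raise of the rate by `40 μ`, because at least one entry is read
  -- here.
  have h5 : ((h : ℝ) + 8) * n ≤ 40 * μ * (h + 1) * n := by
    refine mul_le_mul_of_nonneg_right ?_ (Nat.cast_nonneg n)
    nlinarith [Nat.cast_nonneg (α := ℝ) h]
  have h6 : 40 * (μ : ℝ) ≤ 40 * μ * m := by nlinarith
  linarith

theorem workload_le_mul {μ : ℕ} (hμ : 2 ≤ μ) : ∀ h : ℕ,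
    ChildCost (Tree.ArityOK μ h) (40 * μ * (h + 1)) (fun _ => 0) (search h)
      (passUp (T := T) (V := V) μ h)
  | 0 => by
    intro loc hi c B _ hb
    obtain ⟨h1, h2, h3⟩ := takeBefore_length hi B
    have h3 := h3 hb
    have hμ' : (2 : ℝ) ≤ μ := by exact_mod_cast hμ
    have hcons : consumed B (search 0 hi c B).val.2 = (takeBefore hi B).val.1.length := by
      have : ((takeBefore hi B).val.1.length : ℝ) + (takeBefore hi B).val.2.length = B.length := by
        exact_mod_cast h1
      simp only [consumed, search]
      linarith
    rw [hcons]
    -- With `n ≥ 1` entries read: `n + 1` for reading, `n` for the treelets, `9 n` put aside.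
    have hw : (search 0 hi c B).time + (passUp μ 0 loc c (search 0 hi c B).val.1).time +
        9 * (passUp μ 0 loc c (search 0 hi c B).val.1).val.2.length ≤
          12 * (takeBefore hi B).val.1.length := by
      have e1 : (passUp μ 0 loc c (search 0 hi c B).val.1).time =
        (takeBefore hi B).val.1.length := rfl
      have e2 : (passUp μ 0 loc c (search 0 hi c B).val.1).val.2.length =
          (takeBefore hi B).val.1.length :=
        (congrArg List.length (passUp_zero_val μ loc c (takeBefore hi B).val.1)).trans (by simp)
      rw [e1, e2, search]
      omega
    refine (Nat.cast_le.2 hw).trans ?_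
    push_cast
    have : (0 : ℝ) ≤ (takeBefore hi B).val.1.length := Nat.cast_nonneg _
    nlinarith
  | h + 1 => fun loc hi c B hc hb => by
    have := workload_node_le_mul hμ (workload_le_mul hμ h) loc hi c B
      ((arityOK_succ.1 hc).mono (by omega)) hb
    rw [add_zero]
    exact this

/-- The size term of the cost for subtrees of height `l + u`. -/
noncomputable def sizeCost (μ l u : ℕ) (n : ℕ) : ℝ :=
  60 * μ / 2 ^ l * (n + 1) - 30 * μ * (u + 2)

/-- The subtracted credit grows linearly in `u`, the size exponentially: `u + 2 ≤ 2 * 2 ^ u`.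
Nonnegativity allows the subtrees that are not visited to be charged as well. -/
theorem sizeCost_nonneg {μ l u n : ℕ} (h : 2 ^ (l + u) ≤ n + 1) : 0 ≤ sizeCost μ l u n := by
  unfold sizeCost
  have h1 : (2 : ℝ) ^ l * 2 ^ u ≤ n + 1 := by
    rw [← pow_add]
    exact_mod_cast h
  have h2 : (u : ℝ) + 2 ≤ 2 * 2 ^ u := by
    have : u + 1 ≤ 2 ^ u := Nat.lt_two_pow_self
    have h3 : (u : ℝ) + 1 ≤ 2 ^ u := by exact_mod_cast this
    linarith [Nat.cast_nonneg (α := ℝ) u]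
  have h4 : (0 : ℝ) < 2 ^ l := by positivity
  have h5 : 60 * (μ : ℝ) * 2 ^ u ≤ 60 * μ / 2 ^ l * (n + 1) := by
    calc 60 * (μ : ℝ) * 2 ^ u = 60 * μ / 2 ^ l * (2 ^ l * 2 ^ u) := by field_simp
      _ ≤ _ := mul_le_mul_of_nonneg_left h1 (by positivity)
  have h6 : 30 * (μ : ℝ) * (u + 2) ≤ 30 * μ * (2 * 2 ^ u) :=
    mul_le_mul_of_nonneg_left h2 (by positivity)
  linarith

/-- A bound for subtrees of height at least `l` all of whose timestamps count. -/
theorem workload_le_size {μ : ℕ} (hμ : 2 ≤ μ) (l : ℕ) : ∀ u : ℕ,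
    ChildCost (Tree.ArityOK μ (l + u)) (40 * μ * (l + 1))
      (fun y => sizeCost μ l u (Tree.keys (l + u) y).length) (search (l + u))
      (passUp (T := T) (V := V) μ (l + u))
  | 0 => fun loc hi c B hc hb => by
    have h1 := workload_le_mul hμ l loc hi c B hc hb
    have h2 := sizeCost_nonneg (μ := μ) (l := l) (u := 0) (two_pow_le_size hμ l c hc)
    rw [add_zero] at h1
    exact h1.trans (le_add_of_nonneg_right h2)
  | u + 1 => fun loc hi y B hy hb => by
    have h1 := workload_succ_le (h := l + u) hμ loc hi y B hy.2.1
    obtain ⟨h2, h3⟩ := (workload_le_size hμ l u).scan (recCount_passUp μ (l + u))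
      (fun c hc => sizeCost_nonneg (two_pow_le_size hμ (l + u) c hc)) loc.right hi y.rest loc.left
      y.first B hy.2.2.1 hy.2.2.2
    have h4 := arity_cast_le hy.2.1
    have h5 := childSum_size (V := V) (Tree.keys (l + u)) (60 * μ / 2 ^ l) (30 * μ * (u + 2))
      y.rest y.first
    simp only [sizeCost] at h2
    rw [h5, ← Tree.keys_succ] at h2
    have e : (search (l + (u + 1)) hi y B) = scan (search (l + u)) hi y.first y.rest B := rfl
    refine (Nat.cast_le (α := ℝ).2 h1).trans ?_
    rw [e]
    have h6 : (1 : ℝ) ≤ List.length (α := (T × V) × Tree T V (l + u)) y.rest := by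
      have : 2 ≤ y.rest.length + 1 := hμ.trans hy.1
      have : 1 ≤ y.rest.length := by omega
      exact_mod_cast this
    generalize recCount (gather (passUp μ (l + u)) loc.left loc.right y.first y.rest
      (scan (search (l + u)) hi y.first y.rest B).val.1).val.2 = n at *
    generalize consumed B (scan (search (l + u)) hi y.first y.rest B).val.2 = m at *
    have h3' := (Nat.cast_le (α := ℝ)).2 h3
    generalize (List.length (α := (T × V) × Tree T V (l + u)) y.rest : ℝ) = a at *
    have hμ' : (2 : ℝ) ≤ μ := by exact_mod_cast hμ
    have hu := Nat.cast_nonneg (α := ℝ) u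
    have hn := Nat.cast_nonneg (α := ℝ) n
    have h7 : ((l : ℝ) + 8) * n ≤ 40 * μ * (l + 1) * n := by
      refine mul_le_mul_of_nonneg_right ?_ hn
      nlinarith [Nat.cast_nonneg (α := ℝ) l]
    -- The `a + 1` children leave a credit of `30 μ (u + 2) (a + 1)`, of which the node must keep
    -- `30 μ (u + 3)`. The difference is `30 μ (u a + 2 a - 1)`: the part `30 μ u a` carries
    -- recomputation events through the levels above `l`, and the rest, at least `30 μ`, covers the
    -- `16 μ` steps at the node.
    have h8 : (u : ℝ) * n ≤ 30 * μ * u * a := by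
      have : (u : ℝ) * n ≤ u * a := mul_le_mul_of_nonneg_left h3' hu
      have : (u : ℝ) * a * 1 ≤ u * a * (30 * μ) :=
        mul_le_mul_of_nonneg_left (by linarith) (by positivity)
      linarith
    have h9 : 60 * (μ : ℝ) ≤ 60 * μ * a := by nlinarith
    simp only [sizeCost]
    push_cast
    have e2 : Tree.keys (l + (u + 1)) y = Tree.keys (l + u + 1) y := rfl
    rw [e2]
    linarith

/-- A bound for nodes of height greater than `l`, where only the timestamps that are not before the
bulk count. -/
theorem workload_node_le_late {μ : ℕ} (hμ : 2 ≤ μ) (l u : ℕ)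
    (H : ∀ (loc : Loc) (hi : WithTop T) (y : Tree T V (l + u)) (b : T × V) (B : List (T × V)),
      Tree.ArityOK μ (l + u) y → (Tree.keys (l + u) y).Pairwise (· < ·) → before hi (b :: B) →
      (workload μ (l + u) loc hi y (b :: B) : ℝ) ≤
        40 * μ * (l + 1) * consumed (b :: B) (search (l + u) hi y (b :: B)).val.2 +
          (40 * μ * u + 60 * μ / 2 ^ l * lateCount b.1 (Tree.keys (l + u) y)))
    (loc : Loc) (hi : WithTop T) (y : Tree T V (l + u + 1)) (b : T × V) (B : List (T × V))
    (hy : NodeOK μ 1 (l + u) y) (hk : (Tree.keys (l + u + 1) y).Pairwise (· < ·)) :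
    (workload μ (l + u + 1) loc hi y (b :: B) : ℝ) ≤
      40 * μ * (l + 1) * consumed (b :: B) (search (l + u + 1) hi y (b :: B)).val.2 +
        (40 * μ * (u + 1 : ℕ) + 60 * μ / 2 ^ l * lateCount b.1 (Tree.keys (l + u + 1) y)) := by
  have hμ' : (2 : ℝ) ≤ μ := by exact_mod_cast hμ
  have hu := Nat.cast_nonneg (α := ℝ) u
  have hl := Nat.cast_nonneg (α := ℝ) l
  rw [Tree.keys_succ] at hk ⊢
  have h1 := workload_succ_le hμ loc hi y (b :: B) hy.2.1
  -- Here `x` pays for the boundary path above height `l`, to which this node adds `6 μ + 10 μ ≤ 40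
  -- μ`; `γ` is the price of a recomputation event in `workload_succ_le`.
  have h2 := scan_cost_left (kk := Tree.keys (l + u)) (ok := Tree.ArityOK μ (l + u))
    (α := 40 * μ * (l + 1)) (β := 60 * μ / 2 ^ l) (x := 40 * μ * u) (s := 30 * μ * (u + 2))
    (γ := l + u + 8) (b := b) (recCount_passUp (T := T) (V := V) μ (l + u))
    (workload_le_size hμ l u) (fun c hc => sizeCost_nonneg (two_pow_le_size hμ (l + u) c hc))
    (fun loc hi c B hc hk hb => H loc hi c b B hc hk hb) (by positivity) (by positivity)
    (by positivity) (by nlinarith) loc.right hi B y.rest loc.left y.first hy.2.2.1 hy.2.2.2 hk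
  have h4 := arity_cast_le hy.2.1
  have e : (search (l + u + 1) hi y (b :: B)) =
    scan (search (l + u)) hi y.first y.rest (b :: B) := rfl
  refine (Nat.cast_le (α := ℝ).2 h1).trans ?_
  rw [e]
  push_cast
  linarith

theorem workload_le_late {μ : ℕ} (hμ : 2 ≤ μ) (l : ℕ) : ∀ (u : ℕ) (loc : Loc) (hi : WithTop T)
    (y : Tree T V (l + u)) (b : T × V) (B : List (T × V)), Tree.ArityOK μ (l + u) y →
    (Tree.keys (l + u) y).Pairwise (· < ·) → before hi (b :: B) →
    (workload μ (l + u) loc hi y (b :: B) : ℝ) ≤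
      40 * μ * (l + 1) * consumed (b :: B) (search (l + u) hi y (b :: B)).val.2 +
        (40 * μ * u + 60 * μ / 2 ^ l * lateCount b.1 (Tree.keys (l + u) y))
  | 0 => fun loc hi y b B hy _ hb => by
    have h1 := workload_le_mul hμ l loc hi y (b :: B) hy hb
    rw [add_zero] at h1
    refine h1.trans (le_add_of_nonneg_right ?_)
    positivity
  | u + 1 => fun loc hi y b B hy hk _ =>
    workload_node_le_late hμ l u (workload_le_late hμ l u) loc hi y b B
      ((arityOK_succ.1 hy).mono (by omega)) hk

/-- The cost of search and pass up from the node at which the search starts. -/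
theorem workload_le {μ : ℕ} (hμ : 2 ≤ μ) (l h : ℕ) (loc : Loc) (y : Tree T V (h + 1)) (b : T × V)
    (B : List (T × V)) (hy : NodeOK μ 1 h y) (hk : (Tree.keys (h + 1) y).Pairwise (· < ·)) :
    (workload μ (h + 1) loc ⊤ y (b :: B) : ℝ) ≤ 40 * μ * (l + 1) * (b :: B).length +
      40 * μ * (h + 1) + 60 * μ / 2 ^ l * lateCount b.1 (Tree.keys (h + 1) y) := by
  have hm : consumed (b :: B) (search (h + 1) ⊤ y (b :: B)).val.2 ≤ (b :: B).length := by
    unfold consumed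
    linarith [Nat.cast_nonneg (α := ℝ) (search (h + 1) ⊤ y (b :: B)).val.2.length]
  have hm0 := consumed_nonneg (h + 1) ⊤ y (b :: B)
  -- If the whole subtree lies below the cut, the bound per entry suffices.
  rcases Nat.lt_or_ge h l with hl | hl
  · have h1 := workload_node_le_mul hμ (workload_le_mul hμ h) loc ⊤ y (b :: B) hy
      (by simp [before])
    have h2 : 40 * (μ : ℝ) * ((h + 1 : ℕ) + 1) * consumed (b :: B)
        (search (h + 1) ⊤ y (b :: B)).val.2 ≤ 40 * μ * (l + 1) * (b :: B).length := by
      have : ((h + 1 : ℕ) : ℝ) ≤ l := by exact_mod_cast hl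
      gcongr
    have h3 : 0 ≤ 40 * (μ : ℝ) * (h + 1) + 60 * μ / 2 ^ l *
      lateCount b.1 (Tree.keys (h + 1) y) := by positivity
    linarith
  · obtain ⟨u, rfl⟩ := Nat.exists_eq_add_of_le hl
    have h1 := workload_node_le_late hμ l u (workload_le_late hμ l u) loc ⊤ y b B hy hk
    have h2 : 40 * (μ : ℝ) * (l + 1) * consumed (b :: B)
        (search (l + u + 1) ⊤ y (b :: B)).val.2 ≤ 40 * μ * (l + 1) * (b :: B).length := by
      gcongr
    have h3 : 40 * (μ : ℝ) * (u + 1 : ℕ) ≤ 40 * μ * ((l + u : ℕ) + 1) := by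
      push_cast
      have : (0 : ℝ) ≤ μ * l := by positivity
      linarith
    linarith

end workload

/-! ### The walk up from the right finger -/

section finger

variable {T V : Type u}

theorem Node.exists_concat {C : Type u} (y : Node T V C) (hy : 2 ≤ y.arity) :
    ∃ a f l e c, y = ⟨a, f, l ++ [(e, c)]⟩ := by
  rcases y.eq_concat with h | ⟨l, e, c, h⟩
  · simp [Node.arity, h] at hy
  · exact ⟨_, _, l, e, c, h⟩

theorem NodeOK.last {μ a h : ℕ} {y : Tree T V (h + 1)} (hy : NodeOK μ a h y) :
    Tree.ArityOK μ h (Node.last y) := by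
  rcases Node.eq_concat y with h1 | ⟨l, e, c, h1⟩
  · have : Node.last y = y.first := by simp [Node.last, h1]
    rw [this]
    exact hy.2.2.1
  · rw [h1, Node.last_concat]
    exact hy.2.2.2 (e, c) (by rw [h1]; simp)

theorem keys_last_suffix {h : ℕ} (y : Tree T V (h + 1)) :
    Tree.keys h (Node.last y) <:+ Tree.keys (h + 1) y := by
  rw [Tree.keys_succ]
  rcases Node.eq_concat y with h1 | ⟨l, e, c, h1⟩
  · have : Node.last y = y.first := by simp [Node.last, h1]
    rw [this, h1]
    simp
  · rw [h1, Node.last_concat]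
    refine ⟨Tree.keys h y.first ++ flatKeys (Tree.keys h) l ++ [e.1], ?_⟩
    simp

variable [LinearOrder T]

/-- The number of timestamps later than `t`. -/
def laterCount (t : T) (l : List T) : ℕ := l.countP fun x => decide (t < x)

/-- At most one timestamp equals `t`. The cost analysis counts it and the distance `d` does not,
hence the `d + 1` in the final bounds. -/
theorem lateCount_le_laterCount (t : T) : ∀ l : List T, l.Pairwise (· < ·) →
    lateCount t l ≤ laterCount t l + 1
  | [], _ => by simp [lateCount]
  | x :: l, h => by
    obtain ⟨h1, h2⟩ := List.pairwise_cons.1 h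
    have ih := lateCount_le_laterCount t l h2
    unfold lateCount laterCount at ih ⊢
    rw [List.countP_cons, List.countP_cons]
    rcases lt_trichotomy t x with hx | rfl | hx
    · simp only [hx.le, hx, decide_true, if_true]
      omega
    · have e1 : l.countP (fun x => decide (t ≤ x)) = l.length := by
        rw [List.countP_eq_length]
        exact fun x hx => by simpa using (h1 x hx).le
      have e2 : l.countP (fun x => decide (t < x)) = l.length := by
        rw [List.countP_eq_length]
        exact fun x hx => by simpa using h1 x hx
      rw [e1, e2]
      simp
    · simp only [not_le.2 hx, not_lt.2 hx.le, decide_false]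
      simpa using ih

theorem lowestOnSpine_eq_none {t : T} : ∀ (h : ℕ) (y : Tree T V (h + 1)),
    lowestOnSpine t h y = none → Node.startsBy y t = false
  | 0, y, hy => by
    unfold lowestOnSpine at hy
    split at hy
    · exact absurd hy (by simp)
    · rename_i hs
      exact Bool.eq_false_iff.2 hs
  | h + 1, y, hy => by
    rw [lowestOnSpine, Option.or_eq_none_iff] at hy
    have := hy.2
    split at this
    · exact absurd this (by simp)
    · rename_i hs
      exact Bool.eq_false_iff.2 hs

theorem lowestOnSpine_eq_some {t : T} : ∀ (h : ℕ) (y : Tree T V (h + 1)) (k : ℕ),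
    lowestOnSpine t h y = some k → 1 ≤ k ∧ k ≤ h + 1 ∧ ∃ x ∈ Tree.keys (h + 1) y, x ≤ t := by
  have key : ∀ (h : ℕ) (y : Tree T V (h + 1)), Node.startsBy y t = true →
      ∃ x ∈ Tree.keys (h + 1) y, x ≤ t := by
    intro h y hy
    rw [Tree.keys_succ]
    unfold Node.startsBy at hy
    split at hy
    · exact absurd hy (by simp)
    · rename_i e r heq
      refine ⟨e.1.1, ?_, by simpa using hy⟩
      rw [heq]
      simp
  intro h
  induction h with
  | zero =>
    intro y k hk
    unfold lowestOnSpine at hk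
    split at hk
    · rename_i hs
      cases hk
      exact ⟨le_rfl, le_rfl, key 0 y hs⟩
    · exact absurd hk (by simp)
  | succ h ih =>
    intro y k hk
    rw [lowestOnSpine, Option.or_eq_some_iff] at hk
    rcases hk with hk | ⟨-, hk⟩
    · obtain ⟨h1, h2, x, h3, h4⟩ := ih _ k hk
      exact ⟨h1, by omega, x, (keys_last_suffix y).subset h3, h4⟩
    · split at hk
      · rename_i hs
        cases hk
        exact ⟨by omega, le_rfl, key (h + 1) y hs⟩
      · exact absurd hk (by simp)

theorem laterCount_mono {t : T} {l l' : List T} (h : l.Sublist l') :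
    laterCount t l ≤ laterCount t l' := h.countP_le

/-- The height reached by the walk up from the right finger is logarithmic in the number of later
timestamps. -/
theorem two_pow_fingerWalk_le {μ : ℕ} (hμ : 2 ≤ μ) (t : T) : ∀ (h : ℕ) (y : Tree T V (h + 1)),
    NodeOK μ 1 h y → (Tree.keys (h + 1) y).Pairwise (· < ·) →
    2 ^ (lowestOnSpine t h y).getD (h + 1) ≤ 4 * (laterCount t (Tree.keys (h + 1) y) + 1)
  | 0, y, _, _ => by
    have : (lowestOnSpine t 0 y).getD (0 + 1) = 1 := by
      unfold lowestOnSpine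
      split <;> rfl
    rw [this]
    omega
  | h + 1, y, hy, hk => by
    have hl := (keys_last_suffix y).sublist
    have hlast := hy.last
    cases hc : lowestOnSpine t h (Node.last y) with
    | some j =>
      have ih := two_pow_fingerWalk_le hμ t h (Node.last y)
        ((arityOK_succ.1 hlast).mono (by omega)) (hk.sublist hl)
      have e : (lowestOnSpine t (h + 1) y) = some j := by rw [lowestOnSpine, hc]; rfl
      rw [hc, Option.getD_some] at ih
      rw [e, Option.getD_some]
      have := laterCount_mono (t := t) hl
      omega
    | none =>
      have hs := lowestOnSpine_eq_none h _ hc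
      have hle : (lowestOnSpine t (h + 1) y).getD (h + 1 + 1) = h + 2 := by
        rw [lowestOnSpine, hc, Option.none_or]
        split <;> rfl
      rw [hle]
      have hkl := hk.sublist hl
      have hmono := laterCount_mono (t := t) hl
      generalize Node.last y = z at *
      unfold Node.startsBy at hs
      have h2 : 2 ≤ z.rest.length + 1 := hμ.trans hlast.1
      split at hs
      · rename_i heq
        rw [heq] at h2
        simp at h2
      · rename_i e r heq
        have ht : t < e.1.1 := by simpa using hs
        have hsz := two_pow_le_size hμ h e.2 (hlast.2.2.2 e (by rw [heq]; simp))
        rw [Tree.keys_succ, heq, flatKeys_cons] at hkl hmono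
        have hall := (List.pairwise_cons.1 (List.pairwise_append.1 hkl).2.1).1
        -- The last child `z` was passed by because its first entry is later than `t`. That entry
        -- and the subtree of height `h` after it are at least `2 ^ h` later timestamps, against a
        -- walk to height `h + 2`: this is the factor 4.
        have hcount : (Tree.keys h e.2).length + 1 ≤
            laterCount t (Tree.keys h z.first ++ e.1.1 ::
              (Tree.keys h e.2 ++ flatKeys (Tree.keys h) r)) := by
          have hsub : (e.1.1 :: Tree.keys h e.2).Sublist (Tree.keys h z.first ++ e.1.1 ::
              (Tree.keys h e.2 ++ flatKeys (Tree.keys h) r)) :=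
            ((List.sublist_append_left _ _).cons_cons _).trans (List.sublist_append_right _ _)
          refine le_trans (le_of_eq ?_) (laterCount_mono hsub)
          symm
          rw [laterCount, List.countP_eq_length.2]
          · rfl
          · intro x hx
            rcases List.mem_cons.1 hx with rfl | hx
            · simpa using ht
            · simpa using ht.trans (hall x (by simp [hx]))
        rw [pow_add]
        omega

end finger

/-! ### The pass up along the right spine -/

section spine

variable {T V : Type u} [LinearOrder T] [Monoid V]

/-- The result of the pass up along the right spine that starts at height `k` and reaches height
`p.2`, where `w` is the workload of the subtree at height `k`. -/
structure SpineSpec (μ a k h w : ℕ) (lo : WithBot T) (y : Tree T V (h + 1))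
    (p : Timed ((Tree T V (h + 1) × List (Treelet T V (Tree T V (h + 1)))) × ℕ))
    (R : List ((T × V) × Tree T V (h + 1))) : Prop where
  eq_insertions : p.val.1.2 = insertions R
  bounded : Bounded lo ⊤ (Tree.keys (h + 1) p.val.1.1 ++ flatKeys (Tree.keys (h + 1)) R)
  nodeOK : NodeOK μ a h p.val.1.1
  nodeOK_of_ne_nil : R ≠ [] → NodeOK μ μ h p.val.1.1
  arityOK : ∀ x ∈ R, Tree.ArityOK μ (h + 1) x.2
  time_le : p.time + 9 * R.length + 10 * μ * k ≤ w + 10 * μ * p.val.2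
  le_top : k ≤ p.val.2
  top_le : p.val.2 ≤ h + 1
  top_eq : R ≠ [] → p.val.2 = h + 1
  length_le : R.length ≤ w
  potential_le : p.val.2 + (Tree.full μ (h + 1) p.val.1.1 +
    childSum (Tree.full μ (h + 1)) R) + 2 * R.length ≤ k + Tree.full μ (h + 1) y + 2 * w

/-- The bound for the workload of the subtree at height `k`. -/
def WorkloadBound (μ k m n w : ℕ) : Prop :=
  ∀ l : ℕ, (w : ℝ) ≤ 40 * μ * (l + 1) * m + 40 * μ * k + 60 * μ / 2 ^ l * n

/-- The starting point of the climb, with `top = k`. The workload contains 9 steps for each promoted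
treelet and at least one step for each new full node, so `2w` covers both in the potential. -/
theorem spineSpec_start {μ a h : ℕ} (hμ : 2 ≤ μ) (ha : a ≤ μ) (ha1 : 1 ≤ a) (loc : Loc)
    (lo : WithBot T) (y : Tree T V (h + 1)) (b : T × V) (B : List (T × V)) (hy : NodeOK μ a h y)
    (hk : Bounded lo ⊤ (Tree.keys (h + 1) y)) (hB : (b :: B).Pairwise fun a b => a.1 < b.1)
    (hlo : ∀ x ∈ b :: B, lo < (x.1 : WithBot T)) :
    ∃ w R, WorkloadBound μ (h + 1) (b :: B).length (lateCount b.1 (Tree.keys (h + 1) y)) w ∧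
      SpineSpec μ a (h + 1) h w lo y (search (h + 1) ⊤ y (b :: B) >>= fun s =>
        passUp μ (h + 1) loc y s.1 >>= fun p => pure (p, h + 1)) R := by
  obtain ⟨-, R, h1, h2, h3, h4, h5, h6⟩ := passUp_node_spec hμ (passUp_childSpec hμ h) a ha loc lo
    ⊤ y (b :: B) hk hy hB hlo
  have hw : workload μ (h + 1) loc ⊤ y (b :: B) = (search (h + 1) ⊤ y (b :: B)).time +
    (passUp μ (h + 1) loc y (search (h + 1) ⊤ y (b :: B)).val.1).time + 9 * R.length := by
    rw [workload, h1, insertions_length]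
  refine ⟨workload μ (h + 1) loc ⊤ y (b :: B), R, fun l => ?_, ?_⟩
  · have := workload_le hμ l h loc y b B (hy.mono ha1) hk.1
    exact_mod_cast this
  · refine ⟨h1, h2, h3, h4, h5, ?_, le_rfl, le_rfl, fun _ => rfl, ?_, ?_⟩
    · simp only [Timed.val_bind, Timed.time_bind, Timed.val_pure, Timed.time_pure]
      omega
    · omega
    · simp only [Timed.val_bind, Timed.val_pure]
      omega

theorem passUpSpine_of_nil {μ k h : ℕ} {B : List (T × V)} {loc : Loc} {y : Tree T V (h + 1 + 1)}
    (hk : ¬ h + 2 ≤ k)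
    (hp : (passUpSpine μ k B h ⟨false, loc.right⟩ (Node.last y)).val.1.2 = []) :
    passUpSpine μ k B (h + 1) loc y =
      ⟨((Node.setLast y (passUpSpine μ k B h ⟨false, loc.right⟩ (Node.last y)).val.1.1, []),
        (passUpSpine μ k B h ⟨false, loc.right⟩ (Node.last y)).val.2),
        (passUpSpine μ k B h ⟨false, loc.right⟩ (Node.last y)).time⟩ := by
  rw [passUpSpine, if_neg hk]
  generalize passUpSpine μ k B h ⟨false, loc.right⟩ (Node.last y) = p at *
  obtain ⟨⟨⟨z, L⟩, n⟩, t⟩ := p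
  subst hp
  rfl

theorem passUpSpine_of_ne_nil {μ k h : ℕ} {B : List (T × V)} {loc : Loc}
    {y : Tree T V (h + 1 + 1)} (hk : ¬ h + 2 ≤ k)
    (hp : (passUpSpine μ k B h ⟨false, loc.right⟩ (Node.last y)).val.1.2 ≠ []) :
    ∃ z, z = Node.setLast y (passUpSpine μ k B h ⟨false, loc.right⟩ (Node.last y)).val.1.1 ∧
    passUpSpine μ k B (h + 1) loc y =
      ⟨((processTarget μ (h + 1) loc z.first z.rest
          (passUpSpine μ k B h ⟨false, loc.right⟩ (Node.last y)).val.1.2).val, h + 2),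
        (passUpSpine μ k B h ⟨false, loc.right⟩ (Node.last y)).time +
          (processTarget μ (h + 1) loc z.first z.rest
            (passUpSpine μ k B h ⟨false, loc.right⟩ (Node.last y)).val.1.2).time⟩ := by
  refine ⟨_, rfl, ?_⟩
  rw [passUpSpine, if_neg hk]
  generalize passUpSpine μ k B h ⟨false, loc.right⟩ (Node.last y) = p at *
  obtain ⟨⟨⟨z, L⟩, n⟩, t⟩ := p
  cases L with
  | nil => exact absurd rfl hp
  | cons x L => rfl

/-- Either the walk stops at this node, or it stops inside the last child and the climb adds one
level. Treelets from the last child go behind all entries of the node; the level costs `10 μ` steps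
beyond their reserves, and `TargetSpec.potential` pays for raising `top` by one. -/
theorem passUpSpine_spec {μ : ℕ} (hμ : 2 ≤ μ) (b : T × V) (B : List (T × V))
    (hB : (b :: B).Pairwise fun a b => a.1 < b.1) : ∀ (h a k : ℕ) (loc : Loc) (lo : WithBot T)
    (y : Tree T V (h + 1)), a ≤ μ → rootMin h ≤ a → NodeOK μ a h y →
    Bounded lo ⊤ (Tree.keys (h + 1) y) → (∀ x ∈ b :: B, lo < (x.1 : WithBot T)) →
    k = (lowestOnSpine b.1 h y).getD (h + 1) →
    ∃ w R, WorkloadBound μ k (b :: B).length (lateCount b.1 (Tree.keys (h + 1) y)) w ∧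
      SpineSpec μ a k h w lo y (passUpSpine μ k (b :: B) h loc y) R
  | 0, a, k, loc, lo, y, ha, ha1, hy, hk, hlo, hkk => by
    have : k = 1 := by
      rw [hkk]
      unfold lowestOnSpine
      split <;> rfl
    subst this
    exact spineSpec_start hμ ha ha1 loc lo y b B hy hk hB hlo
  | h + 1, a, k, loc, lo, y, ha, ha1, hy, hk, hlo, hkk => by
    cases hc : lowestOnSpine b.1 h (Node.last y) with
    | none =>
      have : k = h + 2 := by
        rw [hkk, lowestOnSpine, hc, Option.none_or]
        split <;> rfl
      subst this
      rw [passUpSpine, if_pos le_rfl]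
      exact spineSpec_start hμ ha (by unfold rootMin at ha1; simp at ha1; omega) loc lo y b B hy hk
        hB hlo
    | some j =>
      have hj : k = j := by rw [hkk, lowestOnSpine, hc]; rfl
      subst hj
      obtain ⟨j1, j2, x, j3, j4⟩ := lowestOnSpine_eq_some h _ k hc
      have ha2 : 2 ≤ a := by unfold rootMin at ha1; simpa using ha1
      obtain ⟨ag, f, l, e, c, rfl⟩ := Node.exists_concat y (ha2.trans hy.1)
      obtain ⟨y1, y2, y3, y4⟩ := nodeOK_mk.1 hy
      rw [Node.last_concat] at hc j3
      have hkeys : Tree.keys (h + 1 + 1)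
          (⟨ag, f, l ++ [(e, c)]⟩ : Node T V (Tree T V (h + 1))) =
          (Tree.keys (h + 1) f ++ flatKeys (Tree.keys (h + 1)) l) ++ e.1 :: Tree.keys (h + 1) c := by
        rw [Tree.keys_mk, flatKeys_append, flatKeys_cons, flatKeys_nil]
        simp
      have hk' := hk
      rw [hkeys] at hk'
      obtain ⟨k1, k2, k3, k4⟩ := hk'.split
      have hcOK : Tree.ArityOK μ (h + 1) c := y4 (e, c) (by simp)
      -- The walk stopped inside the last child because of a timestamp `x ≤ b.1` there. It is later
      -- than the separating entry `e`, hence so is the whole bulk, and the search may be confined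
      -- to that child.
      have hlo' : ∀ x ∈ b :: B, ((e.1 : T) : WithBot T) < (x.1 : WithBot T) := by
        intro z hz
        have hbz : b.1 ≤ z.1 := by
          rcases List.mem_cons.1 hz with rfl | hz
          · exact le_rfl
          · exact ((List.pairwise_cons.1 hB).1 z hz).le
        exact (k2.2 x j3).1.trans_le (WithBot.coe_le_coe.2 (j4.trans hbz))
      obtain ⟨w, R, hw, hS⟩ := passUpSpine_spec hμ b B hB h μ k ⟨false, loc.right⟩ e.1 c le_rfl
        ((rootMin_le_two h).trans hμ) (arityOK_succ.1 hcOK) k2 hlo' (by rw [hc]; rfl)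
      have hfull : Tree.full μ (h + 1 + 1)
          (⟨ag, f, l ++ [(e, c)]⟩ : Node T V (Tree T V (h + 1))) =
          fullInd μ (l.length + 1) + Tree.full μ (h + 1) f +
            (childSum (Tree.full μ (h + 1)) l + Tree.full μ (h + 1) c) := by
        rw [Tree.full_mk]
        simp
      have hwb : WorkloadBound μ k (b :: B).length (lateCount b.1 (Tree.keys (h + 1 + 1)
          (⟨ag, f, l ++ [(e, c)]⟩ : Node T V (Tree T V (h + 1))))) w := by
        intro l'
        refine (hw l').trans ?_
        have : lateCount b.1 (Tree.keys (h + 1) c) ≤ lateCount b.1 (Tree.keys (h + 1 + 1)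
            (⟨ag, f, l ++ [(e, c)]⟩ : Node T V (Tree T V (h + 1)))) := by
          rw [hkeys]
          exact ((List.sublist_cons_self _ _).trans (List.sublist_append_right _ _)).countP_le
        gcongr
      have hstep0 := passUpSpine_of_nil (μ := μ) (k := k) (B := b :: B) (loc := loc)
        (y := (⟨ag, f, l ++ [(e, c)]⟩ : Node T V (Tree T V (h + 1)))) (by omega)
      have hstep1 := passUpSpine_of_ne_nil (μ := μ) (k := k) (B := b :: B) (loc := loc)
        (y := (⟨ag, f, l ++ [(e, c)]⟩ : Node T V (Tree T V (h + 1)))) (by omega)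
      rw [Node.last_concat, Node.setLast_concat] at hstep0 hstep1
      generalize passUpSpine μ k (b :: B) h ⟨false, loc.right⟩ c = p at *
      generalize passUpSpine μ k (b :: B) (h + 1) loc
        (⟨ag, f, l ++ [(e, c)]⟩ : Node T V (Tree T V (h + 1))) = q at *
      obtain ⟨s1, s2, s3, s4, s5, s6, s7, s8, s9, s10, s11⟩ := hS
      have hlen : (l ++ [(e, p.val.1.1)]).length = l.length + 1 := by simp
      have hlen' : (l ++ [(e, c)]).length = l.length + 1 := by simp
      rw [hlen'] at y1 y2
      have hkids : ∀ q ∈ l ++ [(e, p.val.1.1)], Tree.ArityOK μ (h + 1) q.2 := by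
        intro q hq
        rcases List.mem_append.1 hq with hq | hq
        · exact y4 q (by simp [hq])
        · rw [List.mem_singleton.1 hq]
          exact s3
      have hbd := k1.glue s2 k3 k4
      by_cases hR : R = []
      · subst hR
        have hq := hstep0 s1
        subst hq
        simp only [flatKeys_nil, List.append_nil, childSum_nil, List.length_nil] at hbd s6 s11
        refine ⟨w, [], hwb, rfl, ?_, ?_, by simp, by simp, s6, s7,
          s8.trans (Nat.le_succ _), by simp, by simp, ?_⟩
        · rw [Tree.keys_mk]
          simpa using hbd
        · exact nodeOK_mk.2 ⟨by omega, by omega, y3, hkids⟩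
        · rw [hfull, Tree.full_mk]
          simp only [childSum_append, childSum_cons, childSum_nil, List.length_nil, hlen]
          omega
      · have hR1 : 1 ≤ R.length := List.length_pos_iff.2 hR
        have hI : (interleave (l ++ [(e, p.val.1.1)]) (insertions R)).val =
            (l ++ [(e, p.val.1.1)]) ++ R := by
          refine interleave_append_insertions R _ fun q hq x hx => ?_
          have hx' : e.1 < x.1.1 := by
            refine WithBot.coe_lt_coe.1 (s2.2 x.1.1 ?_).1
            simp only [List.mem_append, flatKeys, List.mem_flatMap]
            exact Or.inr ⟨x, hx, by simp⟩
          rcases List.mem_append.1 hq with hq | hq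
          · refine lt_trans ?_ hx'
            refine WithTop.coe_lt_coe.1 (k1.2 q.1.1 ?_).2
            simp only [List.mem_append, flatKeys, List.mem_flatMap]
            exact Or.inr ⟨q, hq, by simp⟩
          · rw [List.mem_singleton.1 hq]
            exact hx'
        obtain ⟨R', r1, r2, -⟩ := processTarget_spec hμ loc f (l ++ [(e, p.val.1.1)])
          (insertions R) y3 (by
            rw [hI]
            intro q hq
            rcases List.mem_append.1 hq with hq | hq
            · exact hkids q hq
            · exact s5 q hq)
        have hcost := (processTarget_cost hμ loc f (l ++ [(e, p.val.1.1)]) (insertions R)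
          (by omega)).1
        rw [hI] at r2
        obtain ⟨p1, -, p2⟩ := r2.potential hμ (n := l.length + 1) (m := R.length)
          (by rw [List.length_append, hlen]) (by omega) hR1
        have htop := s9 hR
        rw [r1, insertions_length, insertions_length] at hcost
        refine ⟨w, R', hwb, ?_⟩
        obtain ⟨z, hz, hq⟩ := hstep1 (by
          rw [s1]
          simpa [insertions] using hR)
        subst hz
        rw [s1] at hq
        subst hq
        refine ⟨r1, ?_, r2.nodeOK a ha (by simp; omega), r2.nodeOK_of_ne_nil, r2.arityOK, ?_, ?_,
          ?_, fun _ => rfl, ?_, ?_⟩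
        · rw [r2.keys_eq, flatKeys_append, flatKeys_append, flatKeys_cons, flatKeys_nil]
          simpa using hbd
        · simp only
          rw [htop] at s6
          simp only [Nat.mul_add] at s6 ⊢
          omega
        · simp only; omega
        · simp only; omega
        · omega
        · simp only [childSum_append, childSum_cons, childSum_nil] at p2
          simp only [hfull]
          omega

/-! ### New roots -/

/-- A new root starts without entries, and then strictly fewer treelets leave than arrive (the case
`n = 0` of `TargetSpec.potential`); so the fuel suffices and the height grows by at most `R.length`.
An old root that gets siblings must meet the arity bound `μ` of other nodes, which it does because
it was split. -/
theorem growRoot_spec {μ : ℕ} (hμ : 2 ≤ μ) : ∀ (n h : ℕ) (y : Tree T V (h + 1))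
    (R : List ((T × V) × Tree T V (h + 1))), R.length ≤ n →
    Bounded ⊥ ⊤ (Tree.keys (h + 1) y ++ flatKeys (Tree.keys (h + 1)) R) →
    NodeOK μ (rootMin h) h y → (R ≠ [] → NodeOK μ μ h y) →
    (∀ x ∈ R, Tree.ArityOK μ (h + 1) x.2) →
    (growRoot μ n h y (insertions R)).val.Valid μ ∧
    h ≤ (growRoot μ n h y (insertions R)).val.height ∧
    (R = [] → (growRoot μ n h y (insertions R)).val.height = h) ∧
    (growRoot μ n h y (insertions R)).val.height ≤ h + R.length ∧
    (growRoot μ n h y (insertions R)).val.height +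
      (growRoot μ n h y (insertions R)).val.full μ ≤
        h + (Tree.full μ (h + 1) y + childSum (Tree.full μ (h + 1)) R) + 2 * R.length ∧
    (growRoot μ n h y (insertions R)).time + 10 * μ * h ≤
      9 * R.length + 10 * μ * (growRoot μ n h y (insertions R)).val.height := by
  intro n
  induction n with
  | zero =>
    intro h y R hn hk hy _ _
    have hR : R = [] := List.length_eq_zero_iff.1 (by omega)
    subst hR
    rw [flatKeys_nil, List.append_nil] at hk
    have e : growRoot μ 0 h y (insertions ([] : List ((T × V) × Tree T V (h + 1)))) =
      pure ⟨h, y⟩ := rfl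
    rw [e]
    refine ⟨(window_valid_iff hμ _).2 ⟨hy, hk.1⟩, le_rfl, fun _ => rfl, by simp, ?_, by simp⟩
    simp [Window.full]
  | succ n ih =>
    intro h y R hn hk hy hy' hR'
    by_cases hR : R = []
    · subst hR
      rw [flatKeys_nil, List.append_nil] at hk
      have e : growRoot μ (n + 1) h y (insertions ([] : List ((T × V) × Tree T V (h + 1)))) =
        pure ⟨h, y⟩ := rfl
      rw [e]
      refine ⟨(window_valid_iff hμ _).2 ⟨hy, hk.1⟩, le_rfl, fun _ => rfl, by simp, ?_, by simp⟩
      simp [Window.full]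
    · have hR1 : 1 ≤ R.length := List.length_pos_iff.2 hR
      have hemp : (insertions R).isEmpty = false := by
        cases R with
        | nil => exact absurd rfl hR
        | cons _ _ => rfl
      have e : growRoot μ (n + 1) h y (insertions R) =
          (processTarget μ (h + 1) ⟨true, true⟩ y [] (insertions R) >>= fun p =>
            growRoot μ n (h + 1) p.1 p.2) := by
        rw [growRoot, hemp]
        rfl
      rw [e]
      have hI := interleave_nil_insertions R
      obtain ⟨R', r1, r2, -⟩ := processTarget_spec hμ ⟨true, true⟩ y [] (insertions R)
        (arityOK_succ.2 (hy' hR)) (by rw [hI]; exact hR')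
      have hcost := (processTarget_cost hμ ⟨true, true⟩ y [] (insertions R)
        (by simp; omega)).1
      rw [hI] at r2
      obtain ⟨-, p1, p2⟩ := r2.potential hμ (n := 0) (m := R.length) (by simp) (by omega) hR1
      have p1 := p1 rfl
      rw [r1, insertions_length, insertions_length] at hcost
      simp only [Timed.val_bind, Timed.time_bind]
      rw [r1]
      generalize processTarget μ (h + 1) ⟨true, true⟩ y [] (insertions R) = p at *
      obtain ⟨i1, i2, i3, i4, i5, i6⟩ := ih (h + 1) p.val.1 R' (by omega)
        (by rw [r2.keys_eq]; exact hk) (r2.nodeOK _ ((rootMin_le_two _).trans hμ)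
          ((rootMin_le_two _).trans (by omega))) r2.nodeOK_of_ne_nil r2.arityOK
      generalize growRoot μ n (h + 1) p.val.1 (insertions R') = g at *
      rw [fullInd_eq_zero (n := 0) (by omega)] at p2
      simp only [Nat.mul_add] at i6
      refine ⟨i1, by omega, fun h => absurd h hR, by omega, by omega, by omega⟩

end spine

/-! ### The pass down -/

section passdown

variable {T V : Type u} [Monoid V]

/-- A repaired node costs `2 * arity + 1 ≤ 4 μ + 1` steps; nodes above `top` cost nothing. -/
theorem repairRight_time_le {μ : ℕ} (top : ℕ) : ∀ (h : ℕ) (x : V) (y : Tree T V h),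
    Tree.ArityOK μ h y → (repairRight top h x y).time ≤ (4 * μ + 1) * min top h
  | 0, _, _, _ => by simp [repairRight]
  | h + 1, x, y, hy => by
    have ih := fun x => repairRight_time_le top h x (Node.last y) (arityOK_succ.1 hy).last
    have h1 : Node.arity y ≤ 2 * μ := hy.2.1
    unfold repairRight
    split
    · rename_i hle
      rw [min_eq_right (by omega)] at ih
      rw [min_eq_right hle, Nat.mul_succ]
      have := ih (x * y.first.agg * innerAgg h y.rest)
      change 2 * Node.arity y + 1 + (0 + ((repairRight top h (x * y.first.agg * innerAgg h y.rest)
        (Node.last y)).time + 0)) ≤ _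
      omega
    · rw [min_eq_left (by omega)] at ih ⊢
      have := ih y.agg
      change 0 + ((repairRight top h y.agg (Node.last y)).time + 0) ≤ _
      omega

theorem repairLeft_time_le {μ : ℕ} (top : ℕ) : ∀ (h : ℕ) (x : V) (y : Tree T V h),
    Tree.ArityOK μ h y → (repairLeft top h x y).time ≤ (4 * μ + 1) * h
  | 0, _, _, _ => by simp [repairLeft]
  | h + 1, x, y, hy => by
    have ih := fun x => repairLeft_time_le top h x y.first hy.2.2.1
    have h1 : Node.arity y ≤ 2 * μ := hy.2.1
    unfold repairLeft
    rw [Nat.mul_succ]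
    split
    · have := ih (innerAgg h y.rest * (Node.last y).agg * x)
      change 2 * Node.arity y + 1 + (0 + ((repairLeft top h
        (innerAgg h y.rest * (Node.last y).agg * x) y.first).time + 0)) ≤ _
      omega
    · have := ih y.agg
      change 0 + ((repairLeft top h y.agg y.first).time + 0) ≤ _
      omega

theorem passDown_time_le {μ a : ℕ} (top : ℕ) (left : Bool) (F : Window T V)
    (hF : NodeOK μ a F.height F.root) : (passDown top left F).time ≤
      (4 * μ + 1) * top + if left then (4 * μ + 1) * F.height else 0 := by
  obtain ⟨h, y⟩ := F
  have h1 := repairRight_time_le top h 1 (Node.last y) hF.last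
  have h2 : (4 * μ + 1) * min top h ≤ (4 * μ + 1) * top :=
    Nat.mul_le_mul_left _ (min_le_left _ _)
  have hR : Tree.skel (h + 1) (Node.setLast y (repairRight top h 1 (Node.last y)).val) =
      Tree.skel (h + 1) y :=
    Tree.skel_setLast h y.agg y _ (Tree.skel_repairRight top h _ _)
  have hOK : NodeOK μ a h (Node.setLast y (repairRight top h 1 (Node.last y)).val) :=
    (nodeOK_skel μ a h _).1 (hR ▸ (nodeOK_skel μ a h y).2 hF)
  have h3 := repairLeft_time_le h h 1 _ hOK.2.2.1
  cases left
  · simp only [passDown, Timed.time_bind]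
    simp
    omega
  · simp only [passDown, Timed.time_bind]
    simp
    omega

end passdown

/-! ### Bulk insertion -/

section insertion

variable {T V : Type u} [LinearOrder T]

theorem outOfOrderDistance_eq (F : Window T V) (b : T × V) (B : List (T × V)) :
    outOfOrderDistance F (b :: B) = laterCount b.1 F.keys := by
  simp only [outOfOrderDistance, laterCount, Window.keys, Tree.keys, List.countP_map]
  rfl

theorem outOfOrderDistance_le (F : Window T V) (B : List (T × V)) :
    outOfOrderDistance F B ≤ F.entries.length := by
  cases B with
  | nil => exact Nat.zero_le _
  | cons b B => exact List.countP_le_length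

theorem one_le_rootMin (h : ℕ) : 1 ≤ rootMin h := by unfold rootMin; split <;> omega

theorem two_pow_height_le {μ : ℕ} (hμ : 2 ≤ μ) {F : Window T V} (hF : F.Valid μ) :
    2 ^ F.height ≤ F.entries.length + 1 := by
  obtain ⟨h1, -⟩ := (window_valid_iff hμ F).1 hF
  refine (two_pow_le_size hμ F.height F.root.first h1.2.2.1).trans ?_
  have h2 : F.entries.length = (Tree.keys (F.height + 1) F.root).length := by
    simp [Window.entries, Tree.keys]
  rw [h2, Tree.keys_succ, List.length_append]
  omega

variable [Monoid V]

/-- What a bulk insertion does to the invariants and to the number of nodes of maximal arity, and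
how long it takes, in terms of the height `k` of the walk up from the finger, the workload `w` of
the subtree at that height, and the height `top` of the highest processed node. -/
theorem bulkInsert_spec {μ : ℕ} (hμ : 2 ≤ μ) {F : Window T V} (hF : F.Valid μ) {B : List (T × V)}
    (hB : IsBulk B) :
    ∃ k w top : ℕ, 2 ^ k ≤ 4 * (outOfOrderDistance F B + 1) ∧
      WorkloadBound μ k B.length (outOfOrderDistance F B + 1) w ∧
      (bulkInsert μ F B).val.Valid μ ∧
      (bulkInsert μ F B).time ≤ k + w + 10 * μ * top + (4 * μ + 1) * (2 * top + k) ∧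
      top + (bulkInsert μ F B).val.full μ ≤ k + F.full μ + 2 * w ∧
      top ≤ F.height + 1 + w := by
  obtain ⟨hne, hs⟩ := hB
  match B, hne, hs with
  | b :: B, _, hs =>
  obtain ⟨f1, f2⟩ := (window_valid_iff hμ F).1 hF
  obtain ⟨w, R, hw, hS⟩ := passUpSpine_spec hμ b B hs F.height (rootMin F.height)
    (fingerWalk b.1 F) ⟨true, true⟩ ⊥ F.root ((rootMin_le_two _).trans hμ) le_rfl f1
    (bounded_bot_top.2 f2) (fun x _ => WithBot.bot_lt_coe _) rfl
  have hk : 2 ^ fingerWalk b.1 F ≤ 4 * (laterCount b.1 F.keys + 1) :=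
    two_pow_fingerWalk_le hμ b.1 F.height F.root (f1.mono (one_le_rootMin _)) f2
  rw [outOfOrderDistance_eq]
  refine ⟨fingerWalk b.1 F, w, ?_⟩
  have hw' : WorkloadBound μ (fingerWalk b.1 F) (b :: B).length (laterCount b.1 F.keys + 1) w := by
    intro l
    refine (hw l).trans ?_
    have h1 := lateCount_le_laterCount b.1 F.keys f2
    have h2 : lateCount b.1 (Tree.keys (F.height + 1) F.root) ≤ laterCount b.1 F.keys + 1 := h1
    gcongr
  have e : bulkInsert μ F (b :: B) = (tick (fingerWalk b.1 F) >>= fun _ =>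
      passUpSpine μ (fingerWalk b.1 F) (b :: B) F.height ⟨true, true⟩ F.root >>= fun p =>
      growRoot μ p.1.2.length F.height p.1.1 p.1.2 >>= fun G =>
      if F.height < G.height then passDown G.height true G
      else passDown p.2 (decide (fingerWalk b.1 F = F.height + 1) &&
        !(Node.startsBy F.root b.1)) G) := rfl
  rw [e]
  generalize fingerWalk b.1 F = k at *
  generalize passUpSpine μ k (b :: B) F.height ⟨true, true⟩ F.root = p at *
  obtain ⟨s1, s2, s3, s4, s5, s6, s7, s8, s9, s10, s11⟩ := hS
  obtain ⟨g1, g2, g3, g4, g5, g6⟩ := growRoot_spec hμ R.length F.height p.val.1.1 R le_rfl s2 s3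
    s4 s5
  have e' : growRoot μ p.val.1.2.length F.height p.val.1.1 p.val.1.2 =
    growRoot μ R.length F.height p.val.1.1 (insertions R) := by rw [s1, insertions_length]
  simp only [Timed.val_bind, Timed.time_bind, time_tick]
  rw [e']
  generalize growRoot μ R.length F.height p.val.1.1 (insertions R) = G at *
  have hG := ((window_valid_iff hμ G.val).1 g1).1
  have hfF : F.full μ = Tree.full μ (F.height + 1) F.root := rfl
  split
  · rename_i hlt
    have hsim := passDown_similar G.val.height true G.val
    have ht := passDown_time_le G.val.height true G.val hG
    have hR : R ≠ [] := fun h => by have := g3 h; omega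
    have htop := s9 hR
    rw [if_pos rfl] at ht
    -- After a root split the highest processed node is the new root. Both spines are no longer than
    -- its height, hence `2 * top` in the time bound.
    refine ⟨G.val.height + 1, hk, hw', (hsim.valid_iff hμ).2 g1, ?_, ?_, ?_⟩
    · rw [htop] at s6
      have h1 : 0 ≤ 10 * μ * k := Nat.zero_le _
      have h2 : 0 ≤ (4 * μ + 1) * k := Nat.zero_le _
      have h3 : (4 * μ + 1) * (2 * (G.val.height + 1) + k) =
        2 * ((4 * μ + 1) * G.val.height) + 2 * (4 * μ + 1) + (4 * μ + 1) * k := by ring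
      rw [h3]
      simp only [Nat.mul_add (10 * μ)] at s6 ⊢
      omega
    · rw [hsim.full_eq]
      omega
    · omega
  · rename_i hlt
    generalize hleft : (decide (k = F.height + 1) && !(Node.startsBy F.root b.1)) = left
    have hsim := passDown_similar p.val.2 left G.val
    have ht := passDown_time_le p.val.2 left G.val hG
    have hGh : G.val.height = F.height := by omega
    -- Without a root split the left spine is repaired only if the walk went up to the root, and
    -- then `k` exceeds its length.
    have hl : (if left = true then (4 * μ + 1) * G.val.height else 0) ≤ (4 * μ + 1) * k := by
      split
      · rename_i hl
        rw [hl] at hleft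
        have : k = F.height + 1 := by simpa using (Bool.and_eq_true_iff.1 hleft).1
        exact Nat.mul_le_mul_left _ (by omega)
      · exact Nat.zero_le _
    refine ⟨p.val.2, hk, hw', (hsim.valid_iff hμ).2 g1, ?_, ?_, by omega⟩
    · rw [hGh] at g6
      have h1 : 0 ≤ 10 * μ * k := Nat.zero_le _
      have h3 : (4 * μ + 1) * (2 * p.val.2 + k) =
        2 * ((4 * μ + 1) * p.val.2) + (4 * μ + 1) * k := by ring
      rw [h3]
      omega
    · rw [hsim.full_eq]
      omega

end insertion

/-! ### Logarithms -/

section logarithms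

open Real

/-- The factor 2 is a rounded `1 / log 2`. -/
theorem le_two_mul_log {k : ℕ} {x : ℝ} (h : (2 : ℝ) ^ k ≤ x) : (k : ℝ) ≤ 2 * log x := by
  have h1 : (k : ℝ) * log 2 ≤ log x := by
    rw [← log_pow]
    exact log_le_log (by positivity) h
  have h2 := log_two_gt_d9
  have h3 : (k : ℝ) * (1 / 2) ≤ k * log 2 :=
    mul_le_mul_of_nonneg_left (by linarith) (Nat.cast_nonneg k)
  linarith

theorem walk_le {k d : ℕ} (h : 2 ^ k ≤ 4 * (d + 1)) : (k : ℝ) ≤ 3 + 2 * log⁺ (d : ℝ) := by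
  have hpos : 0 ≤ log⁺ (d : ℝ) := posLog_nonneg
  rcases Nat.lt_or_ge k 3 with hk | hk
  · have : (k : ℝ) ≤ 3 := by exact_mod_cast hk.le
    linarith
  · obtain ⟨j, rfl⟩ := Nat.exists_eq_add_of_le hk
    have hd : 1 ≤ d := by
      by_contra hd
      have hd : d = 0 := by omega
      have : 2 ^ 3 ≤ 2 ^ (3 + j) := Nat.pow_le_pow_right (by omega) (by omega)
      subst hd
      omega
    have h1 : 2 ^ j ≤ d := by
      rw [pow_add] at h
      omega
    have h2 := le_two_mul_log (k := j) (x := d) (by exact_mod_cast h1)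
    have h3 : log (d : ℝ) ≤ log⁺ (d : ℝ) := le_max_right _ _
    push_cast
    linarith

theorem exists_level (d m : ℕ) (hm : 1 ≤ m) : ∃ l : ℕ, ((d : ℝ) + 1) / 2 ^ l ≤ 2 * m ∧
    (l : ℝ) ≤ 1 + 2 * log⁺ ((d : ℝ) / m) := by
  have hpos : 0 ≤ log⁺ ((d : ℝ) / m) := posLog_nonneg
  have hm' : (0 : ℝ) < m := by exact_mod_cast hm
  -- The largest `l` with `2 ^ l * m ≤ d + 1`, or 0 if there is none.
  refine ⟨Nat.log 2 ((d + 1) / m), ?_, ?_⟩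
  · rw [div_le_iff₀ (by positivity)]
    have h1 := Nat.lt_pow_succ_log_self one_lt_two ((d + 1) / m)
    rw [Nat.div_lt_iff_lt_mul hm, pow_succ] at h1
    have h2 : ((d + 1 : ℕ) : ℝ) ≤ ((2 ^ Nat.log 2 ((d + 1) / m) * 2 * m : ℕ) : ℝ) :=
      Nat.cast_le.2 h1.le
    push_cast at h2
    linarith
  · rcases Nat.eq_zero_or_pos (Nat.log 2 ((d + 1) / m)) with h0 | h0
    · rw [h0]
      push_cast
      linarith
    · obtain ⟨j, hj⟩ := Nat.exists_eq_add_of_le' h0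
      have hne : (d + 1) / m ≠ 0 := fun h => by rw [h] at h0; simp at h0
      have h1 := Nat.pow_log_le_self 2 hne
      rw [Nat.le_div_iff_mul_le hm, hj, pow_succ] at h1
      have h2 : 1 ≤ 2 ^ j * m := Nat.mul_pos (by positivity) hm
      -- One factor 2 is given up to replace `d + 1` by `d`; the summand 1 in the bound for `l`
      -- makes up for it.
      have h3 : 2 ^ j * m ≤ d := by
        have : 2 ^ j * 2 * m = 2 * (2 ^ j * m) := by ring
        omega
      have h4 : (2 : ℝ) ^ j ≤ (d : ℝ) / m := by
        rw [le_div_iff₀ hm']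
        exact_mod_cast h3
      have h5 := le_two_mul_log h4
      have h6 : log ((d : ℝ) / m) ≤ log⁺ ((d : ℝ) / m) := le_max_right _ _
      rw [hj]
      push_cast
      linarith

theorem WorkloadBound.le {μ k m d w : ℕ} (h : WorkloadBound μ k m (d + 1) w) (hm : 1 ≤ m)
    (hk : 2 ^ k ≤ 4 * (d + 1)) :
    (w : ℝ) ≤ 320 * μ * (log⁺ (d : ℝ) + m * (1 + log⁺ ((d : ℝ) / m))) ∧
      (k : ℝ) ≤ 3 * (log⁺ (d : ℝ) + m * (1 + log⁺ ((d : ℝ) / m))) := by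
  obtain ⟨l, h1, h2⟩ := exists_level d m hm
  have h3 := walk_le hk
  have hp : 0 ≤ log⁺ (d : ℝ) := posLog_nonneg
  have hq : 0 ≤ log⁺ ((d : ℝ) / m) := posLog_nonneg
  have h4 := h l
  have hm' : (1 : ℝ) ≤ m := by exact_mod_cast hm
  have hμ := Nat.cast_nonneg (α := ℝ) μ
  generalize log⁺ (d : ℝ) = p at *
  generalize log⁺ ((d : ℝ) / m) = q at *
  have hmq : 0 ≤ (m : ℝ) * q := by positivity
  refine ⟨h4.trans ?_, by linarith⟩
  have h5 : (l + 1 : ℝ) * m ≤ (2 + 2 * q) * m :=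
    mul_le_mul_of_nonneg_right (by linarith) (by linarith)
  have h6 : 60 * (μ : ℝ) / 2 ^ l * (d + 1 : ℕ) = 60 * μ * ((d + 1) / 2 ^ l) := by
    push_cast
    ring
  rw [h6]
  -- The terms contribute `80 m`, `120` and `120 m` besides the logarithms; `m ≥ 1` turns the sum
  -- into `320 m`.
  have h7 : (l + 1 : ℝ) * m * 40 + 40 * k + 60 * ((d + 1) / 2 ^ l) ≤
      320 * (p + m * (1 + q)) := by
    linarith
  calc 40 * (μ : ℝ) * (l + 1) * m + 40 * μ * k + 60 * μ * ((d + 1) / 2 ^ l)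
      = μ * ((l + 1 : ℝ) * m * 40 + 40 * k + 60 * ((d + 1) / 2 ^ l)) := by ring
    _ ≤ μ * (320 * (p + m * (1 + q))) := mul_le_mul_of_nonneg_left h7 hμ
    _ = _ := by ring

/-- Bernoulli's inequality gives `1 + n ≤ (1 + n / m) ^ m`. Thus the logarithmic height of the tree
is absorbed by the `m`-term of the worst-case bound. -/
theorem log_succ_le {m n : ℕ} (hm : 1 ≤ m) :
    log ((n : ℝ) + 1) ≤ m * log (((m : ℝ) + n) / m) := by
  have hm' : (0 : ℝ) < m := by exact_mod_cast hm
  rw [← log_pow]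
  refine log_le_log (by positivity) ?_
  have h1 : ((m : ℝ) + n) / m = 1 + n / m := by field_simp
  rw [h1]
  have h2 := one_add_mul_le_pow (a := (n : ℝ) / m)
    (le_trans (by norm_num) (by positivity : (0 : ℝ) ≤ n / m)) m
  have h3 : (m : ℝ) * (n / m) = n := by field_simp
  rw [h3] at h2
  linarith

theorem posLog_div_le {d m n : ℕ} (hm : 1 ≤ m) (hd : d ≤ n) :
    log⁺ ((d : ℝ) / m) ≤ log (((m : ℝ) + n) / m) := by
  have hm' : (0 : ℝ) < m := by exact_mod_cast hm
  have hd' : (d : ℝ) ≤ n := by exact_mod_cast hd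
  have h0 : 0 ≤ log (((m : ℝ) + n) / m) := by
    refine log_nonneg ?_
    rw [le_div_iff₀ hm']
    linarith [Nat.cast_nonneg (α := ℝ) n]
  refine max_le h0 ?_
  rcases Nat.eq_zero_or_pos d with rfl | hd0
  · simpa using h0
  · have : (0 : ℝ) < d := by exact_mod_cast hd0
    refine log_le_log (by positivity) ?_
    gcongr
    linarith

end logarithms

/-! ### The amortized and the worst-case bound -/

section bounds

variable {T V : Type u} [LinearOrder T]

theorem amortizedBound_nonneg (F : Window T V) (B : List (T × V)) : 0 ≤ amortizedBound F B :=
  add_nonneg Real.posLog_nonneg (mul_nonneg (Nat.cast_nonneg _)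
    (add_nonneg zero_le_one Real.posLog_nonneg))

theorem IsBulk.one_le_length {B : List (T × V)} (hB : IsBulk B) : 1 ≤ B.length :=
  List.length_pos_iff.2 hB.1

theorem amortizedBound_le_worstCaseBound (F : Window T V) {B : List (T × V)} (hB : IsBulk B) :
    amortizedBound F B ≤ worstCaseBound F B := by
  have := posLog_div_le hB.one_le_length (outOfOrderDistance_le F B)
  unfold amortizedBound worstCaseBound
  gcongr

theorem height_le_worstCaseBound {μ : ℕ} (hμ : 2 ≤ μ) {F : Window T V} (hF : F.Valid μ)
    {B : List (T × V)} (hB : IsBulk B) : (F.height : ℝ) + 1 ≤ 3 * worstCaseBound F B := by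
  have h1 : ((2 ^ F.height : ℕ) : ℝ) ≤ ((F.entries.length + 1 : ℕ) : ℝ) :=
    Nat.cast_le.2 (two_pow_height_le hμ hF)
  push_cast at h1
  have h2 := le_two_mul_log h1
  have h3 := log_succ_le (n := F.entries.length) hB.one_le_length
  have h4 : (1 : ℝ) ≤ B.length := by exact_mod_cast hB.one_le_length
  have h5 : 0 ≤ Real.posLog (outOfOrderDistance F B : ℝ) := Real.posLog_nonneg
  have h6 : 0 ≤ Real.log ((F.entries.length : ℝ) + 1) :=
    Real.log_nonneg (by linarith [Nat.cast_nonneg (α := ℝ) F.entries.length])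
  unfold worstCaseBound
  linarith

variable [Monoid V]

/-- The factor of the potential in the amortized analysis. -/
def potentialFactor (μ : ℕ) : ℝ := 18 * μ + 2

/-- The factor in the amortized bound. -/
def amortizedFactor (μ : ℕ) : ℝ := (22 * μ + 4) * 3 + (36 * μ + 5) * (320 * μ)

/-- The factor in the worst-case bound. -/
def worstCaseFactor (μ : ℕ) : ℝ := (4 * μ + 2) * 3 + 320 * μ + (18 * μ + 2) * (3 + 320 * μ)

theorem bulkInsert_bounds {μ : ℕ} (hμ : 2 ≤ μ) {F : Window T V} (hF : F.Valid μ)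
    {B : List (T × V)} (hB : IsBulk B) :
    (bulkInsert μ F B).val.Valid μ ∧
    ((bulkInsert μ F B).time : ℝ) + potentialFactor μ * (bulkInsert μ F B).val.full μ ≤
      amortizedFactor μ * amortizedBound F B + potentialFactor μ * F.full μ ∧
    ((bulkInsert μ F B).time : ℝ) ≤ worstCaseFactor μ * worstCaseBound F B := by
  obtain ⟨k, w, top, h1, h2, h3, h4, h5, h6⟩ := bulkInsert_spec hμ hF hB
  refine ⟨h3, ?_⟩
  obtain ⟨hw, hk⟩ := h2.le hB.one_le_length h1
  have hA : Real.posLog (outOfOrderDistance F B : ℝ) + B.length * (1 + Real.posLog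
    ((outOfOrderDistance F B : ℝ) / B.length)) = amortizedBound F B := rfl
  rw [hA] at hw hk
  have hAW := amortizedBound_le_worstCaseBound F hB
  have hH := height_le_worstCaseBound hμ hF hB
  generalize amortizedBound F B = A at *
  generalize worstCaseBound F B = W at *
  have h4' : ((bulkInsert μ F B).time : ℝ) ≤
      k + w + 10 * μ * top + (4 * μ + 1) * (2 * top + k) := by exact_mod_cast h4
  have h5' : (top : ℝ) + (bulkInsert μ F B).val.full μ ≤ k + F.full μ + 2 * w := by
    exact_mod_cast h5
  have h6' : (top : ℝ) ≤ F.height + 1 + w := by exact_mod_cast h6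
  have hμ0 := Nat.cast_nonneg (α := ℝ) μ
  constructor
  -- The coefficient of `top` in the time is `10 μ + 2 (4 μ + 1) = 18 μ + 2`. The potential
  -- inequality trades `top` for `k + 2w`, which raises the coefficient of `k` to `22 μ + 4` and
  -- that of `w` to `36 μ + 5`.
  · have m1 := mul_le_mul_of_nonneg_left h5' (by positivity : (0 : ℝ) ≤ 18 * μ + 2)
    have m2 := mul_le_mul_of_nonneg_left hk (by positivity : (0 : ℝ) ≤ 22 * μ + 4)
    have m3 := mul_le_mul_of_nonneg_left hw (by positivity : (0 : ℝ) ≤ 36 * μ + 5)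
    unfold potentialFactor amortizedFactor
    linarith
  · have hw' : (w : ℝ) ≤ 320 * μ * W :=
      hw.trans (mul_le_mul_of_nonneg_left hAW (by positivity))
    have hk' : (k : ℝ) ≤ 3 * W := by linarith
    -- A single operation has no earlier credit to draw on, so here the height of the tree bounds
    -- the climb.
    have htop : (top : ℝ) ≤ (3 + 320 * μ) * W := by linarith
    have m1 := mul_le_mul_of_nonneg_left htop (by positivity : (0 : ℝ) ≤ 18 * μ + 2)
    have m2 := mul_le_mul_of_nonneg_left hk' (by positivity : (0 : ℝ) ≤ 4 * μ + 2)
    unfold worstCaseFactor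
    linarith

/-- The potential differences telescope along the sequence; the final potential is dropped and the
initial one vanishes for the empty window. -/
theorem totalInsertTime_le {μ : ℕ} (hμ : 2 ≤ μ) : ∀ (ops : List (Op T V)) (F : Window T V),
    F.Valid μ → (∀ op ∈ ops, op.WellFormed) →
    (totalInsertTime μ F ops : ℝ) ≤
      amortizedFactor μ * totalAmortizedBound μ F ops + potentialFactor μ * F.full μ
  | [], F, _, _ => by
    have : 0 ≤ potentialFactor μ * F.full μ := by unfold potentialFactor; positivity
    simpa [totalInsertTime, totalAmortizedBound] using this
  | .insert B :: ops, F, hF, hops => by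
    have hB : IsBulk B := hops (.insert B) (by simp)
    obtain ⟨h1, h2, -⟩ := bulkInsert_bounds hμ hF hB
    have ih := totalInsertTime_le hμ ops _ h1 fun op hop => hops op (by simp [hop])
    simp only [totalInsertTime, totalAmortizedBound]
    push_cast
    linarith
  | .evict t :: ops, F, hF, hops => by
    obtain ⟨h1, h2⟩ := bulkEvict_spec hμ t hF
    have ih := totalInsertTime_le hμ ops _ h1 fun op hop => hops op (by simp [hop])
    simp only [totalInsertTime, totalAmortizedBound]
    have h3 : potentialFactor μ * (bulkEvict μ t F).full μ ≤ potentialFactor μ * F.full μ :=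
      mul_le_mul_of_nonneg_left (Nat.cast_le.2 h2) (by unfold potentialFactor; positivity)
    linarith

theorem totalAmortizedBound_nonneg (μ : ℕ) : ∀ (ops : List (Op T V)) (F : Window T V),
    0 ≤ totalAmortizedBound μ F ops
  | [], _ => le_rfl
  | .insert B :: ops, F =>
    add_nonneg (amortizedBound_nonneg F B) (totalAmortizedBound_nonneg μ ops _)
  | .evict _ :: ops, _ => totalAmortizedBound_nonneg μ ops _

theorem empty_valid {μ : ℕ} (hμ : 2 ≤ μ) :
    (Window.empty : Window T V).Valid μ ∧ (Window.empty : Window T V).full μ = 0 := by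
  refine ⟨⟨⟨Or.inr ⟨rfl, rfl⟩, trivial, fun p hp => trivial⟩, List.Pairwise.nil⟩, ?_⟩
  have : (Window.empty : Window T V).full μ = fullInd μ 0 := rfl
  rw [this]
  exact fullInd_eq_zero (by omega)

end bounds

end FiBA


theorem mainTheorem2 (μ : ℕ) (hμ : 2 ≤ μ) :
    ∃ C : ℝ, ∀ (T V : Type u) [LinearOrder T] [Monoid V],
      (∀ ops : List (FiBA.Op T V), (∀ op ∈ ops, op.WellFormed) →
        (FiBA.totalInsertTime μ FiBA.Window.empty ops : ℝ) ≤
          C * FiBA.totalAmortizedBound μ FiBA.Window.empty ops) ∧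
      (∀ (F : FiBA.Window T V) (B : List (T × V)), F.Valid μ → FiBA.IsBulk B →
        ((FiBA.bulkInsert μ F B).time : ℝ) ≤ C * FiBA.worstCaseBound F B) := by
  -- Both bounds are nonnegative, so the larger factor serves for both parts.
  refine ⟨max (FiBA.amortizedFactor μ) (FiBA.worstCaseFactor μ), fun T V _ _ => ⟨?_, ?_⟩⟩
  · intro ops hops
    obtain ⟨h1, h2⟩ := FiBA.empty_valid (T := T) (V := V) hμ
    have h3 := FiBA.totalInsertTime_le hμ ops _ h1 hops
    rw [h2, Nat.cast_zero, mul_zero, add_zero] at h3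
    exact h3.trans (mul_le_mul_of_nonneg_right (le_max_left _ _)
      (FiBA.totalAmortizedBound_nonneg μ ops _))
  · intro F B hF hB
    obtain ⟨-, -, h⟩ := FiBA.bulkInsert_bounds hμ hF hB
    exact h.trans (mul_le_mul_of_nonneg_right (le_max_right _ _)
      ((FiBA.amortizedBound_nonneg F B).trans (FiBA.amortizedBound_le_worstCaseBound F hB)))
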